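/- **Setting.** A triangle means a nondegenerate closed triangle $T\subset\mathbb R^2$, and $\Pi_1$ is the space of affine functions. Let $(\mathcal A_T)_T$ be a family of linear operators, one for each triangle $T$, mapping continuous functions on $T$ to $\Pi_1$, such that (i) each $\mathcal A_T$ is continuous in the $L^\infty(T)$ norm; (ii) $\mathcal A_{\phi(T)}(f)\circ\phi=\mathcal A_{T}(f\circ\phi)$ for every affine bijection $\phi$ of the plane and every $f\in C(\phi(T))$; (iii) $\mathcal A_T\pi=\pi$ for all $\pi\in\Pi_1$. (Examples: the interpolation operator $I_T$ at the three vertices of $T$; the $L^2(T)$-orthogonal projection onto $\Pi_1$.) For $1\le p\le\infty$ put $e_T(f)_p=\|f-\mathcal A_Tf\|_{L^p(T)}$. Let $\Omega\subset\mathbb R^2$ be a polygonal domain, i.e. a bounded nonempty connected open set whose boundary is contained in a finite union of line segments. A triangulation of $\Omega$ is a finite set of triangles with pairwise disjoint interiors and union $\overline\Omega$ (not necessarily conforming). **Greedy algorithm.** Given a function $f\in C(\overline\Omega)$ and an initial triangulation $\mathcal T_{N_0}$ of $\Omega$ with $N_0$ triangles, for $N\ge N_0$ the triangulation $\mathcal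 T_{N+1}$ is obtained from $\mathcal T_N$ by choosing $T\in\mathcal T_N$ that maximizes $e_T(f)_p$ over $\mathcal T_N$, choosing an edge $e$ of $T$ that minimizes $$d_T(e,f)=\|f-I_{T_e^1}f\|_{L^1(T_e^1)}+\|f-I_{T_e^2}f\|_{L^1(T_e^2)}$$ among the three edges of $T$, where $T_e^1,T_e^2$ are the two triangles obtained by cutting $T$ from the midpoint of $e$ to the opposite vertex, and replacing $T$ by $T_e^1$ and $T_e^2$; ties are broken arbitrarily. The approximant $f_N$ is the function equal to $\mathcal A_Tf$ inside each $T\in\mathcal T_N$. **Theorem.** There is a constant $C<\infty$, depending only on the family $(\mathcal A_T)$, such that for all $1\le p\le\infty$, every polygonal domain $\Omega$, every initial triangulation of $\Omega$, every $m>0$, every $f\in C^2(\overline\Omega)$ with $d^2f(x)\ge m\,I$ for all $x\in\Omega$, and every sequence $(f_N)_{N\ge N_0}$ produced by the greedy algorithm, $$\limsup_{N\to\infty}\,N\,\|f-f_N\|_{L^p(\Omega)}\le C\,\bigl\|\sqrt{\det(d^2f)}\bigr\|_{L^\tau(\Omega)},\qquad \frac1\tau=\frac1p+1 .$$ In particular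 $C$ is independent of $p$, $f$ and $m$ (and of $\Omega$ and the initial triangulation). -/

import Mathlib

open MeasureTheory Filter
open scoped ENNReal NNReal

noncomputable section

namespace GreedyBisection

/-- The Euclidean plane. -/
abbrev Plane : Type := EuclideanSpace ℝ (Fin 2)

/-- Nondegenerate triangles with (ordered) vertices `T.points 0`, `T.points 1`, `T.points 2`.
The closed triangle, as a subset of the plane, is `T.closedInterior`. -/
abbrev Triangle : Type := Affine.Triangle ℝ Plane

/-! ### Bisection of a triangle -/

/-- The edge of `T` opposite the vertex `i` joins the vertices `i + 1` and `i + 2`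
(indices modulo 3); this is its midpoint. -/
def edgeMidpoint (T : Triangle) (i : Fin 3) : Plane :=
  midpoint ℝ (T.points (i + 1)) (T.points (i + 2))

theorem affineIndependent_replace (T : Triangle) (i j : Fin 3) (hj : j = i + 1 ∨ j = i + 2) :
    AffineIndependent ℝ (Function.update T.points j (edgeMidpoint T i)) := by
  apply AffineIndependent.affineIndependent_update_of_notMem_affineSpan T.independent
  obtain ⟨k, hki, hkj, hmid⟩ : ∃ k : Fin 3, k ≠ i ∧ k ≠ j ∧
      edgeMidpoint T i = midpoint ℝ (T.points k) (T.points j) := by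
    rcases hj with rfl | rfl
    · refine ⟨i + 2, ?_, ?_, ?_⟩
      · revert i; decide
      · revert i; decide
      · rw [edgeMidpoint, midpoint_comm]
    · refine ⟨i + 1, ?_, ?_, rfl⟩
      · revert i; decide
      · revert i; decide
  rw [hmid]
  intro hmem
  have hk : T.points k ∈ affineSpan ℝ (T.points '' {x | x ≠ j}) :=
    mem_affineSpan ℝ ⟨k, hkj, rfl⟩
  have h2 : AffineMap.lineMap (T.points k) (midpoint ℝ (T.points k) (T.points j)) (2 : ℝ) =
      T.points j := by
    simp [midpoint, AffineMap.lineMap_apply]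
  have hjm : T.points j ∈ affineSpan ℝ (T.points '' {x | x ≠ j}) := by
    rw [← h2]
    exact AffineMap.lineMap_mem _ hk hmem
  exact T.independent.notMem_affineSpan_sdiff j Set.univ (by
    convert hjm using 3
    ext x; simp)

/-- The first of the two triangles obtained by cutting `T` from the midpoint of the edge opposite the vertex `i`
to the vertex `i`: in each of the two, one endpoint of that edge is replaced by the midpoint. -/
def childLeft (T : Triangle) (i : Fin 3) : Triangle :=
  ⟨Function.update T.points (i + 2) (edgeMidpoint T i),
    affineIndependent_replace T i (i + 2) (Or.inr rfl)⟩

/-- The second of the two triangles obtained by this cut. -/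
def childRight (T : Triangle) (i : Fin 3) : Triangle :=
  ⟨Function.update T.points (i + 1) (edgeMidpoint T i),
    affineIndependent_replace T i (i + 1) (Or.inl rfl)⟩

/-! ### Local interpolation and the decision function -/

/-- The vertices of a triangle as an affine basis of the plane. -/
def vertexBasis (T : Triangle) : AffineBasis (Fin 3) ℝ Plane :=
  ⟨T.points, T.independent,
    T.independent.affineSpan_eq_top_iff_card_eq_finrank_add_one.mpr (by simp)⟩

/-- The affine interpolant `I_T f` of `f` at the vertices of `T` (in barycentric coordinates). -/
def interp (T : Triangle) (f : Plane → ℝ) : Plane →ᵃ[ℝ] ℝ :=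
  ∑ i, f (T.points i) • (vertexBasis T).coord i

/-- `‖f - I_T f‖_{L¹(T)}`. -/
def interpErrorL1 (T : Triangle) (f : Plane → ℝ) : ℝ≥0∞ :=
  eLpNorm (fun x => f x - interp T f x) 1 (volume.restrict T.closedInterior)

/-- The decision function `d_T(e, f)`, where `e` is the edge of `T` opposite the vertex `i`. -/
def decision (f : Plane → ℝ) (T : Triangle) (i : Fin 3) : ℝ≥0∞ :=
  interpErrorL1 (childLeft T i) f + interpErrorL1 (childRight T i) f

/-! ### Local approximation operators -/

/-- `A` is a family of linear operators `A T` (one for each triangle `T`) mapping continuous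
functions on `T` to affine functions, such that each `A T` is continuous in the `L^∞` norm,
the family commutes with affine changes of variables, and affine functions are reproduced.
Functions on `T` are represented by functions on the plane that are continuous on `T`; by `add`,
`smul` and `bounded`, `A T f` depends only on the restriction of `f` to `T`. By `comm` (with `φ` the
identity), `A T` does not depend on the order of the vertices of `T`. -/
structure IsApproxOperator (A : Triangle → (Plane → ℝ) → (Plane →ᵃ[ℝ] ℝ)) : Prop where
  add : ∀ (T : Triangle) (f g : Plane → ℝ), ContinuousOn f T.closedInterior →
    ContinuousOn g T.closedInterior → A T (f + g) = A T f + A T g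
  smul : ∀ (T : Triangle) (c : ℝ) (f : Plane → ℝ), ContinuousOn f T.closedInterior →
    A T (c • f) = c • A T f
  bounded : ∀ T : Triangle, ∃ K : ℝ, ∀ f : Plane → ℝ, ContinuousOn f T.closedInterior →
    ∀ M : ℝ, (∀ x ∈ T.closedInterior, |f x| ≤ M) → ∀ x ∈ T.closedInterior, |A T f x| ≤ K * M
  comm : ∀ (T T' : Triangle) (φ : Plane ≃ᵃ[ℝ] Plane), φ '' T.closedInterior = T'.closedInterior →
    ∀ f : Plane → ℝ, ContinuousOn f T'.closedInterior →
      ∀ x : Plane, A T' f (φ x) = A T (fun y => f (φ y)) x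
  repro : ∀ (T : Triangle) (π : Plane →ᵃ[ℝ] ℝ), A T π = π

/-- The local error `e_T(f)_p = ‖f - A_T f‖_{L^p(T)}`. -/
def localError (A : Triangle → (Plane → ℝ) → (Plane →ᵃ[ℝ] ℝ)) (p : ℝ≥0∞) (f : Plane → ℝ)
    (T : Triangle) : ℝ≥0∞ :=
  eLpNorm (fun x => f x - A T f x) p (volume.restrict T.closedInterior)

/-- The piecewise affine approximant which equals `A_T f` inside each triangle `T` of the
triangulation `S` (its value on the edges, a null set, is irrelevant). -/
def approximant (A : Triangle → (Plane → ℝ) → (Plane →ᵃ[ℝ] ℝ)) (f : Plane → ℝ)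
    (S : Finset Triangle) : Plane → ℝ :=
  fun x => ∑ T ∈ S, (interior T.closedInterior).indicator (A T f) x

/-! ### Domains, triangulations, the greedy algorithm -/

/-- A (bounded) polygonal domain: a bounded nonempty connected open set whose boundary is contained
in a finite union of line segments. -/
structure IsPolygonalDomain (Ω : Set Plane) : Prop where
  isOpen : IsOpen Ω
  isConnected : IsConnected Ω
  isBounded : Bornology.IsBounded Ω
  frontier_subset : ∃ E : Finset (Plane × Plane), frontier Ω ⊆ ⋃ e ∈ E, segment ℝ e.1 e.2

/-- `S` is a (not necessarily conforming) triangulation of `Ω`: the triangles have pairwise disjoint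
interiors and their union is the closure of `Ω`. -/
structure IsTriangulation (S : Finset Triangle) (Ω : Set Plane) : Prop where
  disjoint : (S : Set Triangle).PairwiseDisjoint fun T => interior T.closedInterior
  union : ⋃ T ∈ S, T.closedInterior = closure Ω

open Classical in
/-- `S'` is obtained from `S` by one step of the greedy algorithm: a triangle of `S` with maximal
local `L^p` error is bisected from the midpoint of an edge that minimizes the decision function.
Ties may be broken in any way. -/
def GreedyStep (A : Triangle → (Plane → ℝ) → (Plane →ᵃ[ℝ] ℝ)) (p : ℝ≥0∞) (f : Plane → ℝ)
    (S S' : Finset Triangle) : Prop :=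
  ∃ T ∈ S, (∀ T' ∈ S, localError A p f T' ≤ localError A p f T) ∧
    ∃ i : Fin 3, (∀ j : Fin 3, decision f T i ≤ decision f T j) ∧
      S' = S.erase T ∪ {childLeft T i, childRight T i}

/-- `(𝒯 N)`, for `N ≥ N₀ = #(S₀)`, is a sequence of triangulations produced by the greedy algorithm
from the initial triangulation `S₀` (the values `𝒯 N` for `N < N₀` are irrelevant). Each step
increases the number of triangles by one, so that `𝒯 N` has `N` elements. -/
structure IsGreedyRun (A : Triangle → (Plane → ℝ) → (Plane →ᵃ[ℝ] ℝ)) (p : ℝ≥0∞) (f : Plane → ℝ)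
    (S₀ : Finset Triangle) (𝒯 : ℕ → Finset Triangle) : Prop where
  start : 𝒯 S₀.card = S₀
  step : ∀ N, S₀.card ≤ N → GreedyStep A p f (𝒯 N) (𝒯 (N + 1))

/-! ### The hessian -/

/-- The hessian matrix `d²f(x)`. -/
def hessian (f : Plane → ℝ) (x : Plane) : Matrix (Fin 2) (Fin 2) ℝ :=
  Matrix.of fun i j =>
    iteratedFDeriv ℝ 2 f x ![EuclideanSpace.single i 1, EuclideanSpace.single j 1]

end GreedyBisection

end

/-! For convex `f` the interpolation error has a sign, so the decision function of an edge is a term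
common to the three edges minus a third of the area times the second difference of `f` along that
edge (`decision_eq`). The algorithm thus bisects an edge of largest second difference. Where `f` is
within one percent of the quadratic form of a frozen hessian `H` (`NearQuadratic`), this is a nearly
longest edge in the metric of `H`.

Anisotropy in that metric is measured by `triShape`, the sum of the squared edge lengths minus half
the largest. For a bisected nearly longest edge, the values of the two children add up to at most
19/20 of that of the parent plus a multiple of its area in the metric (`triShape_children_le`). Thin
triangles thus lose their excess geometrically.

The local error on `T` is comparable to `maxEdge H T * |T|^(1/p)`, uniformly in `p`
(`NearQuadratic.toReal_localError`), and this quantity does not increase under bisection. Hence the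
largest error `η` at stage `N` is at most a constant times the error of any triangle bisected
earlier. For a small triangle `R`, let `c k` count the bisected triangles of generation `k` below
`R`, let `w k` be the normalized sum of their shapes, and let `Λ = |R| (√det H / η)^τ`. Then `c k ≤
2^k`, `c k ≤ B Λ (Λ/2^k)^(1/p) w k` and `w (k+1) ≤ 19/20 w k + C c k / 2^k`. For large `Λ` this
forces `∑ c k ≤ G Λ`, with `G` independent of `R` and `p` (`exists_sum_count_le`): generations with
`2^k` up to the order of `Λ` are bounded trivially, and from then on `w` decays geometrically.
Summed over `R`, `N η^τ` is bounded by a Riemann sum for the integral of `√det(d²f)^τ`, and `‖f -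
f_N‖_p ≤ N^(1/p) η` concludes.

All this starts at a stage where every triangle is small, and such a stage must be shown to exist
while `f` is not yet nearly quadratic. Strong convexity alone shows that on a long triangle of small
area an edge of nearly maximal euclidean length is cut (`StronglyConvexC2.exists_flat`), so
triangles of high generation have small diameter. A pigeonhole argument makes some high generation
triangle get bisected; all errors are small at that moment, whereas a triangle of low generation has
an error bounded below (`GreedySeq.exists_generation_ge`). -/

noncomputable section

namespace GreedyBisection

section

/-! ### Edges, areas and affine maps -/

/-- The edge vector of `T` opposite the vertex `i`. -/
def edge (T : Triangle) (i : Fin 3) : Plane := T.points (i + 2) - T.points (i + 1)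

/-- The determinant of two plane vectors. -/
def cross (u v : Plane) : ℝ := u 0 * v 1 - u 1 * v 0

/-- The area of a triangle. -/
def area (T : Triangle) : ℝ := (volume T.closedInterior).toReal

theorem vertexBasis_apply (T : Triangle) (i : Fin 3) : vertexBasis T i = T.points i := rfl

theorem convex_triangle (T : Triangle) : Convex ℝ T.closedInterior := by
  rw [← Affine.Simplex.convexHull_eq_closedInterior]; exact convex_convexHull _ _

theorem interior_triangle_nonempty (T : Triangle) : (interior T.closedInterior).Nonempty := by
  rw [← Affine.Simplex.convexHull_eq_closedInterior,
    interior_convexHull_nonempty_iff_affineSpan_eq_top]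
  exact (vertexBasis T).tot

theorem measurableSet_triangle (T : Triangle) : MeasurableSet T.closedInterior :=
  T.isClosed_closedInterior.measurableSet

theorem volume_triangle_ne_top (T : Triangle) : volume T.closedInterior ≠ ⊤ :=
  T.isCompact_closedInterior.measure_lt_top.ne

theorem volume_triangle_ne_zero (T : Triangle) : volume T.closedInterior ≠ 0 :=
  ((IsOpen.measure_pos _ isOpen_interior (interior_triangle_nonempty T)).trans_le
    (measure_mono interior_subset)).ne'

theorem area_pos (T : Triangle) : 0 < area T :=
  ENNReal.toReal_pos (volume_triangle_ne_zero T) (volume_triangle_ne_top T)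

theorem volume_triangle (T : Triangle) : volume T.closedInterior = ENNReal.ofReal (area T) :=
  (ENNReal.ofReal_toReal (volume_triangle_ne_top T)).symm

theorem triangle_subset {T : Triangle} {s : Set Plane} (hs : Convex ℝ s)
    (h : ∀ i, T.points i ∈ s) : T.closedInterior ⊆ s := by
  rw [← Affine.Simplex.convexHull_eq_closedInterior]
  exact convexHull_min (by rintro _ ⟨i, rfl⟩; exact h i) hs

theorem exists_affineEquiv (T T' : Triangle) :
    ∃ φ : Plane ≃ᵃ[ℝ] Plane, ∀ i, φ (T.points i) = T'.points i := by
  let b := (vertexBasis T).basisOf 0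
  let b' := (vertexBasis T').basisOf 0
  let L : Plane ≃ₗ[ℝ] Plane := b.equiv b' (Equiv.refl _)
  refine ⟨L.toAffineEquiv.trans (AffineEquiv.constVAdd ℝ _ (T'.points 0 - L (T.points 0))), ?_⟩
  intro i
  by_cases hi : i = 0
  · subst hi; simp
  · have : L (T.points i - T.points 0) = T'.points i - T'.points 0 := by
      have h1 : b ⟨i, hi⟩ = T.points i - T.points 0 := by simp [b, vertexBasis_apply]
      have h2 : b' ⟨i, hi⟩ = T'.points i - T'.points 0 := by simp [b', vertexBasis_apply]
      rw [← h1, ← h2]; simp [L]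
    rw [map_sub] at this
    simp only [AffineEquiv.trans_apply, LinearEquiv.coe_toAffineEquiv, AffineEquiv.constVAdd_apply,
      vadd_eq_add]
    rw [sub_add_eq_add_sub, add_sub_assoc, this]; abel

theorem image_triangle (T T' : Triangle) (φ : Plane ≃ᵃ[ℝ] Plane)
    (h : ∀ i, φ (T.points i) = T'.points i) : φ '' T.closedInterior = T'.closedInterior := by
  rw [← Affine.Simplex.convexHull_eq_closedInterior, ← Affine.Simplex.convexHull_eq_closedInterior]
  have := (φ : Plane →ᵃ[ℝ] Plane).image_convexHull (Set.range T.points)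
  simp only [AffineEquiv.coe_toAffineMap] at this
  rw [this, ← Set.range_comp]
  congr 2
  ext1 i
  exact h i

theorem affineEquiv_apply (φ : Plane ≃ᵃ[ℝ] Plane) (x : Plane) :
    φ x = φ.linear x + φ 0 := by
  simpa using φ.map_vadd 0 x

theorem volume_image_affineEquiv (φ : Plane ≃ᵃ[ℝ] Plane) (s : Set Plane) :
    volume (φ '' s) = ENNReal.ofReal |LinearMap.det (φ.linear : Plane →ₗ[ℝ] Plane)| * volume s := by
  have : φ '' s = (fun y => y + φ 0) '' ((φ.linear : Plane →ₗ[ℝ] Plane) '' s) := by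
    rw [Set.image_image]
    exact Set.image_congr fun x _ => affineEquiv_apply φ x
  rw [this, Set.image_add_right, measure_preimage_add_right, Measure.addHaar_image_linearMap]

theorem cross_map (L : Plane →ₗ[ℝ] Plane) (u v : Plane) :
    cross (L u) (L v) = LinearMap.det L * cross u v := by
  let b := (EuclideanSpace.basisFun (Fin 2) ℝ).toBasis
  have hdec : ∀ w : Plane, L w = w 0 • L (b 0) + w 1 • L (b 1) := by
    intro w
    rw [← map_smul L, ← map_smul L, ← map_add]
    congr 1
    ext i; fin_cases i <;> simp [b]
  have hdet : LinearMap.det L = L (b 0) 0 * L (b 1) 1 - L (b 1) 0 * L (b 0) 1 := by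
    rw [← LinearMap.det_toMatrix b, Matrix.det_fin_two]
    simp [LinearMap.toMatrix_apply, b]
  rw [hdec u, hdec v, hdet]
  simp only [cross, PiLp.add_apply, PiLp.smul_apply, smul_eq_mul]
  ring

theorem cross_edge (T : Triangle) (i : Fin 3) :
    cross (edge T i) (edge T (i + 1)) = cross (edge T 0) (edge T 1) := by
  fin_cases i <;> simp [cross, edge] <;> ring

/-- A triangle of reference. -/
theorem exists_triangle : Nonempty Triangle := by
  obtain ⟨b⟩ := AffineBasis.exists_affineBasis_of_finiteDimensional (k := ℝ) (P := Plane)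
    (ι := Fin 3) (by simp)
  exact ⟨⟨b, b.ind⟩⟩

/-- Both sides are multiplied by the absolute value of the determinant under an affine bijection, so
one reference triangle settles the ratio. The value 1/2 of `ω` is never needed. -/
theorem exists_area_eq : ∃ ω : ℝ, 0 < ω ∧
    ∀ T : Triangle, area T = ω * |cross (edge T 0) (edge T 1)| := by
  obtain ⟨T₀⟩ := exists_triangle
  have key : ∀ T : Triangle, ∃ d : ℝ, 0 ≤ d ∧ area T = d * area T₀ ∧
      |cross (edge T 0) (edge T 1)| = d * |cross (edge T₀ 0) (edge T₀ 1)| := by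
    intro T
    obtain ⟨φ, hφ⟩ := exists_affineEquiv T₀ T
    refine ⟨|LinearMap.det (φ.linear : Plane →ₗ[ℝ] Plane)|, abs_nonneg _, ?_, ?_⟩
    · rw [area, ← image_triangle T₀ T φ hφ, volume_image_affineEquiv, ENNReal.toReal_mul,
        ENNReal.toReal_ofReal (abs_nonneg _), area]
    · have he : ∀ i, edge T i = φ.linear (edge T₀ i) := fun i => by
        rw [edge, edge, ← hφ, ← hφ, affineEquiv_apply φ (T₀.points (i + 2)),
          affineEquiv_apply φ (T₀.points (i + 1)), map_sub]
        abel
      rw [← abs_mul, ← cross_map, he, he]; rfl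
  have hc : 0 < |cross (edge T₀ 0) (edge T₀ 1)| := by
    refine (abs_nonneg _).lt_of_ne fun h => ?_
    have hli := (affineIndependent_iff_linearIndependent_vsub ℝ T₀.points 0).mp T₀.independent
    have hx : cross (edge T₀ 0) (edge T₀ 1) = 0 := abs_eq_zero.mp h.symm
    set u := T₀.points 1 - T₀.points 0 with hu
    set v := T₀.points 2 - T₀.points 0 with hv
    have hx' : u 0 * v 1 - u 1 * v 0 = 0 := by
      have : cross (edge T₀ 0) (edge T₀ 1) = u 0 * v 1 - u 1 * v 0 := by
        simp [cross, edge, hu, hv]; ring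
      linarith
    have hli2 : LinearIndependent ℝ ![u, v] := by
      have := hli.comp (![⟨1, by decide⟩, ⟨2, by decide⟩] : Fin 2 → {x : Fin 3 // x ≠ 0}) (by
        intro a b; fin_cases a <;> fin_cases b <;> simp)
      have h2 : ![u, v] = (fun i : {x : Fin 3 // x ≠ 0} => T₀.points ↑i -ᵥ T₀.points 0) ∘
          (![⟨1, by decide⟩, ⟨2, by decide⟩] : Fin 2 → {x : Fin 3 // x ≠ 0}) := by
        ext1 j; fin_cases j <;> simp [hu, hv]
      rw [h2]; exact this
    rw [LinearIndependent.pair_iff] at hli2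
    -- A vanishing determinant yields the relations `v₁ u = u₁ v` and `v₀ u = u₀ v`; independence
    -- then forces `v = 0`.
    have h1 := hli2 (v 1) (-(u 1)) (by ext k; fin_cases k <;> simp <;> linarith)
    have h2 := hli2 (v 0) (-(u 0)) (by ext k; fin_cases k <;> simp <;> linarith)
    have hv0 : v = 0 := by ext k; fin_cases k <;> simp [h1.1, h2.1]
    have h3 := hli2 0 1 (by simp [hv0])
    simp at h3
  refine ⟨area T₀ / |cross (edge T₀ 0) (edge T₀ 1)|, div_pos (area_pos _) hc, fun T => ?_⟩
  obtain ⟨d, -, h1, h2⟩ := key T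
  rw [h1, h2]; field_simp

theorem setIntegral_image_affineEquiv (φ : Plane ≃ᵃ[ℝ] Plane) {s : Set Plane}
    (hs : MeasurableSet s) (g : Plane → ℝ) :
    ∫ x in φ '' s, g x = |LinearMap.det (φ.linear : Plane →ₗ[ℝ] Plane)| * ∫ x in s, g (φ x) := by
  let L : Plane →L[ℝ] Plane := LinearMap.toContinuousLinearMap (φ.linear : Plane →ₗ[ℝ] Plane)
  have hd : ∀ x ∈ s, HasFDerivWithinAt φ L s x := by
    intro x _
    have h : (φ : Plane → Plane) = fun x => L x + φ 0 := by
      ext1 x; exact affineEquiv_apply φ x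
    rw [h]
    exact (L.hasFDerivAt.add_const _).hasFDerivWithinAt
  rw [integral_image_eq_integral_abs_det_fderiv_smul volume hs hd φ.injective.injOn,
    integral_smul, smul_eq_mul]
  rfl

/-- Each permutation of the vertices is realized by an affine map preserving `T`, hence preserving
area, so the three barycentric coordinates have equal integrals. They sum to 1. -/
theorem setIntegral_coord (T : Triangle) (i : Fin 3) :
    ∫ x in T.closedInterior, (vertexBasis T).coord i x = area T / 3 := by
  have hint : ∀ i, IntegrableOn (fun x => (vertexBasis T).coord i x) T.closedInterior := fun i =>
    (((vertexBasis T).coord i).continuous_of_finiteDimensional.continuousOn).integrableOn_compact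
      T.isCompact_closedInterior
  have hperm : ∀ σ : Equiv.Perm (Fin 3), ∫ x in T.closedInterior, (vertexBasis T).coord i x =
      ∫ x in T.closedInterior, (vertexBasis T).coord (σ i) x := by
    intro σ
    obtain ⟨φ, hφ⟩ := exists_affineEquiv T (T.reindex σ)
    have him := image_triangle _ _ φ hφ
    rw [Affine.Simplex.closedInterior_reindex] at him
    have hvol := volume_image_affineEquiv φ T.closedInterior
    rw [him] at hvol
    have hdet : |LinearMap.det (φ.linear : Plane →ₗ[ℝ] Plane)| = 1 := by
      have := congrArg ENNReal.toReal hvol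
      rw [ENNReal.toReal_mul, ENNReal.toReal_ofReal (abs_nonneg _)] at this
      have h0 := area_pos T
      rw [area] at h0
      exact (mul_right_cancel₀ h0.ne' (by linarith)).symm
    have h2 := setIntegral_image_affineEquiv φ (measurableSet_triangle T)
      (fun x => (vertexBasis T).coord i x)
    rw [him, hdet, one_mul] at h2
    rw [h2]
    congr 1
    ext1 x
    have : (((vertexBasis T).coord i).comp (φ : Plane →ᵃ[ℝ] Plane)) = (vertexBasis T).coord (σ i) := by
      refine AffineMap.ext_on (s := Set.range (vertexBasis T)) (vertexBasis T).tot ?_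
      rintro _ ⟨j, rfl⟩
      simp only [AffineMap.comp_apply, AffineEquiv.coe_toAffineMap]
      have : φ (vertexBasis T j) = vertexBasis T (σ.symm j) := hφ j
      rw [this, AffineBasis.coord_apply, AffineBasis.coord_apply]
      simp [Equiv.eq_symm_apply]
    rw [← this]; rfl
  have hsum : ∑ j, ∫ x in T.closedInterior, (vertexBasis T).coord j x = area T := by
    rw [← integral_finsetSum _ fun j _ => hint j]
    simp [AffineBasis.sum_coord_apply_eq_one, area, Measure.real]
  have hall : ∀ j, ∫ x in T.closedInterior, (vertexBasis T).coord j x =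
      ∫ x in T.closedInterior, (vertexBasis T).coord i x := fun j => by
    rw [hperm (Equiv.swap i j), Equiv.swap_apply_left]
  rw [Finset.sum_congr rfl fun j _ => hall j] at hsum
  simp at hsum
  linarith

theorem affineMap_eq_sum (T : Triangle) (π : Plane →ᵃ[ℝ] ℝ) (x : Plane) :
    π x = ∑ i, π (T.points i) * (vertexBasis T).coord i x := by
  conv_lhs => rw [← (vertexBasis T).linear_combination_coord_eq_self x]
  have h := (vertexBasis T).sum_coord_apply_eq_one x
  have h2 := (vertexBasis T).affineCombination_coord_eq_self x
  have := Finset.univ.map_affineCombination (k := ℝ) (vertexBasis T)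
    (fun i => (vertexBasis T).coord i x) h π
  rw [h2] at this
  rw [(vertexBasis T).linear_combination_coord_eq_self x, this,
    Finset.affineCombination_eq_linear_combination _ _ _ h]
  simp [vertexBasis_apply, mul_comm]

theorem setIntegral_affineMap (T : Triangle) (π : Plane →ᵃ[ℝ] ℝ) :
    ∫ x in T.closedInterior, π x = area T / 3 * ∑ i, π (T.points i) := by
  rw [setIntegral_congr_fun (measurableSet_triangle T) fun x _ => affineMap_eq_sum T π x,
    integral_finsetSum]
  · simp_rw [integral_const_mul, setIntegral_coord, ← Finset.sum_mul]
    ring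
  · intro i _
    exact (((((vertexBasis T).coord i).continuous_of_finiteDimensional).const_mul _).continuousOn).integrableOn_compact
      T.isCompact_closedInterior

end

section

/-! ### Quadratic forms and the shape functional -/

/-- The quadratic form of a `2 × 2` matrix. -/
def qf (H : Matrix (Fin 2) (Fin 2) ℝ) (v : Plane) : ℝ :=
  H 0 0 * v 0 ^ 2 + (H 0 1 + H 1 0) * (v 0 * v 1) + H 1 1 * v 1 ^ 2

theorem qf_smul (H : Matrix (Fin 2) (Fin 2) ℝ) (c : ℝ) (v : Plane) :
    qf H (c • v) = c ^ 2 * qf H v := by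
  simp only [qf, PiLp.smul_apply, smul_eq_mul]; ring

theorem qf_neg (H : Matrix (Fin 2) (Fin 2) ℝ) (v : Plane) : qf H (-v) = qf H v := by
  simp only [qf, PiLp.neg_apply]; ring

theorem qf_add_sub (H : Matrix (Fin 2) (Fin 2) ℝ) (u v : Plane) :
    qf H (u + v) + qf H (u - v) = 2 * qf H u + 2 * qf H v := by
  simp only [qf, PiLp.add_apply, PiLp.sub_apply]; ring

theorem qf_one (v : Plane) : qf 1 v = ‖v‖ ^ 2 := by
  simp [qf, EuclideanSpace.norm_sq_eq, Fin.sum_univ_two]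

theorem continuous_qf (H : Matrix (Fin 2) (Fin 2) ℝ) : Continuous (qf H) := by
  unfold qf; fun_prop

theorem convexOn_qf {H : Matrix (Fin 2) (Fin 2) ℝ} (hH : ∀ v, 0 ≤ qf H v) (s : Set Plane)
    (hs : Convex ℝ s) : ConvexOn ℝ s (qf H) := by
  refine ⟨hs, fun x _ y _ a b ha hb hab => ?_⟩
  have h : qf H (a • x + b • y) = a * qf H x + b * qf H y - a * b * qf H (x - y) := by
    obtain rfl : b = 1 - a := by linarith
    simp only [qf, PiLp.add_apply, PiLp.smul_apply, smul_eq_mul, PiLp.sub_apply]; ring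
  rw [h, smul_eq_mul, smul_eq_mul]
  have := mul_nonneg (mul_nonneg ha hb) (hH (x - y))
  linarith

/-- The sum of three squared edge lengths minus half of the largest one. -/
def shape (a b c : ℝ) : ℝ := a + b + c - max a (max b c) / 2

theorem shape_rotate (a b c : ℝ) : shape b c a = shape a b c := by
  unfold shape; rw [max_comm a, max_assoc]; ring

/-- Since the maximum is subtracted, any one edge may stand in for it in an upper bound. This spares
deciding which edge of a child is longest. -/
theorem shape_le {a b c l : ℝ} (h : l ≤ max a (max b c)) : shape a b c ≤ a + b + c - l / 2 := by
  unfold shape; linarith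

/-- The largest squared edge length, with respect to `H`. -/
def maxEdge (H : Matrix (Fin 2) (Fin 2) ℝ) (T : Triangle) : ℝ :=
  max (qf H (edge T 0)) (max (qf H (edge T 1)) (qf H (edge T 2)))

/-- The functional `shape` of the squared edge lengths of `T` with respect to `H`. -/
def triShape (H : Matrix (Fin 2) (Fin 2) ℝ) (T : Triangle) : ℝ :=
  shape (qf H (edge T 0)) (qf H (edge T 1)) (qf H (edge T 2))

theorem maxEdge_eq (H : Matrix (Fin 2) (Fin 2) ℝ) (T : Triangle) (i : Fin 3) :
    maxEdge H T = max (qf H (edge T i)) (max (qf H (edge T (i + 1))) (qf H (edge T (i + 2)))) := by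
  fin_cases i
  · rfl
  · exact (max_comm _ _).trans (max_assoc _ _ _)
  · exact (max_assoc _ _ _).symm.trans (max_comm _ _)

theorem triShape_eq (H : Matrix (Fin 2) (Fin 2) ℝ) (T : Triangle) (i : Fin 3) :
    triShape H T = shape (qf H (edge T i)) (qf H (edge T (i + 1))) (qf H (edge T (i + 2))) := by
  fin_cases i
  · rfl
  · exact (shape_rotate _ _ _).symm
  · exact shape_rotate _ _ _

theorem qf_edge_le_maxEdge (H : Matrix (Fin 2) (Fin 2) ℝ) (T : Triangle) (i : Fin 3) :
    qf H (edge T i) ≤ maxEdge H T := by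
  rw [maxEdge_eq H T i]; exact le_max_left _ _

theorem exists_maxEdge (H : Matrix (Fin 2) (Fin 2) ℝ) (T : Triangle) :
    ∃ i, maxEdge H T = qf H (edge T i) := by
  unfold maxEdge
  rcases max_choice (qf H (edge T 0)) (max (qf H (edge T 1)) (qf H (edge T 2))) with h | h
  · exact ⟨0, h⟩
  · rcases max_choice (qf H (edge T 1)) (qf H (edge T 2)) with h' | h'
    · exact ⟨1, h.trans h'⟩
    · exact ⟨2, h.trans h'⟩

theorem maxEdge_nonneg {H : Matrix (Fin 2) (Fin 2) ℝ} (hH : ∀ v, 0 ≤ qf H v) (T : Triangle) :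
    0 ≤ maxEdge H T := (hH _).trans (qf_edge_le_maxEdge H T 0)

theorem half_maxEdge_le_triShape {H : Matrix (Fin 2) (Fin 2) ℝ} (hH : ∀ v, 0 ≤ qf H v)
    (T : Triangle) : maxEdge H T / 2 ≤ triShape H T := by
  obtain ⟨i, hi⟩ := exists_maxEdge H T
  rw [triShape_eq H T i, shape, ← maxEdge_eq]
  have := hH (edge T (i + 1)); have := hH (edge T (i + 2))
  linarith

theorem triShape_le_maxEdge (H : Matrix (Fin 2) (Fin 2) ℝ) (T : Triangle) :
    triShape H T ≤ 5 / 2 * maxEdge H T := by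
  have h0 := qf_edge_le_maxEdge H T 0
  have h1 := qf_edge_le_maxEdge H T 1
  have h2 := qf_edge_le_maxEdge H T 2
  have : triShape H T = qf H (edge T 0) + qf H (edge T 1) + qf H (edge T 2) - maxEdge H T / 2 := rfl
  linarith

/-! ### Edges of the children -/

theorem edge_add_edge_add_edge (T : Triangle) (i : Fin 3) :
    edge T i + edge T (i + 1) + edge T (i + 2) = 0 := by
  fin_cases i <;> simp [edge]

theorem edge_childLeft_zero (T : Triangle) (i : Fin 3) :
    edge (childLeft T i) i = (1 / 2 : ℝ) • edge T i := by
  fin_cases i <;> simp [edge, childLeft, edgeMidpoint, midpoint_eq_smul_add] <;> module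

theorem edge_childLeft_one (T : Triangle) (i : Fin 3) :
    edge (childLeft T i) (i + 1) = (1 / 2 : ℝ) • (edge T (i + 1) - edge T (i + 2)) := by
  fin_cases i <;> simp [edge, childLeft, edgeMidpoint, midpoint_eq_smul_add] <;> module

theorem edge_childLeft_two (T : Triangle) (i : Fin 3) :
    edge (childLeft T i) (i + 2) = edge T (i + 2) := by
  fin_cases i <;> simp [edge, childLeft]

theorem edge_childRight_zero (T : Triangle) (i : Fin 3) :
    edge (childRight T i) i = (1 / 2 : ℝ) • edge T i := by
  fin_cases i <;> simp [edge, childRight, edgeMidpoint, midpoint_eq_smul_add] <;> module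

theorem edge_childRight_one (T : Triangle) (i : Fin 3) :
    edge (childRight T i) (i + 1) = edge T (i + 1) := by
  fin_cases i <;> simp [edge, childRight]

theorem edge_childRight_two (T : Triangle) (i : Fin 3) :
    edge (childRight T i) (i + 2) = (1 / 2 : ℝ) • (edge T (i + 2) - edge T (i + 1)) := by
  fin_cases i <;> simp [edge, childRight, edgeMidpoint, midpoint_eq_smul_add] <;> module

/-- The squared length of the median, by the parallelogram identity. -/
theorem qf_median (H : Matrix (Fin 2) (Fin 2) ℝ) (T : Triangle) (i : Fin 3) :
    qf H ((1 / 2 : ℝ) • (edge T (i + 1) - edge T (i + 2))) =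
      (2 * qf H (edge T (i + 1)) + 2 * qf H (edge T (i + 2)) - qf H (edge T i)) / 4 := by
  have h := qf_add_sub H (edge T (i + 1)) (edge T (i + 2))
  have h2 : edge T (i + 1) + edge T (i + 2) = - edge T i := by
    have := edge_add_edge_add_edge T i
    rw [add_assoc] at this
    exact eq_neg_of_add_eq_zero_right this
  rw [h2, qf_neg] at h
  rw [qf_smul]; linarith

theorem qf_median' (H : Matrix (Fin 2) (Fin 2) ℝ) (T : Triangle) (i : Fin 3) :
    qf H ((1 / 2 : ℝ) • (edge T (i + 2) - edge T (i + 1))) =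
      (2 * qf H (edge T (i + 1)) + 2 * qf H (edge T (i + 2)) - qf H (edge T i)) / 4 := by
  rw [← qf_median, ← qf_neg, ← smul_neg, neg_sub]

theorem qf_half (H : Matrix (Fin 2) (Fin 2) ℝ) (v : Plane) :
    qf H ((1 / 2 : ℝ) • v) = qf H v / 4 := by rw [qf_smul]; ring

theorem triShape_childLeft (H : Matrix (Fin 2) (Fin 2) ℝ) (T : Triangle) (i : Fin 3) :
    triShape H (childLeft T i) = shape (qf H (edge T i) / 4)
      ((2 * qf H (edge T (i + 1)) + 2 * qf H (edge T (i + 2)) - qf H (edge T i)) / 4)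
      (qf H (edge T (i + 2))) := by
  rw [triShape_eq H _ i, edge_childLeft_zero, edge_childLeft_one, edge_childLeft_two, qf_median,
    qf_half]

theorem triShape_childRight (H : Matrix (Fin 2) (Fin 2) ℝ) (T : Triangle) (i : Fin 3) :
    triShape H (childRight T i) = shape (qf H (edge T i) / 4) (qf H (edge T (i + 1)))
      ((2 * qf H (edge T (i + 1)) + 2 * qf H (edge T (i + 2)) - qf H (edge T i)) / 4) := by
  rw [triShape_eq H _ i, edge_childRight_zero, edge_childRight_one, edge_childRight_two, qf_median',
    qf_half]

theorem maxEdge_childLeft_le {H : Matrix (Fin 2) (Fin 2) ℝ} (hH : ∀ v, 0 ≤ qf H v)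
    (T : Triangle) (i : Fin 3) : maxEdge H (childLeft T i) ≤ maxEdge H T := by
  have h0 := qf_edge_le_maxEdge H T i
  have h1 := qf_edge_le_maxEdge H T (i + 1)
  have h2 := qf_edge_le_maxEdge H T (i + 2)
  have h3 := hH (edge T i)
  rw [maxEdge_eq H _ i, edge_childLeft_zero, edge_childLeft_one, edge_childLeft_two, qf_median,
    qf_half]
  refine max_le (by linarith) (max_le (by linarith) h2)

theorem maxEdge_childRight_le {H : Matrix (Fin 2) (Fin 2) ℝ} (hH : ∀ v, 0 ≤ qf H v)
    (T : Triangle) (i : Fin 3) : maxEdge H (childRight T i) ≤ maxEdge H T := by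
  have h0 := qf_edge_le_maxEdge H T i
  have h1 := qf_edge_le_maxEdge H T (i + 1)
  have h2 := qf_edge_le_maxEdge H T (i + 2)
  have h3 := hH (edge T i)
  rw [maxEdge_eq H _ i, edge_childRight_zero, edge_childRight_one, edge_childRight_two, qf_median',
    qf_half]
  refine max_le (by linarith) (max_le h1 (by linarith))

/-! ### Contraction of the shape functional -/

/-- `E` is the bisected edge and the left side bounds the sum of the shapes of the children.
Subtracting half the largest edge is what gives contraction: for `E = U`, `V = 0` the plain sum of
squares is 2E for the parent and for the children together, while the shape drops from 3/2 E to 11/8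
E. -/
theorem shape_contraction_aux {E U V g : ℝ} (hV : 0 ≤ V) (hg : 0 ≤ g)
    (hgram : g ^ 2 = E * U - ((E + U - V) / 2) ^ 2) (hUV : V ≤ U) (hEU : 99 * U ≤ 101 * E) :
    3 / 2 * U + 2 * V - E / 8 ≤ 19 / 20 * shape E U V + 20 * g := by
  have hs : 12 / 25 * E + U + V ≤ shape E U V := by
    unfold shape
    rcases le_total E (max U V) with h | h
    · rw [max_eq_right h, max_eq_left hUV]; linarith
    · rw [max_eq_left h]; linarith
  -- The left side `X` is what the factor 19/20 fails to absorb. If `X > 0`, then `E X ≤ 100 g²`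
  -- because the triangle is not too thin, and `X ≤ 2 E`; hence `X² ≤ 200 g² ≤ (20 g)²`.
  have key : 11 / 20 * U + 21 / 20 * V - 58 / 100 * E ≤ 20 * g := by
    by_cases hX : 11 / 20 * U + 21 / 20 * V - 58 / 100 * E ≤ 0
    · linarith
    push Not at hX
    have h1 : E * (11 / 20 * U + 21 / 20 * V - 58 / 100 * E) ≤ 100 * g ^ 2 := by
      rw [hgram]; nlinarith
    have h2 : (11 / 20 * U + 21 / 20 * V - 58 / 100 * E) ^ 2 ≤
        2 * (E * (11 / 20 * U + 21 / 20 * V - 58 / 100 * E)) := by nlinarith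
    refine le_of_abs_le (abs_le_of_sq_le_sq ?_ (by positivity))
    nlinarith
  linarith

theorem shape_contraction {E U V g : ℝ} (hU : 0 ≤ U) (hV : 0 ≤ V) (hg : 0 ≤ g)
    (hgram : g ^ 2 = E * U - ((E + U - V) / 2) ^ 2) (hEU : 99 * U ≤ 101 * E)
    (hEV : 99 * V ≤ 101 * E) :
    shape (E / 4) ((2 * U + 2 * V - E) / 4) V + shape (E / 4) U ((2 * U + 2 * V - E) / 4) ≤
      19 / 20 * shape E U V + 20 * g := by
  rcases le_total V U with h | h
  · have h1 := shape_le (a := E / 4) (b := (2 * U + 2 * V - E) / 4) (c := V) (le_max_left _ _)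
    have h2 := shape_le (a := E / 4) (b := U) (c := (2 * U + 2 * V - E) / 4)
      ((le_max_left _ _).trans (le_max_right _ _))
    have := shape_contraction_aux hV hg hgram h hEU
    linarith
  · have h1 := shape_le (a := E / 4) (b := (2 * U + 2 * V - E) / 4) (c := V)
      ((le_max_right _ _).trans (le_max_right _ _))
    have h2 := shape_le (a := E / 4) (b := U) (c := (2 * U + 2 * V - E) / 4) (le_max_left _ _)
    have := shape_contraction_aux (E := E) hU hg (hgram.trans (by ring)) h hEV
    have h3 : shape E V U = shape E U V := by unfold shape; rw [max_comm V U]; ring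
    linarith

/-- With `U / 2` subtracted, `E` cancels and `U + V / 2` remains. Here a single child contracts
without an area term, even if the cut edge is only within ten percent of the longest; this serves
before `f` is nearly quadratic. -/
theorem shape_childRight_le {E U V : ℝ} (hU : 0 ≤ U) (hV : 0 ≤ V) (hEU : 9 * U ≤ 10 * E)
    (hEV : 9 * V ≤ 10 * E) :
    shape (E / 4) U ((2 * U + 2 * V - E) / 4) ≤ 9 / 10 * shape E U V := by
  have h1 := shape_le (a := E / 4) (b := U) (c := (2 * U + 2 * V - E) / 4)
    ((le_max_left _ _).trans (le_max_right _ _))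
  have h2 : U + V / 2 ≤ 9 / 10 * shape E U V := by
    unfold shape
    rcases max_choice E (max U V) with h | h <;> rw [h]
    · linarith
    · rcases max_choice U V with h | h <;> rw [h] <;> linarith
  linarith

theorem shape_childLeft_le {E U V : ℝ} (hU : 0 ≤ U) (hEU : 9 * U ≤ 10 * E)
    (hEV : 9 * V ≤ 10 * E) :
    shape (E / 4) ((2 * U + 2 * V - E) / 4) V ≤ 9 / 10 * shape E U V := by
  have h1 := shape_le (a := E / 4) (b := (2 * U + 2 * V - E) / 4) (c := V)
    ((le_max_right _ _).trans (le_max_right _ _))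
  have h2 : V + U / 2 ≤ 9 / 10 * shape E U V := by
    unfold shape
    rcases max_choice E (max U V) with h | h <;> rw [h]
    · linarith
    · rcases max_choice U V with h | h <;> rw [h] <;> linarith
  linarith

/-- By polarization the left side is the Gram determinant of two edges in the metric `H`, so its
square root is a multiple of the area of `T` in that metric. -/
theorem gram_edge {H : Matrix (Fin 2) (Fin 2) ℝ} (hsymm : H 0 1 = H 1 0) (T : Triangle) (i : Fin 3) :
    qf H (edge T i) * qf H (edge T (i + 1)) -
      ((qf H (edge T i) + qf H (edge T (i + 1)) - qf H (edge T (i + 2))) / 2) ^ 2 =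
      H.det * cross (edge T 0) (edge T 1) ^ 2 := by
  have h2 : edge T (i + 2) = -(edge T i + edge T (i + 1)) :=
    eq_neg_of_add_eq_zero_right (edge_add_edge_add_edge T i)
  rw [h2, ← cross_edge T i, Matrix.det_fin_two]
  simp only [qf, cross, PiLp.add_apply, PiLp.neg_apply, hsymm]
  ring

theorem triShape_children_le {H : Matrix (Fin 2) (Fin 2) ℝ} (hH : ∀ v, 0 ≤ qf H v)
    (hsymm : H 0 1 = H 1 0) (hdet : 0 ≤ H.det) (T : Triangle) (i : Fin 3)
    (hi : 99 * maxEdge H T ≤ 101 * qf H (edge T i)) :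
    triShape H (childLeft T i) + triShape H (childRight T i) ≤
      19 / 20 * triShape H T + 20 * (Real.sqrt H.det * |cross (edge T 0) (edge T 1)|) := by
  rw [triShape_childLeft, triShape_childRight, triShape_eq H T i]
  have h1 := qf_edge_le_maxEdge H T (i + 1)
  have h2 := qf_edge_le_maxEdge H T (i + 2)
  refine shape_contraction (hH _) (hH _) (by positivity) ?_ (by linarith) (by linarith)
  rw [gram_edge hsymm, mul_pow, Real.sq_sqrt hdet, sq_abs]

theorem triShape_child_le {H : Matrix (Fin 2) (Fin 2) ℝ} (hH : ∀ v, 0 ≤ qf H v) (T : Triangle)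
    (i : Fin 3) (hi : 9 * maxEdge H T ≤ 10 * qf H (edge T i)) :
    triShape H (childLeft T i) ≤ 9 / 10 * triShape H T ∧
      triShape H (childRight T i) ≤ 9 / 10 * triShape H T := by
  rw [triShape_childLeft, triShape_childRight, triShape_eq H T i]
  have h1 := qf_edge_le_maxEdge H T (i + 1)
  have h2 := qf_edge_le_maxEdge H T (i + 2)
  exact ⟨shape_childLeft_le (hH _) (by linarith) (by linarith),
    shape_childRight_le (hH _) (hH _) (by linarith) (by linarith)⟩

/-! ### The children as sets -/

theorem cross_childLeft (T : Triangle) (i : Fin 3) :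
    cross (edge (childLeft T i) 0) (edge (childLeft T i) 1) = cross (edge T 0) (edge T 1) / 2 := by
  rw [← cross_edge _ i, ← cross_edge T i, edge_childLeft_zero, edge_childLeft_one]
  have h2 : edge T (i + 2) = -(edge T i + edge T (i + 1)) :=
    eq_neg_of_add_eq_zero_right (edge_add_edge_add_edge T i)
  rw [h2]
  simp only [cross, PiLp.smul_apply, PiLp.sub_apply, PiLp.neg_apply, PiLp.add_apply, smul_eq_mul]
  ring

theorem cross_childRight (T : Triangle) (i : Fin 3) :
    cross (edge (childRight T i) 0) (edge (childRight T i) 1) = cross (edge T 0) (edge T 1) / 2 := by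
  rw [← cross_edge _ i, ← cross_edge T i, edge_childRight_zero, edge_childRight_one]
  simp only [cross, PiLp.smul_apply, smul_eq_mul]
  ring

theorem area_childLeft (T : Triangle) (i : Fin 3) : area (childLeft T i) = area T / 2 := by
  obtain ⟨ω, -, h⟩ := exists_area_eq
  rw [h, h, cross_childLeft, abs_div, abs_of_pos (two_pos (α := ℝ)), mul_div_assoc]

theorem area_childRight (T : Triangle) (i : Fin 3) : area (childRight T i) = area T / 2 := by
  obtain ⟨ω, -, h⟩ := exists_area_eq
  rw [h, h, cross_childRight, abs_div, abs_of_pos (two_pos (α := ℝ)), mul_div_assoc]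

theorem edgeMidpoint_mem (T : Triangle) (i : Fin 3) : edgeMidpoint T i ∈ T.closedInterior :=
  (convex_triangle T).midpoint_mem (T.point_mem_closedInterior _) (T.point_mem_closedInterior _)

theorem childLeft_subset (T : Triangle) (i : Fin 3) :
    (childLeft T i).closedInterior ⊆ T.closedInterior := by
  refine triangle_subset (convex_triangle T) fun j => ?_
  simp only [childLeft, Function.update_apply]
  split_ifs
  · exact edgeMidpoint_mem T i
  · exact T.point_mem_closedInterior _

theorem childRight_subset (T : Triangle) (i : Fin 3) :
    (childRight T i).closedInterior ⊆ T.closedInterior := by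
  refine triangle_subset (convex_triangle T) fun j => ?_
  simp only [childRight, Function.update_apply]
  split_ifs
  · exact edgeMidpoint_mem T i
  · exact T.point_mem_closedInterior _

theorem mem_triangle_iff (T : Triangle) (x : Plane) :
    x ∈ T.closedInterior ↔ ∀ i, 0 ≤ (vertexBasis T).coord i x := by
  rw [← Affine.Simplex.convexHull_eq_closedInterior]
  have := (vertexBasis T).convexHull_eq_nonneg_coord
  rw [show (Set.range T.points) = Set.range (vertexBasis T) from rfl, this]
  rfl

theorem sum_smul_mem_triangle (T : Triangle) (i : Fin 3) {a b c : ℝ} (ha : 0 ≤ a) (hb : 0 ≤ b)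
    (hc : 0 ≤ c) (h : a + b + c = 1) :
    a • T.points i + b • T.points (i + 1) + c • T.points (i + 2) ∈ T.closedInterior := by
  have := (convex_triangle T).sum_mem (t := Finset.univ) (w := ![a, b, c])
    (z := ![T.points i, T.points (i + 1), T.points (i + 2)])
    (by intro j _; fin_cases j <;> simpa)
    (by simp [Fin.sum_univ_three, h])
    (by intro j _; fin_cases j <;> exact T.point_mem_closedInterior _)
  simpa [Fin.sum_univ_three] using this

theorem exists_coords (T : Triangle) (i : Fin 3) {x : Plane} (hx : x ∈ T.closedInterior) :
    ∃ a b c : ℝ, 0 ≤ a ∧ 0 ≤ b ∧ 0 ≤ c ∧ a + b + c = 1 ∧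
      x = a • T.points i + b • T.points (i + 1) + c • T.points (i + 2) := by
  rw [mem_triangle_iff] at hx
  have hs := (vertexBasis T).sum_coord_apply_eq_one x
  have hl := (vertexBasis T).linear_combination_coord_eq_self x
  rw [Fin.sum_univ_three] at hs hl
  simp only [vertexBasis_apply] at hl
  refine ⟨_, _, _, hx i, hx (i + 1), hx (i + 2), ?_, ?_⟩
  · rw [← hs]; fin_cases i <;> simp <;> ring
  · rw [← hl]; fin_cases i <;> simp [hl] <;> nth_rewrite 1 [← hl] <;> abel

theorem childLeft_union_childRight (T : Triangle) (i : Fin 3) :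
    (childLeft T i).closedInterior ∪ (childRight T i).closedInterior = T.closedInterior := by
  refine (Set.union_subset (childLeft_subset T i) (childRight_subset T i)).antisymm fun x hx => ?_
  obtain ⟨a, b, c, ha, hb, hc, h, rfl⟩ := exists_coords T i hx
  -- The median separates `c ≤ b` from `b ≤ c`. With `M` the midpoint of `B` and `C`, `b B + c C`
  -- equals `(b - c) B + 2 c M` in the first case and `2 b M + (c - b) C` in the second.
  rcases le_total c b with hbc | hbc
  · left
    have := sum_smul_mem_triangle (childLeft T i) i ha (sub_nonneg.2 hbc)
      (mul_nonneg two_pos.le hc) (by linarith)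
    convert! this using 1
    have h1 : (childLeft T i).points i = T.points i := by
      fin_cases i <;> simp [childLeft]
    have h2 : (childLeft T i).points (i + 1) = T.points (i + 1) := by
      fin_cases i <;> simp [childLeft]
    have h3 : (childLeft T i).points (i + 2) = edgeMidpoint T i := by
      simp [childLeft]
    rw [h1, h2, h3, edgeMidpoint, midpoint_eq_smul_add, invOf_eq_inv]
    module
  · right
    have := sum_smul_mem_triangle (childRight T i) i ha (mul_nonneg two_pos.le hb)
      (sub_nonneg.2 hbc) (by linarith)
    convert! this using 1
    have h1 : (childRight T i).points i = T.points i := by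
      fin_cases i <;> simp [childRight]
    have h2 : (childRight T i).points (i + 2) = T.points (i + 2) := by
      fin_cases i <;> simp [childRight]
    have h3 : (childRight T i).points (i + 1) = edgeMidpoint T i := by
      simp [childRight]
    rw [h1, h2, h3, edgeMidpoint, midpoint_eq_smul_add, invOf_eq_inv]
    module

/-- The children cover `T` and each has half its area, so inclusion-exclusion leaves nothing for the
overlap. -/
theorem aedisjoint_children (T : Triangle) (i : Fin 3) :
    AEDisjoint volume (childLeft T i).closedInterior (childRight T i).closedInterior := by
  have h := measure_union_add_inter (μ := volume) (childLeft T i).closedInterior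
    (measurableSet_triangle (childRight T i))
  rw [childLeft_union_childRight, volume_triangle, volume_triangle, volume_triangle,
    area_childLeft, area_childRight, ← ENNReal.ofReal_add (by linarith [area_pos T])
    (by linarith [area_pos T]), add_halves] at h
  exact (ENNReal.add_right_inj ENNReal.ofReal_ne_top).mp (h.trans (add_zero _).symm)

/-- `Desc R k T` says that `T` is obtained from `R` by `k` bisections. -/
inductive Desc (R : Triangle) : ℕ → Triangle → Prop
  | refl : Desc R 0 R
  | left {k : ℕ} {T : Triangle} (i : Fin 3) : Desc R k T → Desc R (k + 1) (childLeft T i)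
  | right {k : ℕ} {T : Triangle} (i : Fin 3) : Desc R k T → Desc R (k + 1) (childRight T i)

theorem Desc.subset {R T : Triangle} {k : ℕ} (h : Desc R k T) :
    T.closedInterior ⊆ R.closedInterior := by
  induction h with
  | refl => rfl
  | left i _ ih => exact (childLeft_subset _ i).trans ih
  | right i _ ih => exact (childRight_subset _ i).trans ih

theorem Desc.area_eq {R T : Triangle} {k : ℕ} (h : Desc R k T) : area T = area R / 2 ^ k := by
  induction h with
  | refl => simp
  | left i _ ih => rw [area_childLeft, ih, pow_succ, div_div]
  | right i _ ih => rw [area_childRight, ih, pow_succ, div_div]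

theorem Desc.maxEdge_le {R T : Triangle} {k : ℕ} (h : Desc R k T)
    {H : Matrix (Fin 2) (Fin 2) ℝ} (hH : ∀ v, 0 ≤ qf H v) : maxEdge H T ≤ maxEdge H R := by
  induction h with
  | refl => rfl
  | left i _ ih => exact (maxEdge_childLeft_le hH _ i).trans ih
  | right i _ ih => exact (maxEdge_childRight_le hH _ i).trans ih

theorem Desc.trans {R T S : Triangle} {k l : ℕ} (h : Desc R k T) (h' : Desc T l S) :
    Desc R (k + l) S := by
  induction h' with
  | refl => exact h
  | left i _ ih => exact .left i ih
  | right i _ ih => exact .right i ih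

end

section

/-! ### The decision function of a convex function -/

theorem interp_apply (T : Triangle) (f : Plane → ℝ) (x : Plane) :
    interp T f x = ∑ i, f (T.points i) * (vertexBasis T).coord i x := by
  have h : ∀ s : Finset (Fin 3), (∑ i ∈ s, f (T.points i) • (vertexBasis T).coord i) x =
      ∑ i ∈ s, f (T.points i) * (vertexBasis T).coord i x := by
    intro s
    induction s using Finset.induction_on with
    | empty => simp
    | insert a s ha ih =>
      rw [Finset.sum_insert ha, Finset.sum_insert ha, AffineMap.coe_add, Pi.add_apply, ih,
        AffineMap.coe_smul, Pi.smul_apply, smul_eq_mul]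
  exact h _

theorem interp_points (T : Triangle) (f : Plane → ℝ) (i : Fin 3) :
    interp T f (T.points i) = f (T.points i) := by
  rw [interp_apply]
  have : ∀ j, (vertexBasis T).coord j (T.points i) = if j = i then 1 else 0 := fun j =>
    (vertexBasis T).coord_apply j i
  simp [this]

theorem continuous_interp (T : Triangle) (f : Plane → ℝ) : Continuous (interp T f) :=
  (interp T f).continuous_of_finiteDimensional

theorem le_interp {T : Triangle} {f : Plane → ℝ} (hf : ConvexOn ℝ T.closedInterior f)
    {x : Plane} (hx : x ∈ T.closedInterior) : f x ≤ interp T f x := by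
  have h := hf.map_sum_le (t := Finset.univ) (w := fun i => (vertexBasis T).coord i x)
    (p := T.points) (fun i _ => (mem_triangle_iff T x).mp hx i)
    ((vertexBasis T).sum_coord_apply_eq_one x) (fun i _ => T.point_mem_closedInterior i)
  have hl := (vertexBasis T).linear_combination_coord_eq_self x
  simp only [vertexBasis_apply] at hl
  rw [hl] at h
  rw [interp_apply]
  simpa [mul_comm] using h

theorem integrableOn_triangle {T : Triangle} {f : Plane → ℝ}
    (hf : ContinuousOn f T.closedInterior) : IntegrableOn f T.closedInterior :=
  hf.integrableOn_compact T.isCompact_closedInterior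

/-- By convexity `interp T f - f` is nonnegative, so the norm is the integral of a difference, and
affine functions are integrated exactly from their vertex values. -/
theorem interpErrorL1_eq {T : Triangle} {f : Plane → ℝ} (hf : ConvexOn ℝ T.closedInterior f)
    (hc : ContinuousOn f T.closedInterior) :
    interpErrorL1 T f =
        ENNReal.ofReal (area T / 3 * ∑ i, f (T.points i) - ∫ x in T.closedInterior, f x) ∧
      0 ≤ area T / 3 * ∑ i, f (T.points i) - ∫ x in T.closedInterior, f x := by
  have hint : IntegrableOn (fun x => f x - interp T f x) T.closedInterior :=
    integrableOn_triangle (hc.sub (continuous_interp T f).continuousOn)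
  have h1 : ∫ x in T.closedInterior, ‖f x - interp T f x‖ =
      area T / 3 * ∑ i, f (T.points i) - ∫ x in T.closedInterior, f x := by
    have : ∫ x in T.closedInterior, ‖f x - interp T f x‖ =
        ∫ x in T.closedInterior, (interp T f x - f x) := by
      refine setIntegral_congr_fun (measurableSet_triangle T) fun x hx => ?_
      rw [Real.norm_eq_abs, abs_sub_comm, abs_of_nonneg (sub_nonneg.2 (le_interp hf hx))]
    rw [this, integral_sub (integrableOn_triangle (continuous_interp T f).continuousOn)
      (integrableOn_triangle hc), setIntegral_affineMap]
    simp_rw [interp_points]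
  refine ⟨?_, ?_⟩
  · rw [interpErrorL1, eLpNorm_one_eq_lintegral_enorm, ← h1,
      ofReal_integral_norm_eq_lintegral_enorm hint]
  · rw [← h1]; exact integral_nonneg fun x => norm_nonneg _

/-- The second difference of `f` along the edge of `T` opposite the vertex `i`. -/
def secDiff (f : Plane → ℝ) (T : Triangle) (i : Fin 3) : ℝ :=
  (f (T.points (i + 1)) + f (T.points (i + 2))) / 2 - f (edgeMidpoint T i)

theorem sum_points (f : Plane → ℝ) (T : Triangle) (i : Fin 3) :
    ∑ j, f (T.points j) = f (T.points i) + f (T.points (i + 1)) + f (T.points (i + 2)) := by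
  fin_cases i <;> simp [Fin.sum_univ_three] <;> ring

/-- Only `secDiff f T i` depends on the edge, so minimizing the decision function means maximizing
the second difference. The nonnegativity is needed to compare values of `ENNReal.ofReal`. -/
theorem decision_eq {T : Triangle} {f : Plane → ℝ} (hf : ConvexOn ℝ T.closedInterior f)
    (hc : ContinuousOn f T.closedInterior) (i : Fin 3) :
    decision f T i = ENNReal.ofReal (area T / 3 * (∑ j, f (T.points j) - secDiff f T i) -
        ∫ x in T.closedInterior, f x) ∧
      0 ≤ area T / 3 * (∑ j, f (T.points j) - secDiff f T i) - ∫ x in T.closedInterior, f x := by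
  have hsL := childLeft_subset T i
  have hsR := childRight_subset T i
  obtain ⟨hL, hL0⟩ := interpErrorL1_eq (hf.subset hsL (convex_triangle _)) (hc.mono hsL)
  obtain ⟨hR, hR0⟩ := interpErrorL1_eq (hf.subset hsR (convex_triangle _)) (hc.mono hsR)
  have hint : ∫ x in T.closedInterior, f x = (∫ x in (childLeft T i).closedInterior, f x) +
      ∫ x in (childRight T i).closedInterior, f x := by
    rw [← childLeft_union_childRight T i]
    exact setIntegral_union₀ (aedisjoint_children T i)
      (measurableSet_triangle _).nullMeasurableSet (integrableOn_triangle (hc.mono hsL))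
      (integrableOn_triangle (hc.mono hsR))
  have hsum : area (childLeft T i) / 3 * ∑ j, f ((childLeft T i).points j) -
        (∫ x in (childLeft T i).closedInterior, f x) +
        (area (childRight T i) / 3 * ∑ j, f ((childRight T i).points j) -
        ∫ x in (childRight T i).closedInterior, f x) =
      area T / 3 * (∑ j, f (T.points j) - secDiff f T i) - ∫ x in T.closedInterior, f x := by
    rw [area_childLeft, area_childRight, hint, sum_points f (childLeft T i) i,
      sum_points f (childRight T i) i, sum_points f T i]
    have h1 : (childLeft T i).points i = T.points i := by
      fin_cases i <;> simp [childLeft]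
    have h2 : (childLeft T i).points (i + 1) = T.points (i + 1) := by
      fin_cases i <;> simp [childLeft]
    have h3 : (childLeft T i).points (i + 2) = edgeMidpoint T i := by
      simp [childLeft]
    have h4 : (childRight T i).points i = T.points i := by
      fin_cases i <;> simp [childRight]
    have h5 : (childRight T i).points (i + 2) = T.points (i + 2) := by
      fin_cases i <;> simp [childRight]
    have h6 : (childRight T i).points (i + 1) = edgeMidpoint T i := by
      simp [childRight]
    rw [h1, h2, h3, h4, h5, h6, secDiff]
    ring
  refine ⟨?_, hsum ▸ add_nonneg hL0 hR0⟩
  rw [decision, hL, hR, ← ENNReal.ofReal_add hL0 hR0, hsum]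

theorem secDiff_le_of_decision_le {T : Triangle} {f : Plane → ℝ}
    (hf : ConvexOn ℝ T.closedInterior f) (hc : ContinuousOn f T.closedInterior) {i j : Fin 3}
    (h : decision f T i ≤ decision f T j) : secDiff f T j ≤ secDiff f T i := by
  obtain ⟨hi, -⟩ := decision_eq hf hc i
  obtain ⟨hj, hj0⟩ := decision_eq hf hc j
  rw [hi, hj, ENNReal.ofReal_le_ofReal_iff hj0] at h
  have h2 := area_pos T
  have h3 : area T / 3 * (secDiff f T j - secDiff f T i) ≤ 0 := by linarith
  have h4 := nonpos_of_mul_nonpos_right h3 (by positivity)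
  linarith

theorem secDiff_nonneg {T : Triangle} {s : Set Plane} {f : Plane → ℝ} (hf : ConvexOn ℝ s f)
    (hs : T.closedInterior ⊆ s) (i : Fin 3) : 0 ≤ secDiff f T i := by
  have h := hf.2 (hs (T.point_mem_closedInterior (i + 1)))
    (hs (T.point_mem_closedInterior (i + 2))) (show (0 : ℝ) ≤ 1 / 2 by norm_num)
    (show (0 : ℝ) ≤ 1 / 2 by norm_num) (by norm_num)
  rw [secDiff, edgeMidpoint, midpoint_eq_smul_add, smul_add, invOf_eq_inv, ← one_div]
  simp only [smul_eq_mul] at h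
  linarith

theorem secDiff_qf (H : Matrix (Fin 2) (Fin 2) ℝ) (T : Triangle) (i : Fin 3) :
    secDiff (qf H) T i = qf H (edge T i) / 4 := by
  simp only [secDiff, edgeMidpoint, edge, midpoint_eq_smul_add, invOf_eq_inv, qf,
    PiLp.add_apply, PiLp.sub_apply, PiLp.smul_apply, smul_eq_mul]
  ring

/-- On `s`, the function `f` is as convex as the quadratic form of `H`, up to one percent. -/
structure NearQuadratic (f : Plane → ℝ) (H : Matrix (Fin 2) (Fin 2) ℝ) (s : Set Plane) : Prop where
  lower : ConvexOn ℝ s fun x => f x - 99 / 200 * qf H x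
  upper : ConvexOn ℝ s fun x => 101 / 200 * qf H x - f x
  nonneg : ∀ v, 0 ≤ qf H v
  symm : H 0 1 = H 1 0
  det_pos : 0 < H.det

theorem NearQuadratic.convexOn {f : Plane → ℝ} {H : Matrix (Fin 2) (Fin 2) ℝ} {s : Set Plane}
    (h : NearQuadratic f H s) : ConvexOn ℝ s f := by
  have := h.lower.add ((convexOn_qf h.nonneg s h.lower.1).smul (c := 99 / 200) (by norm_num))
  convert! this using 1
  ext x; simp

theorem NearQuadratic.mono {f : Plane → ℝ} {H : Matrix (Fin 2) (Fin 2) ℝ} {s t : Set Plane}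
    (h : NearQuadratic f H s) (hts : t ⊆ s) (ht : Convex ℝ t) : NearQuadratic f H t :=
  ⟨h.lower.subset hts ht, h.upper.subset hts ht, h.nonneg, h.symm, h.det_pos⟩

/-- Second differences of convex functions are nonnegative; applied to `lower` and `upper`, this
puts `secDiff f T i` between 99/800 and 101/800 times `qf H (edge T i)`. -/
theorem NearQuadratic.maxEdge_le {f : Plane → ℝ} {H : Matrix (Fin 2) (Fin 2) ℝ} {T : Triangle}
    (h : NearQuadratic f H T.closedInterior) (hc : ContinuousOn f T.closedInterior) {i : Fin 3}
    (hi : ∀ j, decision f T i ≤ decision f T j) :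
    99 * maxEdge H T ≤ 101 * qf H (edge T i) := by
  obtain ⟨j, hj⟩ := exists_maxEdge H T
  have h1 := secDiff_le_of_decision_le h.convexOn hc (hi j)
  have h2 := secDiff_nonneg h.lower subset_rfl j
  have h3 := secDiff_nonneg h.upper subset_rfl i
  have h4 := secDiff_qf H T i
  have h5 := secDiff_qf H T j
  rw [hj]
  simp only [secDiff] at *
  linarith

end

section

/-! ### Bounds for the local error -/

variable {A : Triangle → (Plane → ℝ) → (Plane →ᵃ[ℝ] ℝ)}

/-- The operators `A T` are bounded by `K` in the `L^∞` norm, uniformly in `T`. -/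
def UniformBound (A : Triangle → (Plane → ℝ) → (Plane →ᵃ[ℝ] ℝ)) (K : ℝ) : Prop :=
  ∀ (T : Triangle) (f : Plane → ℝ), ContinuousOn f T.closedInterior →
    ∀ M : ℝ, (∀ x ∈ T.closedInterior, |f x| ≤ M) → ∀ x ∈ T.closedInterior, |A T f x| ≤ K * M

theorem continuousOn_affineMap (π : Plane →ᵃ[ℝ] ℝ) (s : Set Plane) : ContinuousOn π s :=
  π.continuous_of_finiteDimensional.continuousOn

/-- All triangles are affinely equivalent, so the bound on one reference triangle is transported to
all by `comm`. -/
theorem IsApproxOperator.exists_uniform_bound (hA : IsApproxOperator A) :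
    ∃ K : ℝ, 0 ≤ K ∧ UniformBound A K := by
  obtain ⟨T₀⟩ := exists_triangle
  obtain ⟨K, hK⟩ := hA.bounded T₀
  refine ⟨|K|, abs_nonneg _, fun T f hf M hM x hx => ?_⟩
  obtain ⟨φ, hφ⟩ := exists_affineEquiv T₀ T
  have him := image_triangle T₀ T φ hφ
  rw [← him] at hx
  obtain ⟨y, hy, rfl⟩ := hx
  have hmaps : Set.MapsTo φ T₀.closedInterior T.closedInterior := fun z hz => by
    rw [← him]; exact ⟨z, hz, rfl⟩
  have hφc : Continuous φ := (φ : Plane →ᵃ[ℝ] Plane).continuous_of_finiteDimensional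
  rw [hA.comm T₀ T φ him f hf y]
  have hM0 : 0 ≤ M := (abs_nonneg _).trans (hM _ (hmaps hy))
  calc |A T₀ (fun y => f (φ y)) y| ≤ K * M :=
        hK _ (hf.comp hφc.continuousOn hmaps) M (fun z hz => hM _ (hmaps hz)) y hy
    _ ≤ |K| * M := mul_le_mul_of_nonneg_right (le_abs_self K) hM0

/-- Reproduction of affine functions gives `f - A f = (f - π) - A (f - π)`. -/
theorem IsApproxOperator.abs_sub_le (hA : IsApproxOperator A) {K : ℝ}
    (hK : UniformBound A K) {T : Triangle} {f : Plane → ℝ} (hf : ContinuousOn f T.closedInterior)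
    (π : Plane →ᵃ[ℝ] ℝ) {M : ℝ} (hM : ∀ x ∈ T.closedInterior, |f x - π x| ≤ M) :
    ∀ x ∈ T.closedInterior, |f x - A T f x| ≤ (1 + K) * M := by
  intro x hx
  have hg : ContinuousOn (f - ⇑π) T.closedInterior := hf.sub (continuousOn_affineMap π _)
  have h := hA.add T (f - ⇑π) π hg (continuousOn_affineMap π _)
  rw [sub_add_cancel, hA.repro] at h
  have h1 := hK T (f - ⇑π) hg M hM x hx
  have h2 := hM x hx
  rw [h]
  simp only [AffineMap.coe_add, Pi.add_apply]
  calc |f x - (A T (f - ⇑π) x + π x)| = |(f x - π x) - A T (f - ⇑π) x| := by congr 1; ring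
    _ ≤ |f x - π x| + |A T (f - ⇑π) x| := abs_sub _ _
    _ ≤ (1 + K) * M := by linarith

theorem localError_le_of_abs_sub_le {p : ℝ≥0∞} {T : Triangle} {f : Plane → ℝ} {M : ℝ}
    (hM : ∀ x ∈ T.closedInterior, |f x - A T f x| ≤ M) :
    localError A p f T ≤ ENNReal.ofReal (M * area T ^ p.toReal⁻¹) := by
  have hM0 : 0 ≤ M := (abs_nonneg _).trans (hM _ (T.point_mem_closedInterior 0))
  have h := eLpNorm_le_of_ae_bound (p := p) (μ := volume.restrict T.closedInterior)
    (f := fun x => f x - A T f x) (C := M)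
    ((ae_restrict_mem (measurableSet_triangle T)).mono hM)
  refine h.trans_eq ?_
  rw [Measure.restrict_apply_univ, volume_triangle, ENNReal.ofReal_rpow_of_pos (area_pos T),
    mul_comm, ENNReal.ofReal_mul hM0]

theorem interp_qf_sub_le {H : Matrix (Fin 2) (Fin 2) ℝ} (hH : ∀ v, 0 ≤ qf H v) (T : Triangle)
    {x : Plane} (hx : x ∈ T.closedInterior) : interp T (qf H) x - qf H x ≤ maxEdge H T := by
  have hpos := (mem_triangle_iff T x).mp hx
  have hs := (vertexBasis T).sum_coord_apply_eq_one x
  have hl := (vertexBasis T).linear_combination_coord_eq_self x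
  rw [interp_apply]
  rw [Fin.sum_univ_three] at hs hl ⊢
  simp only [vertexBasis_apply] at hl
  have h0 := hpos 0
  have h1 := hpos 1
  have h2 := hpos 2
  generalize (vertexBasis T).coord 0 x = a at *
  generalize (vertexBasis T).coord 1 x = b at *
  generalize (vertexBasis T).coord 2 x = c at *
  have e0 := qf_edge_le_maxEdge H T 0
  have e1 := qf_edge_le_maxEdge H T 1
  have e2 := qf_edge_le_maxEdge H T 2
  -- The variance identity for the barycentric weights `a`, `b`, `c`.
  have key : qf H (T.points 0) * a + qf H (T.points 1) * b + qf H (T.points 2) * c - qf H x =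
      b * c * qf H (edge T 0) + c * a * qf H (edge T 1) + a * b * qf H (edge T 2) := by
    obtain rfl : a = 1 - b - c := by linarith
    rw [← hl]
    simp [qf, edge]
    ring
  rw [key]
  have hM := maxEdge_nonneg hH T
  have hbc := mul_le_mul_of_nonneg_left e0 (mul_nonneg h1 h2)
  have hca := mul_le_mul_of_nonneg_left e1 (mul_nonneg h2 h0)
  have hab := mul_le_mul_of_nonneg_left e2 (mul_nonneg h0 h1)
  have : b * c + c * a + a * b ≤ 1 := by nlinarith [sq_nonneg a, sq_nonneg b, sq_nonneg c]
  have := mul_le_mul_of_nonneg_right this hM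
  linarith

theorem NearQuadratic.abs_sub_interp_le {f : Plane → ℝ} {H : Matrix (Fin 2) (Fin 2) ℝ}
    {T : Triangle} (h : NearQuadratic f H T.closedInterior) :
    ∀ x ∈ T.closedInterior, |f x - interp T f x| ≤ maxEdge H T := by
  intro x hx
  have h1 := le_interp h.convexOn hx
  have h2 := le_interp h.upper hx
  have h3 := interp_qf_sub_le h.nonneg T hx
  have h4 := maxEdge_nonneg h.nonneg T
  rw [abs_sub_comm, abs_of_nonneg (sub_nonneg.2 h1)]
  simp only [interp_apply] at *
  simp only [sub_mul, Finset.sum_sub_distrib, mul_assoc, ← Finset.mul_sum] at h2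
  linarith

theorem NearQuadratic.localError_le (hA : IsApproxOperator A) {K : ℝ}
    (hK : UniformBound A K) {f : Plane → ℝ} {H : Matrix (Fin 2) (Fin 2) ℝ}
    {T : Triangle} (h : NearQuadratic f H T.closedInterior) (hf : ContinuousOn f T.closedInterior)
    (p : ℝ≥0∞) :
    localError A p f T ≤ ENNReal.ofReal ((1 + K) * maxEdge H T * area T ^ p.toReal⁻¹) :=
  localError_le_of_abs_sub_le (hA.abs_sub_le hK hf (interp T f) h.abs_sub_interp_le)

open scoped Pointwise in
theorem volume_half_image (B : Plane) (s : Set Plane) :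
    volume ((fun y => (1 / 2 : ℝ) • y + (1 / 2 : ℝ) • B) '' s) = ENNReal.ofReal (1 / 4) * volume s := by
  have : (fun y => (1 / 2 : ℝ) • y + (1 / 2 : ℝ) • B) '' s =
      (fun y => y + (1 / 2 : ℝ) • B) '' ((1 / 2 : ℝ) • s) := by
    rw [← Set.image_smul, Set.image_image]
  rw [this, Set.image_add_right, measure_preimage_add_right, Measure.addHaar_smul]
  congr 2
  simp; norm_num

/-- A function which is more convex than `c` times a quadratic form is far from affine functions
in `L¹`. -/
theorem le_setIntegral_abs_sub {T : Triangle} {f : Plane → ℝ}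
    (hf : ContinuousOn f T.closedInterior) {H : Matrix (Fin 2) (Fin 2) ℝ} {c : ℝ}
    (hc : ConvexOn ℝ T.closedInterior fun x => f x - c * qf H x) (π : Plane →ᵃ[ℝ] ℝ) (i : Fin 3) :
    c * qf H (edge T i) / 128 * area T ≤ ∫ x in T.closedInterior, |f x - π x| := by
  set B := T.points (i + 1) with hB
  -- For `x` in the half-size copy `t` of `T` with centre `B`, the points `x`, `x + v`, `x + 2v` lie
  -- in `T`. The second difference of `f - π` at these points does not see `π`, so its lower bound
  -- comes from the convexity hypothesis on `f`.
  set v : Plane := (1 / 4 : ℝ) • edge T i with hv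
  set t : Set Plane := (fun y => (1 / 2 : ℝ) • y + (1 / 2 : ℝ) • B) '' T.closedInterior with ht
  have hBC : T.points (i + 2) = B + (4 : ℝ) • v := by
    rw [hv, edge, ← hB]; module
  have hmem : ∀ x ∈ t, ∀ s : ℝ, 0 ≤ s → s ≤ 2 → x + s • v ∈ T.closedInterior := by
    rintro _ ⟨y, hy, rfl⟩ s hs0 hs2
    have h1 := (convex_triangle T) (T.point_mem_closedInterior (i + 1))
      (T.point_mem_closedInterior (i + 2)) (show 0 ≤ 1 - s / 2 by linarith)
      (show 0 ≤ s / 2 by linarith) (by ring)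
    have h2 := (convex_triangle T) hy h1 (show (0 : ℝ) ≤ 1 / 2 by norm_num)
      (show (0 : ℝ) ≤ 1 / 2 by norm_num) (by norm_num)
    convert! h2 using 1
    rw [hBC, ← hB]; module
  set G : Plane → ℝ := T.closedInterior.indicator fun x => |f x - π x| with hG
  have hGint : Integrable G :=
    (integrable_indicator_iff (measurableSet_triangle T)).mpr
      (integrableOn_triangle (hf.sub (continuousOn_affineMap π _)).abs)
  have hG0 : ∀ x, 0 ≤ G x := fun x => Set.indicator_nonneg (fun _ _ => abs_nonneg _) x
  have htm : MeasurableSet t :=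
    (T.isCompact_closedInterior.image (by fun_prop)).measurableSet
  have hpt : ∀ x, t.indicator (fun _ => c * qf H (edge T i) / 8) x ≤
      G x + G (x + (2 : ℝ) • v) + 2 * G (x + v) := by
    intro x
    by_cases hx : x ∈ t
    · have m0 := hmem x hx 0 le_rfl (by norm_num)
      have m1 := hmem x hx 1 (by norm_num) (by norm_num)
      have m2 := hmem x hx 2 (by norm_num) (by norm_num)
      rw [zero_smul, add_zero] at m0
      rw [one_smul] at m1
      rw [Set.indicator_of_mem hx, hG, Set.indicator_of_mem m0, Set.indicator_of_mem m1,
        Set.indicator_of_mem m2]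
      have hcv := hc.2 m0 m2 (show (0 : ℝ) ≤ 1 / 2 by norm_num)
        (show (0 : ℝ) ≤ 1 / 2 by norm_num) (by norm_num)
      have hmid : (1 / 2 : ℝ) • x + (1 / 2 : ℝ) • (x + (2 : ℝ) • v) = x + v := by module
      rw [hmid] at hcv
      simp only [smul_eq_mul] at hcv
      have hq : qf H x + qf H (x + (2 : ℝ) • v) - 2 * qf H (x + v) = qf H (edge T i) / 8 := by
        have : edge T i = (4 : ℝ) • v := by rw [hv]; module
        rw [this]
        simp only [qf, PiLp.add_apply, PiLp.smul_apply, smul_eq_mul]; ring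
      have hπ : π x + π (x + (2 : ℝ) • v) = 2 * π (x + v) := by
        have h1 := π.map_vadd x v
        have h2 := π.map_vadd x ((2 : ℝ) • v)
        rw [map_smul] at h2
        simp only [vadd_eq_add, smul_eq_mul, add_comm _ x] at h1 h2
        rw [h1, h2]; ring
      have a0 := le_abs_self (f x - π x)
      have a1 := neg_abs_le (f (x + v) - π (x + v))
      have a2 := le_abs_self (f (x + (2 : ℝ) • v) - π (x + (2 : ℝ) • v))
      have hq' := congrArg (c * ·) hq
      simp only [mul_add, mul_sub] at hq'
      linarith
    · rw [Set.indicator_of_notMem hx]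
      have := hG0 x; have := hG0 (x + v); have := hG0 (x + (2 : ℝ) • v)
      positivity
  -- Each translate of `G` has the same integral, so integrating `hpt` gives `c qf / 8 * |T| / 4 ≤ 4
  -- ∫ G`; hence the constant 128.
  have hI1 := hGint.comp_add_right v
  have hI2 := hGint.comp_add_right ((2 : ℝ) • v)
  have hvt : volume t = ENNReal.ofReal (1 / 4 * area T) := by
    rw [ht, volume_half_image, volume_triangle, ← ENNReal.ofReal_mul (by norm_num)]
  have hint := integral_mono (f := t.indicator (fun _ => c * qf H (edge T i) / 8))
    (g := fun x => G x + G (x + (2 : ℝ) • v) + 2 * G (x + v))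
    ((integrable_indicator_iff htm).mpr (integrableOn_const (by rw [hvt]; exact ENNReal.ofReal_ne_top)))
    ((hGint.add hI2).add (hI1.const_mul 2)) hpt
  have hsum : ∫ x, G x + G (x + (2 : ℝ) • v) + 2 * G (x + v) =
      (∫ x, G x) + (∫ x, G x) + 2 * ∫ x, G x := by
    rw [integral_add (f := fun x => G x + G (x + (2 : ℝ) • v)) (hGint.add hI2) (hI1.const_mul 2),
      integral_add hGint hI2, integral_const_mul, integral_add_right_eq_self,
      integral_add_right_eq_self]
  rw [hsum, integral_indicator htm, setIntegral_const, hG, integral_indicator (measurableSet_triangle T), smul_eq_mul,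
    Measure.real, hvt, ENNReal.toReal_ofReal (by linarith [area_pos T])] at hint
  linarith

/-- The `L¹` bound holds for every affine function, in particular for `A T f`. Hölder's inequality
on `T` passes to `L^p` with a constant independent of `p`. -/
theorem le_localError {p : ℝ≥0∞} (hp : 1 ≤ p) {T : Triangle} {f : Plane → ℝ}
    (hf : ContinuousOn f T.closedInterior) {H : Matrix (Fin 2) (Fin 2) ℝ} {c : ℝ}
    (hc : ConvexOn ℝ T.closedInterior fun x => f x - c * qf H x) :
    ENNReal.ofReal (c * maxEdge H T / 128 * area T ^ p.toReal⁻¹) ≤ localError A p f T := by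
  obtain ⟨i, hi⟩ := exists_maxEdge H T
  have hcont : ContinuousOn (fun x => f x - A T f x) T.closedInterior :=
    hf.sub (continuousOn_affineMap _ _)
  have h1 := le_setIntegral_abs_sub hf hc (A T f) i
  rw [← hi] at h1
  have h2 := eLpNorm_le_eLpNorm_mul_rpow_measure_univ (μ := volume.restrict T.closedInterior) hp
    (hcont.aestronglyMeasurable (measurableSet_triangle T))
  rw [eLpNorm_one_eq_lintegral_enorm, ← ofReal_integral_norm_eq_lintegral_enorm
    (integrableOn_triangle hcont), Measure.restrict_apply_univ, volume_triangle,
    ENNReal.ofReal_rpow_of_pos (area_pos T)] at h2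
  have h3 := (ENNReal.ofReal_le_ofReal h1).trans h2
  have hpos : 0 < area T ^ (1 / (1 : ℝ≥0∞).toReal - 1 / p.toReal) := Real.rpow_pos_of_pos (area_pos T) _
  rw [← ENNReal.mul_le_mul_iff_left (ENNReal.ofReal_pos.mpr hpos).ne' ENNReal.ofReal_ne_top]
  refine le_trans (le_of_eq ?_) h3
  rw [← ENNReal.ofReal_mul' hpos.le]
  congr 1
  rw [mul_assoc, ← Real.rpow_add (area_pos T)]
  simp

theorem NearQuadratic.le_localError {f : Plane → ℝ} {H : Matrix (Fin 2) (Fin 2) ℝ}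
    {T : Triangle} (h : NearQuadratic f H T.closedInterior) (hf : ContinuousOn f T.closedInterior)
    {p : ℝ≥0∞} (hp : 1 ≤ p) :
    ENNReal.ofReal (maxEdge H T / 300 * area T ^ p.toReal⁻¹) ≤ localError A p f T := by
  refine le_trans (ENNReal.ofReal_le_ofReal ?_) (GreedyBisection.le_localError hp hf h.lower)
  have := maxEdge_nonneg h.nonneg T
  exact mul_le_mul_of_nonneg_right (by linarith) (Real.rpow_nonneg (area_pos T).le _)

end

section

/-! ### Convexity from bounds on the hessian -/

theorem dist_sq_le_maxEdge {T : Triangle} {x y : Plane} (hx : x ∈ T.closedInterior)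
    (hy : y ∈ T.closedInterior) : dist x y ^ 2 ≤ maxEdge 1 T := by
  rw [← Affine.Simplex.convexHull_eq_closedInterior] at hx hy
  obtain ⟨_, ⟨i, rfl⟩, _, ⟨j, rfl⟩, h⟩ := convexHull_exists_dist_ge2 hx hy
  refine (pow_le_pow_left₀ dist_nonneg h 2).trans ?_
  have key : ∀ k, ‖T.points (k + 2) - T.points (k + 1)‖ ^ 2 ≤ maxEdge 1 T := fun k => by
    have := qf_edge_le_maxEdge 1 T k
    rwa [qf_one] at this
  have h0 : 0 ≤ maxEdge 1 T := (sq_nonneg _).trans (key 0)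
  rw [dist_eq_norm]
  have k0 := key 0
  have k1 := key 1
  have k2 := key 2
  fin_cases i <;> fin_cases j <;> simp at k0 k1 k2 ⊢ <;> first | assumption | skip
  all_goals rw [← norm_neg, neg_sub]; assumption

/-- The hessian is controlled only in the interior; the convexity inequality passes to the closed
triangle by continuity. -/
theorem convexOn_triangle_of_interior {T : Triangle} {g : Plane → ℝ}
    (hg : ConvexOn ℝ (interior T.closedInterior) g) (hc : ContinuousOn g T.closedInterior) :
    ConvexOn ℝ T.closedInterior g := by
  refine ⟨convex_triangle T, fun x hx y hy a b ha hb hab => ?_⟩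
  set s := interior T.closedInterior with hs
  have hcl : closure s = T.closedInterior := by
    rw [hs, (convex_triangle T).closure_interior_eq_closure_of_nonempty_interior
      (interior_triangle_nonempty T), T.isClosed_closedInterior.closure_eq]
  have hmem : (x, y) ∈ closure (s ×ˢ s) := by rw [closure_prod_eq, hcl]; exact ⟨hx, hy⟩
  have hsT : s ⊆ T.closedInterior := interior_subset
  have h1 : ContinuousOn (fun z : Plane × Plane => g (a • z.1 + b • z.2))
      (T.closedInterior ×ˢ T.closedInterior) :=
    hc.comp (by fun_prop) fun z hz => convex_triangle T hz.1 hz.2 ha hb hab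
  have h2 : ContinuousOn (fun z : Plane × Plane => a • g z.1 + b • g z.2)
      (T.closedInterior ×ˢ T.closedInterior) :=
    ((hc.comp continuousOn_fst fun z hz => hz.1).const_smul a).add
      ((hc.comp continuousOn_snd fun z hz => hz.2).const_smul b)
  exact ContinuousWithinAt.closure_le (f := fun z : Plane × Plane => g (a • z.1 + b • z.2))
    (g := fun z : Plane × Plane => a • g z.1 + b • g z.2) hmem
    ((h1 (x, y) ⟨hx, hy⟩).mono (Set.prod_mono hsT hsT))
    ((h2 (x, y) ⟨hx, hy⟩).mono (Set.prod_mono hsT hsT))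
    fun z hz => hg.2 hz.1 hz.2 ha hb hab

theorem iteratedFDeriv_two_eq_qf_hessian (f : Plane → ℝ) (x v : Plane) :
    iteratedFDeriv ℝ 2 f x ![v, v] = qf (hessian f x) v := by
  have hv : v = v 0 • EuclideanSpace.single 0 1 + v 1 • EuclideanSpace.single 1 1 := by
    ext i; fin_cases i <;> simp
  simp only [qf, hessian, Matrix.of_apply, iteratedFDeriv_two_apply, Matrix.cons_val_zero,
    Matrix.cons_val_one]
  generalize fderiv ℝ (fderiv ℝ f) x = B
  conv_lhs => rw [hv]
  simp only [map_add, map_smul, add_apply, smul_apply,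
    smul_eq_mul]
  ring

/-- Along every segment the second derivative is nonnegative. The factor `σ` lets the same statement
yield lower bounds (`σ = 1`) and upper bounds (`σ = -1`) for `f`. -/
theorem convexOn_of_hessian {U : Set Plane} (hU : IsOpen U) (hconv : Convex ℝ U) {f : Plane → ℝ}
    (hf : ContDiffOn ℝ 2 f U) {H : Matrix (Fin 2) (Fin 2) ℝ} {σ c : ℝ}
    (h : ∀ x ∈ U, ∀ v, c * qf H v ≤ σ * qf (hessian f x) v) :
    ConvexOn ℝ U fun x => σ * f x - c / 2 * qf H x := by
  refine ⟨hconv, fun x hx y hy a b ha hb hab => ?_⟩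
  set v := y - x with hv
  set γ : ℝ → Plane := fun t => x + t • v with hγ
  have hγU : ∀ t ∈ Set.Icc (0 : ℝ) 1, γ t ∈ U := by
    intro t ht
    have := hconv hx hy (sub_nonneg.2 ht.2) ht.1 (by ring)
    convert! this using 1
    simp only [hγ, hv]; module
  have hγd : ∀ t, HasDerivAt γ v t := fun t => by
    have := ((hasDerivAt_id t).smul_const v).const_add x
    rw [one_smul] at this
    exact this
  have hcd : ∀ t ∈ Set.Icc (0 : ℝ) 1, ContDiffAt ℝ 2 f (γ t) := fun t ht =>
    hf.contDiffAt (hU.mem_nhds (hγU t ht))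
  have hd1 : ∀ t ∈ Set.Icc (0 : ℝ) 1, HasDerivAt (fun t => f (γ t)) (fderiv ℝ f (γ t) v) t :=
    fun t ht => ((hcd t ht).differentiableAt (by norm_num)).hasFDerivAt.comp_hasDerivAt t (hγd t)
  have hd2 : ∀ t ∈ Set.Icc (0 : ℝ) 1, HasDerivAt (fun t => fderiv ℝ f (γ t) v)
      (qf (hessian f (γ t)) v) t := fun t ht => by
    have h1 : DifferentiableAt ℝ (fderiv ℝ f) (γ t) :=
      ((hcd t ht).fderiv_right (m := 1) (by norm_num)).differentiableAt (by norm_num)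
    have h2 := (h1.hasFDerivAt.comp_hasDerivAt t (hγd t)).clm_apply (hasDerivAt_const t v)
    simp only [map_zero, add_zero] at h2
    rw [← iteratedFDeriv_two_eq_qf_hessian, iteratedFDeriv_two_apply]
    exact h2
  set β := H 0 0 * (2 * x 0 * v 0) + (H 0 1 + H 1 0) * (x 0 * v 1 + x 1 * v 0) +
    H 1 1 * (2 * x 1 * v 1) with hβ
  have hq : ∀ t, qf H (γ t) = qf H x + β * t + qf H v * t ^ 2 := fun t => by
    simp only [hγ, qf, PiLp.add_apply, PiLp.smul_apply, smul_eq_mul, hβ]; ring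
  have hq1 : ∀ t, HasDerivAt (fun t => qf H (γ t)) (β + qf H v * (2 * t)) t := fun t => by
    simp_rw [hq]
    have := ((hasDerivAt_const t (qf H x)).add ((hasDerivAt_id t).const_mul β)).add
      (((hasDerivAt_id t).pow 2).const_mul (qf H v))
    refine this.congr_deriv ?_
    simp
  have hq2 : ∀ t, HasDerivAt (fun t => β + qf H v * (2 * t)) (2 * qf H v) t := fun t => by
    have := (((hasDerivAt_id t).const_mul 2).const_mul (qf H v)).const_add β
    simpa [mul_comm] using this
  have hconv1 : ConvexOn ℝ (Set.Icc 0 1) fun t => σ * f (γ t) - c / 2 * qf H (γ t) := by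
    refine convexOn_of_hasDerivWithinAt2_nonneg (convex_Icc 0 1)
      (f' := fun t => σ * fderiv ℝ f (γ t) v - c / 2 * (β + qf H v * (2 * t)))
      (f'' := fun t => σ * qf (hessian f (γ t)) v - c / 2 * (2 * qf H v)) ?_ ?_ ?_ ?_
    · exact fun t ht => (((hd1 t ht).const_mul σ).sub
        ((hq1 t).const_mul (c / 2))).continuousAt.continuousWithinAt
    · exact fun t ht => (((hd1 t (interior_subset ht)).const_mul σ).sub
        ((hq1 t).const_mul (c / 2))).hasDerivWithinAt
    · exact fun t ht => (((hd2 t (interior_subset ht)).const_mul σ).sub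
        ((hq2 t).const_mul (c / 2))).hasDerivWithinAt
    · intro t ht
      have := h (γ t) (hγU t (interior_subset ht)) v
      linarith
  have := hconv1.2 (Set.left_mem_Icc.2 zero_le_one) (Set.right_mem_Icc.2 zero_le_one) ha hb hab
  have e0 : γ 0 = x := by simp [hγ]
  have e1 : γ 1 = y := by simp [hγ, hv]
  have e2 : γ b = a • x + b • y := by
    obtain rfl : a = 1 - b := by linarith
    simp only [hγ, hv]; module
  simpa [e0, e1, e2] using this

theorem hessianWithin_uniform {T : Triangle} {f : Plane → ℝ}
    (hf : ContDiffOn ℝ 2 f T.closedInterior) {ε : ℝ} (hε : 0 < ε) :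
    ∃ δ > 0, ∀ x ∈ interior T.closedInterior, ∀ y ∈ interior T.closedInterior, dist x y < δ →
      ∀ i j, |hessian f x i j - hessian f y i j| ≤ ε := by
  have hu : UniqueDiffOn ℝ T.closedInterior :=
    uniqueDiffOn_convex (convex_triangle T) (interior_triangle_nonempty T)
  have hcont := hf.continuousOn_iteratedFDerivWithin (m := 2) le_rfl hu
  have hunif := T.isCompact_closedInterior.uniformContinuousOn_of_continuous hcont
  rw [Metric.uniformContinuousOn_iff] at hunif
  obtain ⟨δ, hδ, h⟩ := hunif ε hε
  refine ⟨δ, hδ, fun x hx y hy hxy i j => ?_⟩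
  have heq : ∀ z ∈ interior T.closedInterior,
      iteratedFDerivWithin ℝ 2 f T.closedInterior z = iteratedFDeriv ℝ 2 f z := fun z hz => by
    have h1 : ContDiffAt ℝ 2 f z :=
      (hf.mono interior_subset).contDiffAt (isOpen_interior.mem_nhds hz)
    exact iteratedFDerivWithin_eq_iteratedFDeriv hu h1 (interior_subset hz)
  have h2 := (h x (interior_subset hx) y (interior_subset hy) hxy).le
  rw [heq x hx, heq y hy, dist_eq_norm] at h2
  have h3 := (iteratedFDeriv ℝ 2 f x - iteratedFDeriv ℝ 2 f y).le_opNorm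
    ![EuclideanSpace.single i 1, EuclideanSpace.single j 1]
  simp only [Fin.prod_univ_two, Matrix.cons_val_zero, Matrix.cons_val_one, PiLp.norm_single,
    norm_one, mul_one] at h3
  exact h3.trans h2

/-! ### Comparison of quadratic forms and of determinants -/

theorem abs_qf_sub_le {H H' : Matrix (Fin 2) (Fin 2) ℝ} {ε : ℝ} (h : ∀ i j, |H i j - H' i j| ≤ ε)
    (v : Plane) : |qf H v - qf H' v| ≤ 2 * ε * qf 1 v := by
  have e : qf H v - qf H' v = (H 0 0 - H' 0 0) * v 0 ^ 2 + (H 0 1 - H' 0 1) * (v 0 * v 1) +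
      (H 1 0 - H' 1 0) * (v 0 * v 1) + (H 1 1 - H' 1 1) * v 1 ^ 2 := by simp only [qf]; ring
  have e1 : qf 1 v = v 0 ^ 2 + v 1 ^ 2 := by simp [qf]
  have hε : 0 ≤ ε := (abs_nonneg _).trans (h 0 0)
  have a1 : |(H 0 0 - H' 0 0) * v 0 ^ 2| ≤ ε * v 0 ^ 2 := by
    rw [abs_mul, abs_of_nonneg (sq_nonneg (v 0))]
    exact mul_le_mul_of_nonneg_right (h 0 0) (sq_nonneg _)
  have a4 : |(H 1 1 - H' 1 1) * v 1 ^ 2| ≤ ε * v 1 ^ 2 := by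
    rw [abs_mul, abs_of_nonneg (sq_nonneg (v 1))]
    exact mul_le_mul_of_nonneg_right (h 1 1) (sq_nonneg _)
  have hvv : |v 0 * v 1| ≤ (v 0 ^ 2 + v 1 ^ 2) / 2 := by
    rw [abs_le]; constructor <;> nlinarith [sq_nonneg (v 0 + v 1), sq_nonneg (v 0 - v 1)]
  have a2 : |(H 0 1 - H' 0 1) * (v 0 * v 1)| ≤ ε * ((v 0 ^ 2 + v 1 ^ 2) / 2) := by
    rw [abs_mul]; exact mul_le_mul (h 0 1) hvv (abs_nonneg _) hε
  have a3 : |(H 1 0 - H' 1 0) * (v 0 * v 1)| ≤ ε * ((v 0 ^ 2 + v 1 ^ 2) / 2) := by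
    rw [abs_mul]; exact mul_le_mul (h 1 0) hvv (abs_nonneg _) hε
  rw [e, e1]
  rw [abs_le] at *
  constructor <;> linarith

theorem entries_of_qf_nonneg {P : Matrix (Fin 2) (Fin 2) ℝ} (h : ∀ v, 0 ≤ qf P v)
    (hs : P 0 1 = P 1 0) : 0 ≤ P 0 0 ∧ 0 ≤ P 1 1 ∧ P 0 1 ^ 2 ≤ P 0 0 * P 1 1 := by
  refine ⟨?_, ?_, ?_⟩
  · simpa [qf] using h (!₂[1, 0])
  · simpa [qf] using h (!₂[0, 1])
  · have h1 : ∀ t : ℝ, 0 ≤ P 0 0 * (t * t) + (2 * P 0 1) * t + P 1 1 := fun t => by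
      have := h (!₂[t, 1])
      simp [qf, ← hs] at this
      linarith
    have := discrim_le_zero h1
    rw [discrim] at this
    linarith

/-- With `P = G - κ B` positive semidefinite, `det (κ B + P)` is `κ² det B + det P` plus `κ` times a
mixed discriminant, and both added terms are nonnegative. -/
theorem sqrt_det_le {B G : Matrix (Fin 2) (Fin 2) ℝ} {κ : ℝ} (hκ : 0 ≤ κ) (hB : ∀ v, 0 ≤ qf B v)
    (hBs : B 0 1 = B 1 0) (hGs : G 0 1 = G 1 0) (h : ∀ v, κ * qf B v ≤ qf G v) :
    κ * Real.sqrt B.det ≤ Real.sqrt G.det := by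
  obtain ⟨b0, b1, b2⟩ := entries_of_qf_nonneg hB hBs
  have hP : ∀ v, 0 ≤ qf (G - κ • B) v := fun v => by
    have := h v
    simp only [qf, Matrix.sub_apply, Matrix.smul_apply, smul_eq_mul] at *
    linarith
  obtain ⟨p0, p1, p2⟩ := entries_of_qf_nonneg hP (by simp [hBs, hGs])
  apply Real.le_sqrt_of_sq_le
  rw [mul_pow, Real.sq_sqrt (by rw [Matrix.det_fin_two, ← hBs]; nlinarith)]
  simp only [Matrix.det_fin_two, Matrix.sub_apply, Matrix.smul_apply, smul_eq_mul, ← hBs, ← hGs] at *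
  set a := B 0 0
  set b := B 0 1
  set c := B 1 1
  set x := G 0 0 - κ * a
  set y := G 0 1 - κ * b
  set z := G 1 1 - κ * c
  have e0 : G 0 0 = κ * a + x := by ring
  have e1 : G 0 1 = κ * b + y := by ring
  have e2 : G 1 1 = κ * c + z := by ring
  rw [e0, e1, e2]
  -- Nonnegativity of the mixed discriminant: `b² y² ≤ (a c) (x z) = (a z) (c x) ≤ ((a z + c x) /
  -- 2)²`.
  have key : 2 * b * y ≤ a * z + c * x := by
    refine le_of_abs_le (abs_le_of_sq_le_sq ?_ (by positivity))
    have := mul_le_mul b2 p2 (sq_nonneg _) (mul_nonneg b0 b1)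
    nlinarith [sq_nonneg (a * z - c * x)]
  nlinarith [mul_nonneg hκ (sub_nonneg.2 key)]

/-- A convex function of class `C²` on the closure of an open set. -/
structure StronglyConvexC2 (Ω : Set Plane) (f : Plane → ℝ) (m : ℝ) : Prop where
  isOpen : IsOpen Ω
  contDiffOn : ContDiffOn ℝ 2 f (closure Ω)
  pos : 0 < m
  posSemidef : ∀ x ∈ Ω, (hessian f x - m • (1 : Matrix (Fin 2) (Fin 2) ℝ)).PosSemidef

variable {Ω : Set Plane} {f : Plane → ℝ} {m : ℝ}

theorem StronglyConvexC2.symm (h : StronglyConvexC2 Ω f m) {x : Plane} (hx : x ∈ Ω) :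
    hessian f x 0 1 = hessian f x 1 0 := by
  have := (h.posSemidef x hx).isHermitian.apply 0 1
  simpa using this.symm

theorem StronglyConvexC2.le_qf (h : StronglyConvexC2 Ω f m) {x : Plane} (hx : x ∈ Ω) (v : Plane) :
    m * qf 1 v ≤ qf (hessian f x) v := by
  have := (h.posSemidef x hx).dotProduct_mulVec_nonneg v.ofLp
  simp [Matrix.mulVec, dotProduct, Fin.sum_univ_two] at this
  simp [qf]
  linarith

theorem StronglyConvexC2.inter_nonempty (_h : StronglyConvexC2 Ω f m) {T : Triangle}
    (hT : T.closedInterior ⊆ closure Ω) : (interior T.closedInterior ∩ Ω).Nonempty := by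
  obtain ⟨x, hx⟩ := interior_triangle_nonempty T
  exact mem_closure_iff.mp (hT (interior_subset hx)) _ isOpen_interior hx

/-- A triangle in `closure Ω` may cross slits that do not belong to `Ω`. The bound on the hessian
extends to them by continuity, as `f` is of class `C²` inside the triangle. -/
theorem StronglyConvexC2.le_qf_of_mem_interior (h : StronglyConvexC2 Ω f m) {T : Triangle}
    (hT : T.closedInterior ⊆ closure Ω) {x : Plane} (hx : x ∈ interior T.closedInterior)
    (v : Plane) : m * qf 1 v ≤ qf (hessian f x) v := by
  have hcl : x ∈ closure (interior T.closedInterior ∩ Ω) :=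
    isOpen_interior.inter_closure ⟨hx, hT (interior_subset hx)⟩
  have hcd : ContDiffAt ℝ 2 f x :=
    (h.contDiffOn.mono (interior_subset.trans hT)).contDiffAt (isOpen_interior.mem_nhds hx)
  have hcont : ContinuousAt (fun y => iteratedFDeriv ℝ 2 f y ![v, v]) x := by
    have h1 : ContinuousAt (iteratedFDeriv ℝ 2 f) x := by
      exact (hcd.iteratedFDeriv_right (m := 0) (i := 2) (by norm_num)).continuousAt
    exact (continuous_eval_const (![v, v] : Fin 2 → Plane)).continuousAt.comp h1
  simp_rw [iteratedFDeriv_two_eq_qf_hessian] at hcont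
  exact ContinuousWithinAt.closure_le hcl continuousWithinAt_const hcont.continuousWithinAt
    fun y hy => h.le_qf hy.2 v

theorem StronglyConvexC2.continuousOn (h : StronglyConvexC2 Ω f m) {T : Triangle}
    (hT : T.closedInterior ⊆ closure Ω) : ContinuousOn f T.closedInterior :=
  (h.contDiffOn.mono hT).continuousOn

theorem StronglyConvexC2.convexOn (h : StronglyConvexC2 Ω f m) {T : Triangle}
    (hT : T.closedInterior ⊆ closure Ω) :
    ConvexOn ℝ T.closedInterior fun x => f x - m / 2 * qf 1 x := by
  refine convexOn_triangle_of_interior ?_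
    ((h.continuousOn hT).sub ((continuous_qf 1).const_mul _).continuousOn)
  have := convexOn_of_hessian (σ := 1) (c := m) (H := 1) isOpen_interior (convex_triangle T).interior
    (h.contDiffOn.mono (interior_subset.trans hT))
    (fun x hx v => by rw [one_mul]; exact h.le_qf_of_mem_interior hT hx v)
  simpa using this

theorem qf_one_nonneg (v : Plane) : 0 ≤ qf 1 v := by rw [qf_one]; positivity

theorem StronglyConvexC2.exists_nearQuadratic (h : StronglyConvexC2 Ω f m) {R₀ : Triangle}
    (hR₀ : R₀.closedInterior ⊆ closure Ω) :
    ∃ δ > 0, ∀ R : Triangle, R.closedInterior ⊆ R₀.closedInterior → maxEdge 1 R < δ →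
      ∃ H, NearQuadratic f H R.closedInterior ∧ ∀ x ∈ interior R.closedInterior ∩ Ω,
        99 / 100 * Real.sqrt H.det ≤ Real.sqrt (hessian f x).det := by
  -- Entries within `m / 200` change the form by at most `m / 100` times `qf 1`, which by strong
  -- convexity is one percent of the form itself.
  obtain ⟨δ, hδ, hu⟩ := hessianWithin_uniform (h.contDiffOn.mono hR₀)
    (show 0 < m / 200 by linarith [h.pos])
  refine ⟨δ ^ 2, by positivity, fun R hR hRδ => ?_⟩
  obtain ⟨z, hz, hzΩ⟩ := h.inter_nonempty (hR.trans hR₀)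
  have hH := h.le_qf hzΩ
  have hm := h.pos
  have hH0 : ∀ v, 0 ≤ qf (hessian f z) v := fun v =>
    (mul_nonneg hm.le (qf_one_nonneg v)).trans (hH v)
  have hcmp : ∀ x ∈ interior R.closedInterior, ∀ v,
      |qf (hessian f x) v - qf (hessian f z) v| ≤ 1 / 100 * qf (hessian f z) v := by
    intro x hx v
    have hd : dist x z < δ := by
      have h1 := (dist_sq_le_maxEdge (interior_subset hx) (interior_subset hz)).trans_lt hRδ
      exact lt_of_pow_lt_pow_left₀ 2 hδ.le h1
    have := abs_qf_sub_le (hu x (interior_mono hR hx) z (interior_mono hR hz) hd) v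
    have h2 := hH v
    linarith
  have hcont := h.continuousOn (hR.trans hR₀)
  refine ⟨hessian f z, ⟨?_, ?_, hH0, h.symm hzΩ, ?_⟩, fun x hx => ?_⟩
  · refine convexOn_triangle_of_interior ?_ (hcont.sub ((continuous_qf _).const_mul _).continuousOn)
    have := convexOn_of_hessian (σ := 1) (c := 99 / 100) (H := hessian f z) isOpen_interior
      (convex_triangle R).interior (h.contDiffOn.mono (interior_subset.trans (hR.trans hR₀)))
      (fun x hx v => by have := (abs_le.mp (hcmp x hx v)).1; linarith)
    norm_num at this ⊢
    exact this
  · refine convexOn_triangle_of_interior ?_ (((continuous_qf _).const_mul _).continuousOn.sub hcont)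
    have := convexOn_of_hessian (σ := -1) (c := -101 / 100) (H := hessian f z) isOpen_interior
      (convex_triangle R).interior (h.contDiffOn.mono (interior_subset.trans (hR.trans hR₀)))
      (fun x hx v => by have := (abs_le.mp (hcmp x hx v)).2; linarith)
    convert! this using 1
    ext x; ring
  · have hP := entries_of_qf_nonneg (P := hessian f z - m • 1) (fun v => by
      have := hH v
      simp [qf] at *
      linarith) (by simp [h.symm hzΩ])
    have hs := h.symm hzΩ
    simp only [Matrix.sub_apply, Matrix.smul_apply, Matrix.one_apply_eq, smul_eq_mul, mul_one,
      ne_eq, zero_ne_one, not_false_eq_true, Matrix.one_apply_ne, mul_zero, sub_zero] at hP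
    rw [Matrix.det_fin_two, ← hs]
    nlinarith [hP.1, hP.2.1, hP.2.2]
  · refine sqrt_det_le (by norm_num) hH0 (h.symm hzΩ) (h.symm hx.2) fun v => ?_
    have := (abs_le.mp (hcmp x hx.1 v)).1
    linarith

end

section

/-! ### Flat triangles -/

variable {Ω : Set Plane} {f : Plane → ℝ} {m : ℝ}

/-- Second differences of a convex function increase with the interval. -/
theorem secondDifference_mono {s : Set Plane} {g : Plane → ℝ} (hg : ConvexOn ℝ s g) {X w : Plane}
    (hX : X ∈ s) (hY : X + w ∈ s) {t : ℝ} (ht0 : 0 ≤ t) (ht1 : t ≤ 1) :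
    (g X + g (X + t • w)) / 2 - g (X + (t / 2) • w) ≤
      (g X + g (X + w)) / 2 - g (X + (1 / 2 : ℝ) • w) := by
  set d := 1 - t / 2 with hd
  have hd0 : 0 < d := by linarith
  have hZ : X + (t / 2) • w ∈ s := by
    have := hg.1 hX hY (show 0 ≤ 1 - t / 2 by linarith) (show 0 ≤ t / 2 by linarith) (by ring)
    convert! this using 1; module
  -- Both `X + t w` and `X + w / 2` lie between `X + (t / 2) w` and `X + w`. Half the first
  -- convexity inequality plus the second is the claim.
  have h1 := hg.2 hY hZ (show 0 ≤ t / 2 / d by positivity)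
    (show 0 ≤ (1 - t) / d from div_nonneg (by linarith) hd0.le) (by field_simp; rw [hd]; ring)
  have h2 := hg.2 hY hZ (show 0 ≤ (1 - t) / 2 / d from div_nonneg (by linarith) hd0.le)
    (show 0 ≤ 1 / 2 / d by positivity) (by field_simp; rw [hd]; ring)
  have e1 : (t / 2 / d) • (X + w) + ((1 - t) / d) • (X + (t / 2) • w) = X + t • w := by
    have a1 : t / 2 / d + (1 - t) / d = 1 := by field_simp; rw [hd]; ring
    have a2 : t / 2 / d + (1 - t) / d * (t / 2) = t := by field_simp; rw [hd]; ring
    calc _ = (t / 2 / d + (1 - t) / d) • X + (t / 2 / d + (1 - t) / d * (t / 2)) • w := by module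
      _ = _ := by rw [a1, a2, one_smul]
  have e2 : ((1 - t) / 2 / d) • (X + w) + (1 / 2 / d) • (X + (t / 2) • w) =
      X + (1 / 2 : ℝ) • w := by
    have a1 : (1 - t) / 2 / d + 1 / 2 / d = 1 := by field_simp; rw [hd]; ring
    have a2 : (1 - t) / 2 / d + 1 / 2 / d * (t / 2) = 1 / 2 := by field_simp; rw [hd]; ring
    calc _ = ((1 - t) / 2 / d + 1 / 2 / d) • X + ((1 - t) / 2 / d + 1 / 2 / d * (t / 2)) • w := by
          module
      _ = _ := by rw [a1, a2, one_smul]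
  rw [e1] at h1
  rw [e2] at h2
  simp only [smul_eq_mul] at h1 h2
  have b1 : t / 2 / d / 2 + (1 - t) / 2 / d = 1 / 2 := by field_simp; rw [hd]; ring
  have b2 : (1 - t) / d / 2 + 1 / 2 / d = 1 := by field_simp; rw [hd]; ring
  have c1 := congrArg (· * g (X + w)) b1
  have c2 := congrArg (· * g (X + (t / 2) • w)) b2
  linarith

/-- If `[X, X + w]` is a longest edge of the flat triangle with the third vertex `X + u`, then the
second difference along it exceeds the one along a notably shorter edge `[X, X + u]`. -/
theorem secondDifference_lt {s : Set Plane} (hs : Convex ℝ s)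
    (hconv : ConvexOn ℝ s fun x => f x - m / 2 * qf 1 x) {δ L : ℝ} (hm : 0 < m) (hL : 0 < L)
    (hδ : ∀ x ∈ s, ∀ y ∈ s, dist x y < δ → |f x - f y| ≤ m * L / 200) {X u w : Plane}
    (hX : X ∈ s) (hY : X + w ∈ s) (hZ : X + u ∈ s) (hwL : L ≤ qf 1 w)
    (huw : qf 1 (w - u) ≤ qf 1 w) (hu : 10 * qf 1 u < 9 * qf 1 w)
    (hcross : cross w u ^ 2 < δ ^ 2 * L) (hδ0 : 0 < δ) :
    (f X + f (X + u)) / 2 - f (X + (1 / 2 : ℝ) • u) <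
      (f X + f (X + w)) / 2 - f (X + (1 / 2 : ℝ) • w) := by
  have hq : ∀ v : Plane, qf 1 v = v 0 ^ 2 + v 1 ^ 2 := fun v => by simp [qf]
  have hw0 : 0 < qf 1 w := hL.trans_le hwL
  set ip := u 0 * w 0 + u 1 * w 1 with hip
  have hlag : ip ^ 2 + cross w u ^ 2 = qf 1 u * qf 1 w := by
    rw [hip, cross, hq, hq]; ring
  have hip0 : 0 ≤ ip := by
    have : qf 1 (w - u) = qf 1 w + qf 1 u - 2 * ip := by
      simp only [hq, PiLp.sub_apply, hip]; ring
    have := qf_one_nonneg u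
    linarith
  -- `X + t w` is the orthogonal projection of `X + u` to the long edge. Its distance to `X + u` is
  -- `|cross w u| / |w| < δ`, so replacing `u` by `t w` hardly changes `f`.
  set t := ip / qf 1 w with ht
  have ht0 : 0 ≤ t := div_nonneg hip0 hw0.le
  have htw : t * qf 1 w = ip := by rw [ht]; field_simp
  have ht2 : t ^ 2 * qf 1 w ≤ qf 1 u := by
    have h1 : t ^ 2 * qf 1 w * qf 1 w ≤ qf 1 u * qf 1 w := by
      rw [← hlag, ← htw]; nlinarith [sq_nonneg (cross w u)]
    exact le_of_mul_le_mul_right h1 hw0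
  have ht1 : t ≤ 1 := by
    by_contra h
    push Not at h
    nlinarith
  have hdist : dist (X + u) (X + t • w) < δ := by
    rw [dist_add_left, dist_eq_norm]
    refine lt_of_pow_lt_pow_left₀ 2 hδ0.le ?_
    rw [← qf_one]
    have e : qf 1 (u - t • w) * qf 1 w = cross w u ^ 2 := by
      have : qf 1 (u - t • w) = qf 1 u - 2 * t * ip + t ^ 2 * qf 1 w := by
        simp only [hq, PiLp.sub_apply, PiLp.smul_apply, smul_eq_mul, hip]; ring
      rw [this]
      linear_combination (t * qf 1 w - ip) * htw - hlag
    have h2 : qf 1 (u - t • w) * L ≤ qf 1 (u - t • w) * qf 1 w :=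
      mul_le_mul_of_nonneg_left hwL (qf_one_nonneg _)
    exact lt_of_mul_lt_mul_right (h2.trans_lt (e ▸ hcross)) hL.le
  have hcomb : ∀ r : ℝ, 0 ≤ r → r ≤ 1 → ∀ v : Plane, X + v ∈ s → X + r • v ∈ s := by
    intro r h0 h1 v hv
    have := hs hX hv (sub_nonneg.2 h1) h0 (by ring)
    convert! this using 1; module
  have hdist2 : dist (X + (1 / 2 : ℝ) • u) (X + (t / 2) • w) < δ := by
    have e : dist (X + (1 / 2 : ℝ) • u) (X + (t / 2) • w) = 1 / 2 * dist (X + u) (X + t • w) := by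
      rw [dist_add_left, dist_add_left, dist_eq_norm, dist_eq_norm,
        show (1 / 2 : ℝ) • u - (t / 2) • w = (1 / 2 : ℝ) • (u - t • w) by module, norm_smul]
      norm_num
    rw [e]
    have := dist_nonneg (x := X + u) (y := X + t • w)
    linarith
  have m1 := hcomb t ht0 ht1 w hY
  have m2 := hcomb (1 / 2) (by norm_num) (by norm_num) u hZ
  have m3 := hcomb (t / 2) (by linarith) (by linarith) w hY
  have a1 := (abs_le.mp (hδ _ hZ _ m1 hdist)).2
  have a2 := (abs_le.mp (hδ _ m2 _ m3 hdist2)).1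
  have a3 := secondDifference_mono hconv hX hY ht0 ht1
  -- With `t² < 9/10`, the strongly convex part gains at least `m L / 80`, whereas the two
  -- replacements cost at most `3 m L / 400`.
  have e3 : (qf 1 X + qf 1 (X + w)) / 2 - qf 1 (X + (1 / 2 : ℝ) • w) -
      ((qf 1 X + qf 1 (X + t • w)) / 2 - qf 1 (X + (t / 2) • w)) =
      (qf 1 w - t ^ 2 * qf 1 w) / 4 := by
    simp only [hq, PiLp.add_apply, PiLp.smul_apply, smul_eq_mul]; ring
  have e4 : m * L ≤ m * qf 1 w := mul_le_mul_of_nonneg_left hwL hm.le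
  have e5 : m * (t ^ 2 * qf 1 w) ≤ m * (9 / 10 * qf 1 w) :=
    mul_le_mul_of_nonneg_left (by linarith) hm.le
  have e6 := congrArg (m * ·) e3
  have e7 : 0 < m * L := mul_pos hm hL
  simp only [mul_sub, mul_div_assoc'] at e6
  linarith

/-- If a notably shorter edge were cut, `secondDifference_lt` would give the longest edge a larger
second difference, contradicting the decision rule. -/
theorem StronglyConvexC2.exists_flat (h : StronglyConvexC2 Ω f m) {R₀ : Triangle}
    (hR₀ : R₀.closedInterior ⊆ closure Ω) {L : ℝ} (hL : 0 < L) :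
    ∃ α > 0, ∀ T : Triangle, T.closedInterior ⊆ R₀.closedInterior → area T ≤ α →
      L ≤ maxEdge 1 T → ∀ i, (∀ j, decision f T i ≤ decision f T j) →
        9 * maxEdge 1 T ≤ 10 * qf 1 (edge T i) := by
  have hm := h.pos
  have hc := h.continuousOn hR₀
  have huc := R₀.isCompact_closedInterior.uniformContinuousOn_of_continuous hc
  rw [Metric.uniformContinuousOn_iff] at huc
  obtain ⟨δ, hδ, hu⟩ := huc (m * L / 200) (by positivity)
  obtain ⟨ω, hω, hωa⟩ := exists_area_eq
  refine ⟨ω * (δ * Real.sqrt L / 2), by positivity, fun T hT hα hLT i hi => ?_⟩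
  by_contra hcon
  push Not at hcon
  obtain ⟨j, hj⟩ := exists_maxEdge 1 T
  have hTc : ConvexOn ℝ T.closedInterior f := by
    have := ((h.convexOn hR₀).subset hT (convex_triangle T)).add
      ((convexOn_qf qf_one_nonneg T.closedInterior (convex_triangle T)).smul
        (show 0 ≤ m / 2 by linarith))
    convert! this using 1
    ext x; simp
  have hsd := secDiff_le_of_decision_le hTc (hc.mono hT) (hi j)
  have hcr : |cross (edge T 0) (edge T 1)| ≤ δ * Real.sqrt L / 2 := by
    rw [hωa] at hα
    exact le_of_mul_le_mul_left hα hω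
  have hcr2 : cross (edge T 0) (edge T 1) ^ 2 < δ ^ 2 * L := by
    rw [← sq_abs]
    calc |cross (edge T 0) (edge T 1)| ^ 2 ≤ (δ * Real.sqrt L / 2) ^ 2 :=
          pow_le_pow_left₀ (abs_nonneg _) hcr 2
      _ = δ ^ 2 * L / 4 := by rw [div_pow, mul_pow, Real.sq_sqrt hL.le]; norm_num
      _ < δ ^ 2 * L := by have : 0 < δ ^ 2 * L := by positivity
                          linarith
  have hpt : ∀ k, T.points k ∈ R₀.closedInterior := fun k => hT (T.point_mem_closedInterior k)
  have hδ' : ∀ x ∈ R₀.closedInterior, ∀ y ∈ R₀.closedInterior, dist x y < δ →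
      |f x - f y| ≤ m * L / 200 := fun x hx y hy hxy => (hu x hx y hy hxy).le
  have hmid : ∀ P Q : Plane, midpoint ℝ P Q = P + (1 / 2 : ℝ) • (Q - P) := fun P Q => by
    rw [midpoint_eq_smul_add, invOf_eq_inv]; module
  have key : ∀ X Y Z : Plane, X ∈ R₀.closedInterior → Y ∈ R₀.closedInterior →
      Z ∈ R₀.closedInterior → qf 1 (Y - X) = maxEdge 1 T → qf 1 (Y - Z) ≤ maxEdge 1 T →
      qf 1 (Z - X) = qf 1 (edge T i) →
      cross (Y - X) (Z - X) ^ 2 = cross (edge T 0) (edge T 1) ^ 2 →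
      (f X + f Z) / 2 - f (midpoint ℝ X Z) < (f X + f Y) / 2 - f (midpoint ℝ X Y) := by
    intro X Y Z hX hY hZ h1 h2 h3 h4
    have := secondDifference_lt (X := X) (w := Y - X) (u := Z - X) (convex_triangle R₀)
      (h.convexOn hR₀) hm hL hδ' hX (by simpa using hY) (by simpa using hZ) (by rwa [h1])
      (by rw [h1, sub_sub_sub_cancel_right]; exact h2) (by rw [h1, h3]; exact hcon)
      (by rw [h4]; exact hcr2) hδ
    simpa [hmid] using this
  have hcross1 : cross (T.points (j + 1) - T.points (j + 2)) (T.points j - T.points (j + 2)) ^ 2 =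
      cross (edge T 0) (edge T 1) ^ 2 := by
    rw [← cross_edge T j]
    fin_cases j <;> simp [cross, edge] <;> ring
  have hcross2 : cross (T.points (j + 2) - T.points (j + 1)) (T.points j - T.points (j + 1)) ^ 2 =
      cross (edge T 0) (edge T 1) ^ 2 := by
    rw [← cross_edge T j]
    fin_cases j <;> simp [cross, edge] <;> ring
  have hqs : ∀ u v : Plane, qf 1 (u - v) = qf 1 (v - u) := fun u v => by
    rw [← qf_neg, neg_sub]
  have hij : i ≠ j := by
    rintro rfl
    rw [hj] at hcon
    linarith [qf_one_nonneg (edge T i)]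
  have hcases : i = j + 1 ∨ i = j + 2 :=
    (by decide : ∀ i j : Fin 3, i ≠ j → i = j + 1 ∨ i = j + 2) i j hij
  have hj3 : j + 2 + 1 = j := (by decide : ∀ j : Fin 3, j + 2 + 1 = j) j
  have hj4 : j + 2 + 2 = j + 1 := (by decide : ∀ j : Fin 3, j + 2 + 2 = j + 1) j
  have hj5 : j + 1 + 1 = j + 2 := (by decide : ∀ j : Fin 3, j + 1 + 1 = j + 2) j
  have hj6 : j + 1 + 2 = j := (by decide : ∀ j : Fin 3, j + 1 + 2 = j) j
  rcases hcases with rfl | rfl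
  · have := key (T.points (j + 2)) (T.points (j + 1)) (T.points j) (hpt _) (hpt _) (hpt _)
      (by rw [hj, hqs]; rfl)
      (by have := qf_edge_le_maxEdge 1 T (j + 2)
          rwa [edge, hj3, hj4] at this)
      (by rw [edge, hj6, hj5]) hcross1
    simp only [secDiff, edgeMidpoint, hj5, hj6] at hsd
    rw [midpoint_comm (T.points (j + 1))] at hsd
    linarith
  · have := key (T.points (j + 1)) (T.points (j + 2)) (T.points j) (hpt _) (hpt _) (hpt _)
      hj.symm
      (by have := qf_edge_le_maxEdge 1 T (j + 1)
          rwa [edge, hj5, hj6, hqs] at this)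
      (by rw [edge, hj3, hj4, hqs]) hcross2
    simp only [secDiff, edgeMidpoint, hj3, hj4] at hsd
    rw [midpoint_comm (T.points j)] at hsd
    linarith

/-! ### A counting lemma for sequences -/

/-- The order of the quantifiers matters: `G` is chosen before `w₀` and `P`, so neither the initial
shape nor the exponent enters the final constant; only the threshold `Λ₀` depends on `w₀`. -/
theorem exists_sum_count_le {B C : ℝ} (hB : 0 ≤ B) (hC : 0 ≤ C) :
    ∃ G : ℝ, 0 ≤ G ∧ ∀ w₀ : ℝ, 0 ≤ w₀ → ∃ Λ₀ : ℝ, ∀ Λ : ℝ, Λ₀ ≤ Λ → ∀ P : ℝ, 0 ≤ P →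
      ∀ c w : ℕ → ℝ, (∀ k, 0 ≤ c k) → (∀ k, 0 ≤ w k) → (∀ k, c k ≤ 2 ^ k) → w 0 ≤ w₀ →
        (∀ k, c k ≤ B * Λ * (Λ / 2 ^ k) ^ P * w k) →
        (∀ k, w (k + 1) ≤ 19 / 20 * w k + C * (c k / 2 ^ k)) →
        ∀ n, ∑ k ∈ Finset.range n, c k ≤ G * Λ := by
  -- Once `2 ^ k ≥ K Λ`, the term `C c k / 2 ^ k` is at most `w k / 40`, so `w` contracts by `19/20
  -- + 1/40 = 39/40`.
  set K := 40 * (C * B) + 1 with hK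
  have hK1 : 1 ≤ K := by rw [hK]; nlinarith [mul_nonneg hC hB]
  set E := 1 + 20 * C with hE
  have hE0 : 0 ≤ E := by rw [hE]; linarith
  refine ⟨2 * K + 40 * (B * E), by positivity, fun w₀ hw₀ => ?_⟩
  obtain ⟨k', hk'⟩ : ∃ k' : ℕ, (19 / 20 : ℝ) ^ k' * w₀ ≤ 1 := by
    have : Tendsto (fun k : ℕ => (19 / 20 : ℝ) ^ k * w₀) atTop (nhds (0 * w₀)) :=
      (tendsto_pow_atTop_nhds_zero_of_lt_one (by norm_num) (by norm_num)).mul_const _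
    rw [zero_mul] at this
    exact (this.eventually_le_const one_pos).exists
  -- This makes the critical generation `k₁` at least `k'`, by which time the contribution of `w₀`
  -- has decayed below 1.
  refine ⟨2 ^ k' + 1, fun Λ hΛ P hP c w hc hw hc2 hw0 hcw hww n => ?_⟩
  have hp2 : (1 : ℝ) ≤ 2 ^ k' := one_le_pow₀ (by norm_num)
  have hΛ1 : 1 < Λ := by linarith
  have hex : ∃ k : ℕ, K * Λ ≤ 2 ^ k := pow_unbounded_of_one_lt _ one_lt_two |>.imp fun _ h => h.le
  classical
  set k₁ := Nat.find hex with hk₁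
  have hk₁' : K * Λ ≤ 2 ^ k₁ := Nat.find_spec hex
  have hKΛ : Λ ≤ K * Λ := le_mul_of_one_le_left (by linarith) hK1
  have hk₁0 : k₁ ≠ 0 := fun h0 => by
    rw [h0, pow_zero] at hk₁'; linarith
  have hk₁2 : (2 : ℝ) ^ k₁ ≤ 2 * K * Λ := by
    obtain ⟨l, hl⟩ := Nat.exists_eq_succ_of_ne_zero hk₁0
    have := Nat.find_min hex (m := l) (by omega)
    push Not at this
    rw [hl, pow_succ]; linarith
  have hkk : k' ≤ k₁ := by
    have : (2 : ℝ) ^ k' ≤ 2 ^ k₁ := by linarith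
    exact (pow_le_pow_iff_right₀ one_lt_two).mp this
  -- `20 C` is the fixed point of `x ↦ 19/20 x + C`.
  have hwk : ∀ k, w k ≤ (19 / 20 : ℝ) ^ k * w₀ + 20 * C := by
    intro k
    induction k with
    | zero => simpa using by linarith
    | succ k ih =>
      have h1 : C * (c k / 2 ^ k) ≤ C * 1 :=
        mul_le_mul_of_nonneg_left ((div_le_one (by positivity)).2 (hc2 k)) hC
      have := hww k
      rw [pow_succ]
      linarith
  have hw1 : w k₁ ≤ E := by
    have h1 := hwk k₁
    have h2 : (19 / 20 : ℝ) ^ k₁ * w₀ ≤ (19 / 20 : ℝ) ^ k' * w₀ :=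
      mul_le_mul_of_nonneg_right (pow_le_pow_of_le_one (by norm_num) (by norm_num) hkk) hw₀
    linarith
  have hBΛ : 0 ≤ B * Λ := mul_nonneg hB (by linarith)
  have hlate : ∀ k, k₁ ≤ k → c k ≤ B * Λ * w k ∧ w (k + 1) ≤ 39 / 40 * w k := by
    intro k hk
    have h2k : K * Λ ≤ 2 ^ k := hk₁'.trans (pow_le_pow_right₀ one_le_two hk)
    have hle1 : Λ / 2 ^ k ≤ 1 := (div_le_one (by positivity)).2 (hKΛ.trans h2k)
    have hP1 : (Λ / 2 ^ k) ^ P ≤ 1 := Real.rpow_le_one (by positivity) hle1 hP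
    have h1 : c k ≤ B * Λ * w k := by
      refine (hcw k).trans (mul_le_mul_of_nonneg_right ?_ (hw k))
      exact mul_le_of_le_one_right hBΛ hP1
    refine ⟨h1, ?_⟩
    have h3 : C * (c k / 2 ^ k) ≤ 1 / 40 * w k := by
      rw [mul_div_assoc', div_le_iff₀ (by positivity)]
      have h4 : C * c k ≤ C * (B * Λ * w k) := mul_le_mul_of_nonneg_left h1 hC
      have h5 : 40 * (C * B) * Λ ≤ 2 ^ k := by
        refine le_trans ?_ h2k
        exact mul_le_mul_of_nonneg_right (by rw [hK]; linarith) (by linarith)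
      have h6 := mul_le_mul_of_nonneg_right h5 (hw k)
      linarith
    have := hww k
    linarith
  have hgeo : ∀ j, w (k₁ + j) ≤ (39 / 40 : ℝ) ^ j * E := by
    intro j
    induction j with
    | zero => simpa using hw1
    | succ j ih =>
      have := (hlate (k₁ + j) (by omega)).2
      rw [pow_succ, ← add_assoc]
      linarith
  have hsum1 : ∑ k ∈ Finset.range k₁, c k ≤ 2 ^ k₁ := by
    refine (Finset.sum_le_sum fun k _ => hc2 k).trans ?_
    rw [geom_sum_eq (by norm_num)]
    norm_num
  have hsum2 : ∑ j ∈ Finset.range n, c (k₁ + j) ≤ 40 * (B * E) * Λ := by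
    calc ∑ j ∈ Finset.range n, c (k₁ + j) ≤
          ∑ j ∈ Finset.range n, (39 / 40 : ℝ) ^ j * (B * Λ * E) := by
          refine Finset.sum_le_sum fun j _ => ?_
          have h1 := (hlate (k₁ + j) (by omega)).1
          have h2 := mul_le_mul_of_nonneg_left (hgeo j) hBΛ
          linarith
      _ = (∑ j ∈ Finset.range n, (39 / 40 : ℝ) ^ j) * (B * Λ * E) := (Finset.sum_mul _ _ _).symm
      _ ≤ 40 * (B * Λ * E) := by
          refine mul_le_mul_of_nonneg_right ?_ (mul_nonneg hBΛ hE0)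
          rw [geom_sum_eq (by norm_num)]
          have : (0 : ℝ) ≤ (39 / 40) ^ n := by positivity
          rw [div_le_iff_of_neg (by norm_num)]
          linarith
      _ = 40 * (B * E) * Λ := by ring
  calc ∑ k ∈ Finset.range n, c k ≤ ∑ k ∈ Finset.range (k₁ + n), c k :=
        Finset.sum_le_sum_of_subset_of_nonneg
          (fun k hk => Finset.mem_range.2 ((Finset.mem_range.1 hk).trans_le (by omega)))
          fun k _ _ => hc k
    _ = ∑ k ∈ Finset.range k₁, c k + ∑ j ∈ Finset.range n, c (k₁ + j) := Finset.sum_range_add _ _ _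
    _ ≤ (2 * K + 40 * (B * E)) * Λ := by linarith

end

section

/-! ### Sequences of bisections -/

/-- The interiors of the triangles of `S` are pairwise disjoint. -/
def DisjointInteriors (S : Finset Triangle) : Prop :=
  (S : Set Triangle).PairwiseDisjoint fun T => interior T.closedInterior

open Classical in
/-- For `N ≥ N₀`, the triangulation `𝒯 (N + 1)` is obtained from `𝒯 N` by bisecting `τ N ∈ 𝒯 N` from
the midpoint of the edge opposite the vertex `ι N`. -/
structure IsBisectionSeq (N₀ : ℕ) (𝒯 : ℕ → Finset Triangle) (τ : ℕ → Triangle) (ι : ℕ → Fin 3) :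
    Prop where
  mem : ∀ N, N₀ ≤ N → τ N ∈ 𝒯 N
  step : ∀ N, N₀ ≤ N →
    𝒯 (N + 1) = (𝒯 N).erase (τ N) ∪ {childLeft (τ N) (ι N), childRight (τ N) (ι N)}

variable {N₀ N : ℕ} {𝒯 : ℕ → Finset Triangle} {τ : ℕ → Triangle} {ι : ℕ → Fin 3}

theorem IsBisectionSeq.mono (h : IsBisectionSeq N₀ 𝒯 τ ι) {N₁ : ℕ} (hN : N₀ ≤ N₁) :
    IsBisectionSeq N₁ 𝒯 τ ι :=
  ⟨fun n hn => h.mem n (hN.trans hn), fun n hn => h.step n (hN.trans hn)⟩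

theorem IsBisectionSeq.mem_succ (h : IsBisectionSeq N₀ 𝒯 τ ι) (hN : N₀ ≤ N) {T : Triangle}
    (hT : T ∈ 𝒯 (N + 1)) :
    T ∈ 𝒯 N ∨ T = childLeft (τ N) (ι N) ∨ T = childRight (τ N) (ι N) := by
  rw [h.step N hN] at hT
  simp only [Finset.mem_union, Finset.mem_erase, Finset.mem_insert, Finset.mem_singleton] at hT
  tauto

theorem IsBisectionSeq.exists_desc (h : IsBisectionSeq N₀ 𝒯 τ ι) (hN : N₀ ≤ N) :
    ∀ T ∈ 𝒯 N, ∃ R ∈ 𝒯 N₀, ∃ k, Desc R k T := by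
  induction N, hN using Nat.le_induction with
  | base => exact fun T hT => ⟨T, hT, 0, .refl⟩
  | succ N hN ih =>
    intro T hT
    rcases h.mem_succ hN hT with hT | rfl | rfl
    · exact ih T hT
    · obtain ⟨R, hR, k, hk⟩ := ih _ (h.mem N hN)
      exact ⟨R, hR, k + 1, .left _ hk⟩
    · obtain ⟨R, hR, k, hk⟩ := ih _ (h.mem N hN)
      exact ⟨R, hR, k + 1, .right _ hk⟩

/-- Disjoint interiors determine the ancestor, and the area ratio `2 ^ k` determines the generation.
-/
theorem Desc.unique {S : Finset Triangle} (hS : DisjointInteriors S) {R R' T : Triangle} {k k' : ℕ}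
    (hR : R ∈ S) (hR' : R' ∈ S) (h : Desc R k T) (h' : Desc R' k' T) : R = R' ∧ k = k' := by
  have hRR : R = R' := by
    by_contra hne
    obtain ⟨x, hx⟩ := interior_triangle_nonempty T
    exact Set.disjoint_left.mp (hS hR hR' hne) (interior_mono h.subset hx)
      (interior_mono h'.subset hx)
  subst hRR
  refine ⟨rfl, ?_⟩
  have h1 := h.area_eq
  rw [h'.area_eq, div_eq_div_iff (by positivity) (by positivity)] at h1
  have h2 := mul_left_cancel₀ (area_pos R).ne' h1
  exact Nat.pow_right_injective le_rfl (by exact_mod_cast h2)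

theorem IsBisectionSeq.desc_child (h : IsBisectionSeq N₀ 𝒯 τ ι) (hS : DisjointInteriors (𝒯 N₀))
    (hN : N₀ ≤ N) {T R : Triangle} (hT : T = childLeft (τ N) (ι N) ∨ T = childRight (τ N) (ι N))
    (hR : R ∈ 𝒯 N₀) {k : ℕ} (hk : Desc R k T) : ∃ j, k = j + 1 ∧ Desc R j (τ N) := by
  obtain ⟨R', hR', j, hj⟩ := h.exists_desc hN _ (h.mem N hN)
  have hc : Desc R' (j + 1) T := by
    rcases hT with rfl | rfl
    · exact .left _ hj
    · exact .right _ hj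
  obtain ⟨rfl, rfl⟩ := hk.unique hS hR hR' hc
  exact ⟨j, rfl, hj⟩

theorem interior_children_disjoint (T : Triangle) (i : Fin 3) :
    Disjoint (interior (childLeft T i).closedInterior) (interior (childRight T i).closedInterior) := by
  rw [Set.disjoint_iff_inter_eq_empty]
  refine (isOpen_interior.inter isOpen_interior).eq_empty_of_measure_zero (μ := volume) ?_
  exact measure_mono_null (Set.inter_subset_inter interior_subset interior_subset)
    (aedisjoint_children T i)

theorem IsBisectionSeq.disjoint (h : IsBisectionSeq N₀ 𝒯 τ ι) (hS : DisjointInteriors (𝒯 N₀))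
    (hN : N₀ ≤ N) : DisjointInteriors (𝒯 N) := by
  induction N, hN using Nat.le_induction with
  | base => exact hS
  | succ N hN ih =>
    have hτ := h.mem N hN
    have hL := interior_mono (childLeft_subset (τ N) (ι N))
    have hR := interior_mono (childRight_subset (τ N) (ι N))
    have hLR := interior_children_disjoint (τ N) (ι N)
    intro T hT T' hT' hne
    have hT := Finset.mem_coe.1 hT
    have hT' := Finset.mem_coe.1 hT'
    rw [h.step N hN] at hT hT'
    simp only [Finset.mem_union, Finset.mem_erase, Finset.mem_insert, Finset.mem_singleton]
      at hT hT'
    rcases hT with ⟨hT1, hT2⟩ | rfl | rfl <;> rcases hT' with ⟨hT1', hT2'⟩ | rfl | rfl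
    · exact ih hT2 hT2' hne
    · exact (ih hT2 hτ hT1).mono_right hL
    · exact (ih hT2 hτ hT1).mono_right hR
    · exact (ih hτ hT2' hT1'.symm).mono_left hL
    · exact absurd rfl hne
    · exact hLR
    · exact (ih hτ hT2' hT1'.symm).mono_left hR
    · exact hLR.symm
    · exact absurd rfl hne

theorem IsBisectionSeq.union_eq (h : IsBisectionSeq N₀ 𝒯 τ ι) (hN : N₀ ≤ N) :
    ⋃ T ∈ 𝒯 N, T.closedInterior = ⋃ T ∈ 𝒯 N₀, T.closedInterior := by
  induction N, hN using Nat.le_induction with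
  | base => rfl
  | succ N hN ih =>
    rw [← ih]
    have hu := childLeft_union_childRight (τ N) (ι N)
    have hτ := h.mem N hN
    ext x
    simp only [Set.mem_iUnion, exists_prop]
    constructor
    · rintro ⟨T, hT, hx⟩
      rcases h.mem_succ hN hT with hT | rfl | rfl
      · exact ⟨T, hT, hx⟩
      · exact ⟨_, hτ, childLeft_subset _ _ hx⟩
      · exact ⟨_, hτ, childRight_subset _ _ hx⟩
    · rintro ⟨T, hT, hx⟩
      rw [h.step N hN]
      by_cases hTτ : T = τ N
      · subst hTτ
        rw [← hu] at hx
        rcases hx with hx | hx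
        · exact ⟨_, by simp, hx⟩
        · exact ⟨_, by simp, hx⟩
      · exact ⟨T, by simp [hTτ, hT], hx⟩

theorem IsBisectionSeq.triangle_subset (h : IsBisectionSeq N₀ 𝒯 τ ι) {Ω : Set Plane}
    (hS : IsTriangulation (𝒯 N₀) Ω) (hN : N₀ ≤ N) {T : Triangle} (hT : T ∈ 𝒯 N) :
    T.closedInterior ⊆ closure Ω := by
  rw [← hS.union, ← h.union_eq hN]
  exact Set.subset_biUnion_of_mem (u := fun T : Triangle => T.closedInterior) hT

-- An inequality suffices, so possible coincidences among the children and the remaining triangles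
-- need no discussion.
open Classical in
theorem sum_bisect_le {u : Triangle → ℝ} (hu : ∀ T, 0 ≤ u T) {S : Finset Triangle} {T L R : Triangle}
    (hT : T ∈ S) : ∑ t ∈ S.erase T ∪ {L, R}, u t ≤ ∑ t ∈ S, u t - u T + u L + u R := by
  have h0 : ∀ s : Finset Triangle, 0 ≤ ∑ t ∈ s, u t := fun s => Finset.sum_nonneg fun t _ => hu t
  have h1 := Finset.sum_union_inter (s₁ := S.erase T) (s₂ := {L, R}) (f := u)
  have h2 := Finset.sum_union_inter (s₁ := {L}) (s₂ := {R}) (f := u)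
  rw [Finset.sum_singleton, Finset.sum_singleton] at h2
  have h3 := Finset.add_sum_erase S u hT
  have h4 := h0 (S.erase T ∩ {L, R})
  have h5 := h0 ({L} ∩ {R})
  rw [show ({L, R} : Finset Triangle) = {L} ∪ {R} from rfl] at *
  linarith

theorem IsBisectionSeq.card_le (h : IsBisectionSeq N₀ 𝒯 τ ι) (hN : N₀ ≤ N) :
    ((𝒯 N).card : ℝ) ≤ (𝒯 N₀).card + (N - N₀) := by
  induction N, hN using Nat.le_induction with
  | base => simp
  | succ N hN ih =>
    classical
    have := sum_bisect_le (u := fun _ => 1) (fun _ => zero_le_one) (h.mem N hN)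
      (L := childLeft (τ N) (ι N)) (R := childRight (τ N) (ι N))
    simp only [Finset.sum_const, nsmul_eq_mul, mul_one] at this
    rw [h.step N hN]
    push_cast
    convert! this.trans _ using 1
    linarith

/-! ### Counting bisections by generation -/

open Classical in
/-- The steps at which a triangle of generation `k` below `R` is bisected. -/
def splits (τ : ℕ → Triangle) (N₀ N : ℕ) (R : Triangle) (k : ℕ) : Finset ℕ :=
  (Finset.Ico N₀ N).filter fun n => Desc R k (τ n)

theorem mem_splits {R : Triangle} {k n : ℕ} :
    n ∈ splits τ N₀ N R k ↔ (N₀ ≤ n ∧ n < N) ∧ Desc R k (τ n) := by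
  simp [splits]

theorem splits_self (R : Triangle) (k : ℕ) : splits τ N₀ N₀ R k = ∅ := by simp [splits]

open Classical in
theorem sum_splits_succ (hN : N₀ ≤ N) (R : Triangle) (k : ℕ) (u : ℕ → ℝ) :
    ∑ n ∈ splits τ N₀ (N + 1) R k, u n =
      ∑ n ∈ splits τ N₀ N R k, u n + if Desc R k (τ N) then u N else 0 := by
  rw [splits, splits, Finset.sum_filter, Finset.sum_filter, Finset.sum_Ico_succ_top hN]

-- The weight of generation 0 still present plus that already bisected never exceeds `w R`:
-- bisections create no triangle of generation 0.
open Classical in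
theorem IsBisectionSeq.sum_splits_zero_le (h : IsBisectionSeq N₀ 𝒯 τ ι)
    (hS : DisjointInteriors (𝒯 N₀)) (hN : N₀ ≤ N) {R : Triangle} (hR : R ∈ 𝒯 N₀)
    {w : Triangle → ℝ} (hw : ∀ T, 0 ≤ w T) :
    ∑ n ∈ splits τ N₀ N R 0, w (τ n) ≤ w R := by
  suffices hs : ∑ T ∈ 𝒯 N, (if Desc R 0 T then w T else 0) +
      ∑ n ∈ splits τ N₀ N R 0, w (τ n) ≤ w R by
    have : 0 ≤ ∑ T ∈ 𝒯 N, (if Desc R 0 T then w T else 0) :=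
      Finset.sum_nonneg fun T _ => by split_ifs <;> simp [hw]
    linarith
  induction N, hN using Nat.le_induction with
  | base =>
    rw [splits_self, Finset.sum_empty, add_zero, ← Finset.sum_filter]
    calc _ ≤ ∑ T ∈ {R}, w T := Finset.sum_le_sum_of_subset_of_nonneg (fun T hT => by
          have := (Finset.mem_filter.1 hT).2
          cases this
          simp) fun T _ _ => hw T
      _ = w R := by simp
  | succ N hN ih =>
    have h1 := sum_bisect_le (u := fun T => if Desc R 0 T then w T else 0)
      (fun T => by split_ifs <;> simp [hw]) (h.mem N hN)
      (L := childLeft (τ N) (ι N)) (R := childRight (τ N) (ι N))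
    rw [sum_splits_succ hN, h.step N hN]
    have hL : ¬ Desc R 0 (childLeft (τ N) (ι N)) := fun hd => by
      obtain ⟨j, hj, -⟩ := h.desc_child hS hN (Or.inl rfl) hR hd
      omega
    have hRr : ¬ Desc R 0 (childRight (τ N) (ι N)) := fun hd => by
      obtain ⟨j, hj, -⟩ := h.desc_child hS hN (Or.inr rfl) hR hd
      omega
    simp only [hL, hRr, if_false] at h1
    linarith

-- A balance for generation `k + 1`: such a triangle is present only after being created by a
-- bisection in generation `k`, and bisecting it moves its weight from the first sum of the
-- invariant to the second.
open Classical in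
theorem IsBisectionSeq.sum_splits_succ_le (h : IsBisectionSeq N₀ 𝒯 τ ι)
    (hS : DisjointInteriors (𝒯 N₀)) (hN : N₀ ≤ N) {R : Triangle} (hR : R ∈ 𝒯 N₀)
    {w : Triangle → ℝ} (hw : ∀ T, 0 ≤ w T) (k : ℕ) :
    ∑ n ∈ splits τ N₀ N R (k + 1), w (τ n) ≤
      ∑ n ∈ splits τ N₀ N R k, (w (childLeft (τ n) (ι n)) + w (childRight (τ n) (ι n))) := by
  suffices hs : ∑ T ∈ 𝒯 N, (if Desc R (k + 1) T then w T else 0) +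
      ∑ n ∈ splits τ N₀ N R (k + 1), w (τ n) ≤ (∑ T ∈ 𝒯 N₀, if Desc R (k + 1) T then w T else 0) +
      ∑ n ∈ splits τ N₀ N R k, (w (childLeft (τ n) (ι n)) + w (childRight (τ n) (ι n))) by
    have h1 : 0 ≤ ∑ T ∈ 𝒯 N, (if Desc R (k + 1) T then w T else 0) :=
      Finset.sum_nonneg fun T _ => by split_ifs <;> simp [hw]
    have h2 : (∑ T ∈ 𝒯 N₀, if Desc R (k + 1) T then w T else 0) = 0 :=
      Finset.sum_eq_zero fun T hT => if_neg fun hd => by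
        have := (hd.unique hS hR hT .refl).2
        omega
    linarith
  induction N, hN using Nat.le_induction with
  | base => rw [splits_self, splits_self]; simp
  | succ N hN ih =>
    have h1 := sum_bisect_le (u := fun T => if Desc R (k + 1) T then w T else 0)
      (fun T => by split_ifs <;> simp [hw]) (h.mem N hN)
      (L := childLeft (τ N) (ι N)) (R := childRight (τ N) (ι N))
    rw [sum_splits_succ hN, sum_splits_succ hN, h.step N hN]
    have hiff : ∀ T, T = childLeft (τ N) (ι N) ∨ T = childRight (τ N) (ι N) →
        (if Desc R (k + 1) T then w T else 0) ≤ if Desc R k (τ N) then w T else 0 := by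
      intro T hT
      by_cases hd : Desc R (k + 1) T
      · obtain ⟨j, hj, hj'⟩ := h.desc_child hS hN hT hR hd
        obtain rfl : k = j := by omega
        rw [if_pos hd, if_pos hj']
      · rw [if_neg hd]; split_ifs <;> simp [hw]
    have h2 := hiff _ (Or.inl rfl)
    have h3 := hiff _ (Or.inr rfl)
    have h4 : (if Desc R k (τ N) then w (childLeft (τ N) (ι N)) + w (childRight (τ N) (ι N)) else 0) =
        (if Desc R k (τ N) then w (childLeft (τ N) (ι N)) else 0) +
        if Desc R k (τ N) then w (childRight (τ N) (ι N)) else 0 := by split_ifs <;> simp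
    linarith

theorem IsBisectionSeq.card_splits_le (h : IsBisectionSeq N₀ 𝒯 τ ι)
    (hS : DisjointInteriors (𝒯 N₀)) (hN : N₀ ≤ N) {R : Triangle} (hR : R ∈ 𝒯 N₀) (k : ℕ) :
    ((splits τ N₀ N R k).card : ℝ) ≤ 2 ^ k := by
  induction k with
  | zero =>
    simpa using h.sum_splits_zero_le hS hN hR (w := fun _ => 1) fun _ => zero_le_one
  | succ k ih =>
    have := h.sum_splits_succ_le hS hN hR (w := fun _ => 1) (fun _ => zero_le_one) k
    simp only [Finset.sum_const, nsmul_eq_mul, mul_one] at this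
    rw [pow_succ]
    linarith

/-- Every step bisects a descendant of some triangle of the initial triangulation. -/
theorem IsBisectionSeq.exists_sub_le (h : IsBisectionSeq N₀ 𝒯 τ ι) (hN : N₀ ≤ N) :
    ∃ K : ℕ, (N : ℝ) - N₀ ≤
      ∑ R ∈ 𝒯 N₀, ∑ k ∈ Finset.range K, ((splits τ N₀ N R k).card : ℝ) := by
  classical
  have hex : ∀ n, ∃ R k, N₀ ≤ n → R ∈ 𝒯 N₀ ∧ Desc R k (τ n) := fun n => by
    by_cases hn : N₀ ≤ n
    · obtain ⟨R, hR, k, hk⟩ := h.exists_desc hn _ (h.mem n hn)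
      exact ⟨R, k, fun _ => ⟨hR, hk⟩⟩
    · exact ⟨τ n, 0, fun h => absurd h hn⟩
  choose ρ κ hρ using hex
  refine ⟨(Finset.Ico N₀ N).sup κ + 1, ?_⟩
  set K := (Finset.Ico N₀ N).sup κ + 1 with hK
  have hsub : Finset.Ico N₀ N ⊆
      (𝒯 N₀ ×ˢ Finset.range K).biUnion fun q => splits τ N₀ N q.1 q.2 := by
    intro n hn
    have hn' := Finset.mem_Ico.1 hn
    refine Finset.mem_biUnion.2 ⟨(ρ n, κ n), ?_, mem_splits.2 ⟨hn', (hρ n hn'.1).2⟩⟩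
    refine Finset.mem_product.2 ⟨(hρ n hn'.1).1, Finset.mem_range.2 ?_⟩
    exact Nat.lt_succ_of_le (Finset.le_sup hn)
  have hcard := (Finset.card_le_card hsub).trans Finset.card_biUnion_le
  rw [Nat.card_Ico, Finset.sum_product] at hcard
  rw [← Nat.cast_sub hN]
  exact_mod_cast hcard

/-- Fewer than `2 ^ K` bisections below each initial triangle concern generations less than `K`, so
enough steps force a later generation. -/
theorem IsBisectionSeq.exists_generation_ge (h : IsBisectionSeq N₀ 𝒯 τ ι)
    (hS : DisjointInteriors (𝒯 N₀)) (K : ℕ) :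
    ∃ n, N₀ ≤ n ∧ ∀ R ∈ 𝒯 N₀, ∀ k, Desc R k (τ n) → K ≤ k := by
  by_contra hcon
  push Not at hcon
  set N := N₀ + (𝒯 N₀).card * 2 ^ K + 1 with hN
  have hNN : N₀ ≤ N := by omega
  classical
  have hsub : Finset.Ico N₀ N ⊆
      (𝒯 N₀ ×ˢ Finset.range K).biUnion fun q => splits τ N₀ N q.1 q.2 := by
    intro n hn
    have hn' := Finset.mem_Ico.1 hn
    obtain ⟨R, hR, k, hk, hkK⟩ := hcon n hn'.1
    exact Finset.mem_biUnion.2 ⟨(R, k), Finset.mem_product.2 ⟨hR, Finset.mem_range.2 hkK⟩,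
      mem_splits.2 ⟨hn', hk⟩⟩
  have hcard := (Finset.card_le_card hsub).trans Finset.card_biUnion_le
  rw [Nat.card_Ico, Finset.sum_product] at hcard
  have h2 : ∀ R ∈ 𝒯 N₀, ∑ k ∈ Finset.range K, (splits τ N₀ N R k).card ≤ 2 ^ K := by
    intro R hR
    calc ∑ k ∈ Finset.range K, (splits τ N₀ N R k).card ≤ ∑ k ∈ Finset.range K, 2 ^ k :=
          Finset.sum_le_sum fun k _ => by exact_mod_cast h.card_splits_le hS hNN hR k
      _ ≤ 2 ^ K := (Nat.geomSum_lt le_rfl fun k hk => Finset.mem_range.1 hk).le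
  have h3 := hcard.trans (Finset.sum_le_sum h2)
  rw [Finset.sum_const, smul_eq_mul] at h3
  omega

end

section

/-! ### Asymptotics of the greedy algorithm -/

/-- A run of the greedy algorithm together with the choices it makes. -/
structure GreedySeq (A : Triangle → (Plane → ℝ) → (Plane →ᵃ[ℝ] ℝ)) (p : ℝ≥0∞) (f : Plane → ℝ)
    (N₀ : ℕ) (𝒯 : ℕ → Finset Triangle) (τ : ℕ → Triangle) (ι : ℕ → Fin 3) : Prop where
  seq : IsBisectionSeq N₀ 𝒯 τ ι
  localError_le : ∀ N, N₀ ≤ N → ∀ T ∈ 𝒯 N, localError A p f T ≤ localError A p f (τ N)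
  decision_le : ∀ N, N₀ ≤ N → ∀ j, decision f (τ N) (ι N) ≤ decision f (τ N) j

variable {A : Triangle → (Plane → ℝ) → (Plane →ᵃ[ℝ] ℝ)} {p : ℝ≥0∞} {f : Plane → ℝ} {m : ℝ}
  {Ω : Set Plane} {S₀ : Finset Triangle}
  {N₀ N : ℕ} {𝒯 : ℕ → Finset Triangle} {τ : ℕ → Triangle} {ι : ℕ → Fin 3}

theorem IsGreedyRun.exists_greedySeq (h : IsGreedyRun A p f S₀ 𝒯) :
    ∃ τ ι, GreedySeq A p f S₀.card 𝒯 τ ι := by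
  classical
  have hex : ∀ N, ∃ T i, S₀.card ≤ N → T ∈ 𝒯 N ∧
      (∀ T' ∈ 𝒯 N, localError A p f T' ≤ localError A p f T) ∧
      (∀ j : Fin 3, decision f T i ≤ decision f T j) ∧
      𝒯 (N + 1) = (𝒯 N).erase T ∪ {childLeft T i, childRight T i} := by
    intro N
    by_cases hN : S₀.card ≤ N
    · obtain ⟨T, hT, hmax, i, hi, hS⟩ := h.step N hN
      exact ⟨T, i, fun _ => ⟨hT, hmax, hi, by convert! hS⟩⟩
    · obtain ⟨T⟩ := exists_triangle
      exact ⟨T, 0, fun hN' => absurd hN' hN⟩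
  choose τ ι hτ using hex
  exact ⟨τ, ι, ⟨⟨fun N hN => (hτ N hN).1, fun N hN => by convert! (hτ N hN).2.2.2⟩,
    fun N hN => (hτ N hN).2.1, fun N hN => (hτ N hN).2.2.1⟩⟩

theorem GreedySeq.mono (h : GreedySeq A p f N₀ 𝒯 τ ι) {N₁ : ℕ} (hN : N₀ ≤ N₁) :
    GreedySeq A p f N₁ 𝒯 τ ι :=
  ⟨h.seq.mono hN, fun n hn => h.localError_le n (hN.trans hn),
    fun n hn => h.decision_le n (hN.trans hn)⟩

theorem IsTriangulation.isCompact_closure (hS : IsTriangulation S₀ Ω) : IsCompact (closure Ω) := by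
  rw [← hS.union]
  exact S₀.isCompact_biUnion fun T _ => T.isCompact_closedInterior

theorem area_le (hS : IsTriangulation S₀ Ω) {T : Triangle} (hT : T.closedInterior ⊆ closure Ω) :
    area T ≤ (volume (closure Ω)).toReal :=
  ENNReal.toReal_mono hS.isCompact_closure.measure_lt_top.ne (measure_mono hT)

theorem inv_toReal_mem {p : ℝ≥0∞} (hp : 1 ≤ p) : 0 ≤ p.toReal⁻¹ ∧ p.toReal⁻¹ ≤ 1 := by
  refine ⟨by positivity, ?_⟩
  rcases eq_or_ne p ⊤ with rfl | hpt
  · simp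
  · exact inv_le_one_of_one_le₀ (by simpa using ENNReal.toReal_mono hpt hp)

/-- After `k₀` generations areas are below the threshold of `exists_flat`. From then on each
bisection of a still long triangle reduces the euclidean shape of either child by 9/10, and small
diameters are inherited. -/
theorem GreedySeq.exists_generation_small (h : GreedySeq A p f N₀ 𝒯 τ ι)
    (hf : StronglyConvexC2 Ω f m) (hS : IsTriangulation (𝒯 N₀) Ω) {L : ℝ} (hL : 0 < L)
    {R : Triangle} (hR : R ∈ 𝒯 N₀) :
    ∃ K, ∀ N, N₀ ≤ N → ∀ T ∈ 𝒯 N, ∀ k, Desc R k T → K ≤ k → maxEdge 1 T < L := by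
  have hRΩ := h.seq.triangle_subset hS le_rfl hR
  obtain ⟨α, hα, hflat⟩ := hf.exists_flat hRΩ hL
  obtain ⟨k₀, hk₀⟩ : ∃ k₀ : ℕ, area R / 2 ^ k₀ ≤ α := by
    obtain ⟨k₀, hk₀⟩ := pow_unbounded_of_one_lt (area R / α) one_lt_two
    refine ⟨k₀, ?_⟩
    rw [div_lt_iff₀ hα] at hk₀
    rw [div_le_iff₀ (by positivity)]
    linarith
  set F := 5 / 2 * maxEdge 1 R with hF
  have hF0 : 0 ≤ F := mul_nonneg (by norm_num) (maxEdge_nonneg qf_one_nonneg R)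
  have hinv : ∀ N, N₀ ≤ N → ∀ T ∈ 𝒯 N, ∀ k, Desc R k T →
      k ≤ k₀ ∨ maxEdge 1 T < L ∨ triShape 1 T ≤ F * (9 / 10) ^ (k - k₀) := by
    intro N hN
    induction N, hN using Nat.le_induction with
    | base =>
      intro T hT k hk
      left
      have := (hk.unique hS.disjoint hR hT .refl).2
      omega
    | succ N hN ih =>
      intro T hT k hk
      rcases h.seq.mem_succ hN hT with hT | hT
      · exact ih T hT k hk
      · obtain ⟨j, rfl, hj⟩ := h.seq.desc_child hS.disjoint hN hT hR hk
        rcases Nat.lt_or_ge j k₀ with hjk | hjk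
        · left; omega
        right
        by_cases hsmall : maxEdge 1 (τ N) < L
        · left
          refine lt_of_le_of_lt ?_ hsmall
          rcases hT with rfl | rfl
          · exact maxEdge_childLeft_le qf_one_nonneg _ _
          · exact maxEdge_childRight_le qf_one_nonneg _ _
        · right
          have h1 : triShape 1 (τ N) ≤ F * (9 / 10) ^ (j - k₀) := by
            rcases ih (τ N) (h.seq.mem N hN) j hj with h1 | h1 | h1
            · rw [Nat.sub_eq_zero_of_le h1, pow_zero, mul_one]
              exact (triShape_le_maxEdge 1 _).trans
                (mul_le_mul_of_nonneg_left (hj.maxEdge_le qf_one_nonneg) (by norm_num))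
            · exact absurd h1 hsmall
            · exact h1
          have hα' : area (τ N) ≤ α := by
            rw [hj.area_eq]
            refine le_trans ?_ hk₀
            exact div_le_div_of_nonneg_left (area_pos R).le (by positivity)
              (pow_le_pow_right₀ one_le_two hjk)
          have h2 := triShape_child_le qf_one_nonneg (τ N) (ι N)
            (hflat _ hj.subset hα' (not_lt.1 hsmall) _ (h.decision_le N hN))
          have h3 : triShape 1 T ≤ 9 / 10 * triShape 1 (τ N) := by
            rcases hT with rfl | rfl
            · exact h2.1
            · exact h2.2
          rw [Nat.succ_sub hjk, pow_succ]
          linarith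
  obtain ⟨n, hn⟩ : ∃ n : ℕ, F * (9 / 10) ^ n < L / 2 := by
    have : Tendsto (fun n : ℕ => F * (9 / 10 : ℝ) ^ n) atTop (nhds (F * 0)) :=
      (tendsto_pow_atTop_nhds_zero_of_lt_one (by norm_num) (by norm_num)).const_mul _
    rw [mul_zero] at this
    exact (this.eventually_lt_const (half_pos hL)).exists
  refine ⟨k₀ + n + 1, fun N hN T hT k hk hkK => ?_⟩
  rcases hinv N hN T hT k hk with h1 | h1 | h1
  · omega
  · exact h1
  · have h2 := half_maxEdge_le_triShape qf_one_nonneg T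
    have h3 : F * (9 / 10 : ℝ) ^ (k - k₀) ≤ F * (9 / 10) ^ n :=
      mul_le_mul_of_nonneg_left
        (pow_le_pow_of_le_one (by norm_num) (by norm_num) (by omega)) hF0
    linarith

theorem exists_uniform_generation {S : Finset Triangle} {Q : Triangle → ℕ → Prop}
    (hmono : ∀ R k l, k ≤ l → Q R k → Q R l) (h : ∀ R ∈ S, ∃ K, Q R K) : ∃ K, ∀ R ∈ S, Q R K := by
  choose! K hK using h
  exact ⟨S.sup K, fun R hR => hmono R _ _ (Finset.le_sup hR) (hK R hR)⟩

theorem GreedySeq.exists_generation_small' (h : GreedySeq A p f N₀ 𝒯 τ ι)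
    (hf : StronglyConvexC2 Ω f m) (hS : IsTriangulation (𝒯 N₀) Ω) {L : ℝ} (hL : 0 < L) :
    ∃ K, ∀ R ∈ 𝒯 N₀, ∀ N, N₀ ≤ N → ∀ T ∈ 𝒯 N, ∀ k, Desc R k T → K ≤ k → maxEdge 1 T < L :=
  exists_uniform_generation
    (Q := fun R K => ∀ N, N₀ ≤ N → ∀ T ∈ 𝒯 N, ∀ k, Desc R k T → K ≤ k → maxEdge 1 T < L)
    (fun _ _ _ hkl hQ N hN T hT k hk hlk => hQ N hN T hT k hk (hkl.trans hlk))
    fun _ hR => h.exists_generation_small hf hS hL hR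

theorem rpow_le_one_add {x P : ℝ} (hx : 0 ≤ x) (hP0 : 0 ≤ P) (hP1 : P ≤ 1) : x ^ P ≤ 1 + x := by
  rcases le_total x 1 with h | h
  · linarith [Real.rpow_le_one hx h hP0]
  · have := Real.rpow_le_rpow_of_exponent_le h hP1
    rw [Real.rpow_one] at this
    linarith

/-- Uniform continuity on the compact `closure Ω` suffices: `f` is compared with a constant. -/
theorem exists_localError_le (hA : IsApproxOperator A) (hp : 1 ≤ p) (hf : StronglyConvexC2 Ω f m)
    (hS : IsTriangulation S₀ Ω) {ε : ℝ} (hε : 0 < ε) :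
    ∃ L > 0, ∀ T : Triangle, T.closedInterior ⊆ closure Ω → maxEdge 1 T < L →
      localError A p f T ≤ ENNReal.ofReal ε := by
  obtain ⟨K, hK0, hK⟩ := hA.exists_uniform_bound
  obtain ⟨hP0, hP1⟩ := inv_toReal_mem hp
  set V := (volume (closure Ω)).toReal with hV
  have hV0 : 0 ≤ V := ENNReal.toReal_nonneg
  have huc := hS.isCompact_closure.uniformContinuousOn_of_continuous hf.contDiffOn.continuousOn
  rw [Metric.uniformContinuousOn_iff] at huc
  obtain ⟨δ, hδ, hu⟩ := huc (ε / ((1 + K) * (1 + V))) (by positivity)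
  refine ⟨δ ^ 2, by positivity, fun T hT hTδ => ?_⟩
  have hsup : ∀ x ∈ T.closedInterior,
      |f x - AffineMap.const ℝ Plane (f (T.points 0)) x| ≤ ε / ((1 + K) * (1 + V)) := by
    intro x hx
    have h0 := T.point_mem_closedInterior 0
    have hd : dist x (T.points 0) < δ :=
      lt_of_pow_lt_pow_left₀ 2 hδ.le ((dist_sq_le_maxEdge hx h0).trans_lt hTδ)
    exact (hu x (hT hx) _ (hT h0) hd).le
  have h1 := localError_le_of_abs_sub_le (p := p)
    (hA.abs_sub_le hK (hf.continuousOn hT) _ hsup)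
  refine h1.trans (ENNReal.ofReal_le_ofReal ?_)
  have h2 : area T ^ p.toReal⁻¹ ≤ 1 + V :=
    (rpow_le_one_add (area_pos T).le hP0 hP1).trans (by linarith [area_le hS hT])
  calc (1 + K) * (ε / ((1 + K) * (1 + V))) * area T ^ p.toReal⁻¹
      ≤ (1 + K) * (ε / ((1 + K) * (1 + V))) * (1 + V) :=
        mul_le_mul_of_nonneg_left h2 (by positivity)
    _ = ε := by field_simp

theorem abs_cross_le_maxEdge (T : Triangle) : |cross (edge T 0) (edge T 1)| ≤ maxEdge 1 T := by
  have h := gram_edge (H := 1) (by simp) T 0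
  rw [Matrix.det_one, one_mul] at h
  have h0 := qf_edge_le_maxEdge 1 T 0
  have h1 := qf_edge_le_maxEdge 1 T (0 + 1)
  have n0 := qf_one_nonneg (edge T 0)
  have n1 := qf_one_nonneg (edge T (0 + 1))
  refine abs_le_of_sq_le_sq ?_ (maxEdge_nonneg qf_one_nonneg T)
  nlinarith [mul_le_mul h0 h1 n1 (n0.trans h0), sq_nonneg
    ((qf 1 (edge T 0) + qf 1 (edge T (0 + 1)) - qf 1 (edge T (0 + 2))) / 2)]

theorem exists_le_localError (hp : 1 ≤ p) (hf : StronglyConvexC2 Ω f m) {a : ℝ} (ha : 0 < a) :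
    ∃ ε > 0, ∀ T : Triangle, T.closedInterior ⊆ closure Ω → a ≤ area T →
      ENNReal.ofReal ε ≤ localError A p f T := by
  obtain ⟨ω, hω, hωa⟩ := exists_area_eq
  obtain ⟨hP0, hP1⟩ := inv_toReal_mem hp
  have hm := hf.pos
  -- As `1 / p` lies in `[0, 1]`, `b` is a lower bound for `area T ^ (1 / p)`.
  set b := min 1 a with hb
  have hb0 : 0 < b := lt_min one_pos ha
  refine ⟨m / 2 * (a / ω) / 128 * b, by positivity, fun T hT haT => ?_⟩
  refine le_trans (ENNReal.ofReal_le_ofReal ?_) (le_localError hp (hf.continuousOn hT)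
    (hf.convexOn hT))
  have h1 : a / ω ≤ maxEdge 1 T := by
    refine le_trans ?_ (abs_cross_le_maxEdge T)
    rw [div_le_iff₀ hω, mul_comm, ← hωa]
    exact haT
  have h2 : b ≤ area T ^ p.toReal⁻¹ := by
    calc b = b ^ (1 : ℝ) := (Real.rpow_one b).symm
      _ ≤ b ^ p.toReal⁻¹ := Real.rpow_le_rpow_of_exponent_ge hb0 (min_le_left _ _) hP1
      _ ≤ area T ^ p.toReal⁻¹ :=
        Real.rpow_le_rpow hb0.le ((min_le_right _ _).trans haT) hP0
  have h3 : 0 ≤ maxEdge 1 T := maxEdge_nonneg qf_one_nonneg T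
  gcongr

/-- When a triangle of very high generation is selected, its error is small and maximal, so all
errors are small. Triangles of generation below `K` have area, hence error, bounded below and must
be gone by then. -/
theorem GreedySeq.exists_generation_ge (h : GreedySeq A p f N₀ 𝒯 τ ι) (hA : IsApproxOperator A)
    (hp : 1 ≤ p) (hf : StronglyConvexC2 Ω f m) (hS : IsTriangulation (𝒯 N₀) Ω) (K : ℕ) :
    ∃ N₁, N₀ ≤ N₁ ∧ ∀ N, N₁ ≤ N → ∀ T ∈ 𝒯 N, ∀ R ∈ 𝒯 N₀, ∀ k, Desc R k T → K ≤ k := by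
  obtain ⟨a, ha, haR⟩ : ∃ a > 0, ∀ R ∈ 𝒯 N₀, a ≤ area R := by
    have hne : (𝒯 N₀).Nonempty := ⟨_, h.seq.mem N₀ le_rfl⟩
    obtain ⟨R, -, hR'⟩ := Finset.exists_min_image (𝒯 N₀) area hne
    exact ⟨area R, area_pos R, hR'⟩
  obtain ⟨ε, hε, hlow⟩ := exists_le_localError (A := A) hp hf (a := a / 2 ^ K) (by positivity)
  obtain ⟨L, hL, hup⟩ := exists_localError_le hA hp hf hS (half_pos hε)
  obtain ⟨K', hK'⟩ := h.exists_generation_small' hf hS hL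
  obtain ⟨n, hn, hgen⟩ := h.seq.exists_generation_ge hS.disjoint K'
  have hτn := h.seq.mem n hn
  have hsmall : localError A p f (τ n) ≤ ENNReal.ofReal (ε / 2) := by
    refine hup _ (h.seq.triangle_subset hS hn hτn) ?_
    obtain ⟨R, hR, k, hk⟩ := h.seq.exists_desc hn _ hτn
    exact hK' R hR n hn _ hτn k hk (hgen R hR k hk)
  have hstage : ∀ T ∈ 𝒯 n, ∀ R ∈ 𝒯 N₀, ∀ k, Desc R k T → K ≤ k := by
    intro T hT R hR k hk
    by_contra hkK
    push Not at hkK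
    have hareaT : a / 2 ^ K ≤ area T := by
      rw [hk.area_eq]
      exact div_le_div₀ (area_pos R).le (haR R hR) (by positivity)
        (pow_le_pow_right₀ one_le_two hkK.le)
    have h1 := (hlow T (h.seq.triangle_subset hS hn hT) hareaT).trans
      ((h.localError_le n hn T hT).trans hsmall)
    rw [ENNReal.ofReal_le_ofReal_iff (by linarith)] at h1
    linarith
  refine ⟨n, hn, fun N hN T hT R hR k hk => ?_⟩
  obtain ⟨T', hT', l, hl⟩ := (h.seq.mono hn).exists_desc hN T hT
  obtain ⟨R', hR', j, hj⟩ := h.seq.exists_desc hn T' hT'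
  have := (hk.unique hS.disjoint hR hR' (hj.trans hl)).2
  have := hstage T' hT' R' hR' j hj
  omega

theorem GreedySeq.exists_maxEdge_lt (h : GreedySeq A p f N₀ 𝒯 τ ι) (hA : IsApproxOperator A)
    (hp : 1 ≤ p) (hf : StronglyConvexC2 Ω f m) (hS : IsTriangulation (𝒯 N₀) Ω) {L : ℝ}
    (hL : 0 < L) : ∃ N₁, N₀ ≤ N₁ ∧ ∀ N, N₁ ≤ N → ∀ T ∈ 𝒯 N, maxEdge 1 T < L := by
  obtain ⟨K, hK⟩ := h.exists_generation_small' hf hS hL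
  obtain ⟨N₁, hN₁, hgen⟩ := h.exists_generation_ge hA hp hf hS K
  refine ⟨N₁, hN₁, fun N hN T hT => ?_⟩
  obtain ⟨R, hR, k, hk⟩ := h.seq.exists_desc (hN₁.trans hN) T hT
  exact hK R hR N (hN₁.trans hN) T hT k hk (hgen N hN T hT R hR k hk)

end

section

/-! ### Counting the bisections below a triangle -/

variable {A : Triangle → (Plane → ℝ) → (Plane →ᵃ[ℝ] ℝ)} {p : ℝ≥0∞} {f : Plane → ℝ} {m : ℝ}
  {Ω : Set Plane} {S₀ : Finset Triangle}
  {N₀ N : ℕ} {𝒯 : ℕ → Finset Triangle} {τ : ℕ → Triangle} {ι : ℕ → Fin 3}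

theorem NearQuadratic.desc {H : Matrix (Fin 2) (Fin 2) ℝ} {R T : Triangle} {k : ℕ}
    (h : NearQuadratic f H R.closedInterior) (hT : Desc R k T) :
    NearQuadratic f H T.closedInterior :=
  h.mono hT.subset (convex_triangle T)

theorem NearQuadratic.toReal_localError (hA : IsApproxOperator A) {K : ℝ} (hK0 : 0 ≤ K)
    (hK : UniformBound A K) {H : Matrix (Fin 2) (Fin 2) ℝ}
    {T : Triangle} (h : NearQuadratic f H T.closedInterior) (hf : ContinuousOn f T.closedInterior)
    (hp : 1 ≤ p) :
    localError A p f T ≠ ⊤ ∧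
      maxEdge H T * area T ^ p.toReal⁻¹ ≤ 300 * (localError A p f T).toReal ∧
      (localError A p f T).toReal ≤ (1 + K) * (maxEdge H T * area T ^ p.toReal⁻¹) := by
  have h1 := h.localError_le hA hK hf p
  have h2 := h.le_localError (A := A) hf hp
  have hM := maxEdge_nonneg h.nonneg T
  have ha := Real.rpow_nonneg (area_pos T).le p.toReal⁻¹
  have htop := ne_top_of_le_ne_top ENNReal.ofReal_ne_top h1
  refine ⟨htop, ?_, ?_⟩
  · have := ENNReal.toReal_mono htop h2
    rw [ENNReal.toReal_ofReal (by positivity)] at this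
    linarith
  · have := ENNReal.toReal_mono ENNReal.ofReal_ne_top h1
    rw [ENNReal.toReal_ofReal (by positivity)] at this
    linarith

/-- The maximal local error at stage `N` is bounded in terms of the shape of any triangle which
was bisected earlier. -/
theorem GreedySeq.toReal_localError_le (h : GreedySeq A p f N₀ 𝒯 τ ι) (hA : IsApproxOperator A)
    {K : ℝ} (hK0 : 0 ≤ K)
    (hK : UniformBound A K) (hp : 1 ≤ p)
    (hf : ∀ R ∈ 𝒯 N₀, ContinuousOn f R.closedInterior) {H : Triangle → Matrix (Fin 2) (Fin 2) ℝ}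
    (hH : ∀ R ∈ 𝒯 N₀, NearQuadratic f (H R) R.closedInterior) {n N : ℕ} (hn : N₀ ≤ n) (hnN : n ≤ N)
    {R : Triangle} (hR : R ∈ 𝒯 N₀) {k : ℕ} (hk : Desc R k (τ n)) :
    (localError A p f (τ N)).toReal ≤
      600 * (1 + K) ^ 2 * triShape (H R) (τ n) * (area R / 2 ^ k) ^ p.toReal⁻¹ := by
  obtain ⟨hP0, -⟩ := inv_toReal_mem hp
  -- `T` is the ancestor at stage `n` of the triangle selected at stage `N`. It may lie below
  -- another `R'`, with its own matrix; only local errors are compared across the two.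
  obtain ⟨T, hT, l, hl⟩ := (h.seq.mono hn).exists_desc hnN _ (h.seq.mem N (hn.trans hnN))
  obtain ⟨R', hR', j, hj⟩ := h.seq.exists_desc hn T hT
  have q1 := (hH R' hR').desc (hj.trans hl)
  have q2 := (hH R' hR').desc hj
  have q3 := (hH R hR).desc hk
  obtain ⟨-, -, u1⟩ := q1.toReal_localError hA hK0 hK ((hf R' hR').mono (hj.trans hl).subset) hp
  obtain ⟨-, u2, -⟩ := q2.toReal_localError hA hK0 hK ((hf R' hR').mono hj.subset) hp
  obtain ⟨htop, -, u3⟩ := q3.toReal_localError hA hK0 hK ((hf R hR).mono hk.subset) hp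
  have u4 := ENNReal.toReal_mono htop (h.localError_le n hn T hT)
  have hτ : maxEdge (H R') (τ N) * area (τ N) ^ p.toReal⁻¹ ≤
      maxEdge (H R') T * area T ^ p.toReal⁻¹ := by
    refine mul_le_mul (hl.maxEdge_le q1.nonneg) (Real.rpow_le_rpow (area_pos _).le ?_ hP0)
      (Real.rpow_nonneg (area_pos _).le _) (maxEdge_nonneg q1.nonneg T)
    rw [hl.area_eq]
    exact div_le_self (area_pos T).le (one_le_pow₀ one_le_two)
  have hs := half_maxEdge_le_triShape q3.nonneg (τ n)
  rw [← hk.area_eq]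
  have ha := Real.rpow_nonneg (area_pos (τ n)).le p.toReal⁻¹
  have h1K : 0 ≤ 1 + K := by linarith
  calc (localError A p f (τ N)).toReal
      ≤ (1 + K) * (300 * (localError A p f (τ n)).toReal) :=
        u1.trans (mul_le_mul_of_nonneg_left (hτ.trans (u2.trans (by linarith))) h1K)
    _ ≤ (1 + K) * (300 * ((1 + K) * (2 * triShape (H R) (τ n) * area (τ n) ^ p.toReal⁻¹))) := by
        have := mul_le_mul_of_nonneg_right (show maxEdge (H R) (τ n) ≤ 2 * triShape (H R) (τ n) by
          linarith) ha
        have := u3.trans (mul_le_mul_of_nonneg_left this h1K)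
        exact mul_le_mul_of_nonneg_left (by linarith) h1K
    _ = _ := by ring

/-- The choice of `Λ` is the solution of `Λ^(1 + P) = v^(1 + P) D / η`, which removes `η` from the
bound on the counts. -/
theorem rpow_scale {v D η P : ℝ} (hv : 0 < v) (hD : 0 < D) (hη : 0 < η) (hP : 0 ≤ P) :
    (v * (D / η) ^ (1 / (1 + P))) * (v * (D / η) ^ (1 / (1 + P))) ^ P = v * v ^ P * (D / η) := by
  have h1 : 0 < v * (D / η) ^ (1 / (1 + P)) := by positivity
  nth_rewrite 1 [← Real.rpow_one (v * (D / η) ^ (1 / (1 + P)))]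
  rw [← Real.rpow_add h1, Real.mul_rpow hv.le (by positivity), ← Real.rpow_mul (by positivity),
    one_div_mul_cancel (by positivity), Real.rpow_one, Real.rpow_add hv, Real.rpow_one]

/-- The number of bisections below a small triangle `R` is asymptotically at most a constant times
`|R| (√det H / η)^τ`, where `η` is the current maximal local error. -/
theorem GreedySeq.eventually_sum_splits_le (h : GreedySeq A p f N₀ 𝒯 τ ι)
    (hA : IsApproxOperator A) {K : ℝ} (hK0 : 0 ≤ K)
    (hK : UniformBound A K) {ω : ℝ} (hω : 0 < ω)
    (hωa : ∀ T : Triangle, area T = ω * |cross (edge T 0) (edge T 1)|) {G : ℝ}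
    (hG : ∀ w₀ : ℝ, 0 ≤ w₀ → ∃ Λ₀ : ℝ, ∀ Λ : ℝ, Λ₀ ≤ Λ → ∀ P : ℝ, 0 ≤ P →
      ∀ c w : ℕ → ℝ, (∀ k, 0 ≤ c k) → (∀ k, 0 ≤ w k) → (∀ k, c k ≤ 2 ^ k) → w 0 ≤ w₀ →
        (∀ k, c k ≤ 600 * (1 + K) ^ 2 * Λ * (Λ / 2 ^ k) ^ P * w k) →
        (∀ k, w (k + 1) ≤ 19 / 20 * w k + 20 / ω * (c k / 2 ^ k)) →
        ∀ n, ∑ k ∈ Finset.range n, c k ≤ G * Λ)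
    (hp : 1 ≤ p) (hS : DisjointInteriors (𝒯 N₀))
    (hf : ∀ R ∈ 𝒯 N₀, ContinuousOn f R.closedInterior) {H : Triangle → Matrix (Fin 2) (Fin 2) ℝ}
    (hH : ∀ R ∈ 𝒯 N₀, NearQuadratic f (H R) R.closedInterior)
    (hη : Tendsto (fun N => (localError A p f (τ N)).toReal) atTop (nhdsWithin 0 (Set.Ioi 0)))
    {R : Triangle} (hR : R ∈ 𝒯 N₀) :
    ∀ᶠ N in atTop, ∀ n, ∑ k ∈ Finset.range n, ((splits τ N₀ N R k).card : ℝ) ≤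
      G * (area R * (Real.sqrt (H R).det / (localError A p f (τ N)).toReal) ^
        (1 / (1 + p.toReal⁻¹))) := by
  obtain ⟨hP0, -⟩ := inv_toReal_mem hp
  set P := p.toReal⁻¹ with hP
  set D := Real.sqrt (H R).det with hD
  set v := area R with hv
  have hv0 : 0 < v := area_pos R
  have hD0 : 0 < D := Real.sqrt_pos.2 (hH R hR).det_pos
  have hq := (hH R hR).nonneg
  have hshape : ∀ T, 0 ≤ triShape (H R) T := fun T => by
    have := half_maxEdge_le_triShape hq T
    have := maxEdge_nonneg hq T
    linarith
  obtain ⟨Λ₀, hΛ₀⟩ := hG (triShape (H R) R / (D * v)) (div_nonneg (hshape R) (by positivity))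
  have hΛlim : Tendsto (fun N => v * (D / (localError A p f (τ N)).toReal) ^ (1 / (1 + P)))
      atTop atTop := by
    have h1 : Tendsto (fun N => D / (localError A p f (τ N)).toReal) atTop atTop := by
      simp_rw [div_eq_mul_inv]
      exact (tendsto_inv_nhdsGT_zero.comp hη).const_mul_atTop hD0
    exact ((tendsto_rpow_atTop (by positivity)).comp h1).const_mul_atTop hv0
  have hηpos : ∀ᶠ N in atTop, 0 < (localError A p f (τ N)).toReal :=
    (tendsto_nhdsWithin_iff.1 hη).2
  filter_upwards [hΛlim.eventually_ge_atTop Λ₀, hηpos, eventually_ge_atTop N₀] with N hΛN hη0 hN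
  set η := (localError A p f (τ N)).toReal with hηdef
  set Λ := v * (D / η) ^ (1 / (1 + P)) with hΛ
  have hΛ0 : 0 < Λ := by positivity
  refine hΛ₀ Λ hΛN P hP0 (fun k => ((splits τ N₀ N R k).card : ℝ))
    (fun k => (∑ n ∈ splits τ N₀ N R k, triShape (H R) (τ n)) / (D * v)) (fun k => by positivity)
    (fun k => div_nonneg (Finset.sum_nonneg fun n _ => hshape _) (by positivity))
    (fun k => h.seq.card_splits_le hS hN hR k) ?_ ?_ ?_
  · exact div_le_div_of_nonneg_right (h.seq.sum_splits_zero_le hS hN hR hshape) (by positivity)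
  · intro k
    have h1 : ((splits τ N₀ N R k).card : ℝ) * η ≤
        600 * (1 + K) ^ 2 * (∑ n ∈ splits τ N₀ N R k, triShape (H R) (τ n)) * (v / 2 ^ k) ^ P := by
      -- Every bisected triangle of generation `k` has, up to the constant, error at least `η`;
      -- these bounds are summed.
      rw [← nsmul_eq_mul, ← Finset.sum_const, Finset.mul_sum, Finset.sum_mul]
      refine Finset.sum_le_sum fun n hn => ?_
      obtain ⟨⟨hn0, hnN⟩, hd⟩ := mem_splits.1 hn
      exact h.toReal_localError_le hA hK0 hK hp hf hH hn0 hnN.le hR hd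
    have h2 := rpow_scale hv0 hD0 hη0 hP0
    rw [← hΛ] at h2
    have h3 : (Λ / 2 ^ k) ^ P = Λ ^ P / (2 ^ k) ^ P := Real.div_rpow hΛ0.le (by positivity) _
    have h4 : (v / 2 ^ k) ^ P = v ^ P / (2 ^ k) ^ P := Real.div_rpow hv0.le (by positivity) _
    rw [h4] at h1
    rw [h3]
    refine (le_div_iff₀ hη0).2 h1 |>.trans (le_of_eq ?_)
    set W := ∑ n ∈ splits τ N₀ N R k, triShape (H R) (τ n)
    calc 600 * (1 + K) ^ 2 * W * (v ^ P / (2 ^ k) ^ P) / η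
        = 600 * (1 + K) ^ 2 * (v * v ^ P * (D / η)) / (2 ^ k) ^ P * (W / (D * v)) := by
          field_simp
      _ = 600 * (1 + K) ^ 2 * (Λ * Λ ^ P) / (2 ^ k) ^ P * (W / (D * v)) := by rw [h2]
      _ = _ := by ring
  · intro k
    have h1 := h.seq.sum_splits_succ_le hS hN hR hshape k
    have h2 : ∑ n ∈ splits τ N₀ N R k, (triShape (H R) (childLeft (τ n) (ι n)) +
        triShape (H R) (childRight (τ n) (ι n))) ≤
        ∑ n ∈ splits τ N₀ N R k, (19 / 20 * triShape (H R) (τ n) + 20 * (D * (v / 2 ^ k / ω))) := by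
      refine Finset.sum_le_sum fun n hn => ?_
      obtain ⟨⟨hn0, -⟩, hd⟩ := mem_splits.1 hn
      have hnq := (hH R hR).desc hd
      have h3 := triShape_children_le hq hnq.symm hnq.det_pos.le (τ n) (ι n)
        (hnq.maxEdge_le ((hf R hR).mono hd.subset) (h.decision_le n hn0))
      have h4 : |cross (edge (τ n) 0) (edge (τ n) 1)| = v / 2 ^ k / ω := by
        rw [← hd.area_eq, hωa, mul_div_cancel_left₀ _ hω.ne']
      rwa [h4] at h3
    have h3 := h1.trans h2
    rw [Finset.sum_add_distrib, ← Finset.mul_sum, Finset.sum_const, nsmul_eq_mul] at h3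
    rw [div_le_iff₀ (by positivity)]
    refine h3.trans (le_of_eq ?_)
    field_simp

/-! ### The global error -/

theorem volume_frontier_eq_zero (hΩ : IsPolygonalDomain Ω) : volume (frontier Ω) = 0 := by
  obtain ⟨E, hE⟩ := hΩ.frontier_subset
  refine measure_mono_null hE ((measure_biUnion_null_iff E.countable_toSet).2 fun e _ => ?_)
  have hsub : segment ℝ e.1 e.2 ⊆ (affineSpan ℝ {e.1, e.2} : Set Plane) := by
    rw [← convexHull_pair]
    exact convexHull_subset_affineSpan _
  refine measure_mono_null hsub (Measure.addHaar_affineSubspace volume _ fun htop => ?_)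
  have h1 : Module.finrank ℝ (vectorSpan ℝ {e.1, e.2}) = 2 := by
    rw [← direction_affineSpan, htop, AffineSubspace.direction_top, finrank_top]
    simp
  rw [vectorSpan_pair, vsub_eq_sub] at h1
  have := finrank_span_le_card (R := ℝ) ({e.1 - e.2} : Set Plane)
  simp at this
  omega

theorem ae_mem_interior_triangle (T : Triangle) :
    ∀ᵐ x ∂volume.restrict T.closedInterior, x ∈ interior T.closedInterior := by
  rw [ae_restrict_iff' (measurableSet_triangle T)]
  have h := (convex_triangle T).addHaar_frontier volume
  have h2 : ∀ᵐ x ∂(volume : Measure Plane), x ∉ frontier T.closedInterior := measure_eq_zero_iff_ae_notMem.1 h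
  filter_upwards [h2] with x hx hxT
  by_contra hcon
  exact hx ⟨subset_closure hxT, hcon⟩

theorem approximant_eq {S : Finset Triangle} (hS : DisjointInteriors S) {T : Triangle} (hT : T ∈ S)
    {x : Plane} (hx : x ∈ interior T.closedInterior) : approximant A f S x = A T f x := by
  rw [approximant, Finset.sum_eq_single_of_mem T hT, Set.indicator_of_mem hx]
  intro T' hT' hne
  exact Set.indicator_of_notMem (fun hx' => Set.disjoint_left.1 (hS hT' hT hne) hx' hx) _

theorem eLpNorm_approximant_triangle {S : Finset Triangle} (hS : DisjointInteriors S) {T : Triangle}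
    (hT : T ∈ S) : eLpNorm (fun x => f x - approximant A f S x) p
      (volume.restrict T.closedInterior) = localError A p f T := by
  refine eLpNorm_congr_ae ?_
  filter_upwards [ae_mem_interior_triangle T] with x hx
  rw [approximant_eq hS hT hx]

theorem eLpNorm_restrict_biUnion_le {g : Plane → ℝ} {S : Finset Triangle} {η : ℝ≥0∞} (hp : 1 ≤ p)
    (hη : ∀ T ∈ S, eLpNorm g p (volume.restrict T.closedInterior) ≤ η) :
    eLpNorm g p (volume.restrict (⋃ T ∈ S, T.closedInterior)) ≤
      (S.card : ℝ≥0∞) ^ p.toReal⁻¹ * η := by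
  have hp0 : p ≠ 0 := (zero_lt_one.trans_le hp).ne'
  rcases eq_or_ne p ⊤ with rfl | hpt
  · simp only [ENNReal.toReal_top, inv_zero, ENNReal.rpow_zero, one_mul, eLpNorm_exponent_top] at *
    refine eLpNormEssSup_le_of_ae_enorm_bound ?_
    refine (ae_restrict_biUnion_finset_iff _ _ _).2 fun T hT => ?_
    exact (ae_le_eLpNormEssSup (f := g)).mono fun x hx => hx.trans (hη T hT)
  · have hpr : 0 < p.toReal := ENNReal.toReal_pos hp0 hpt
    rw [eLpNorm_eq_lintegral_rpow_enorm_toReal hp0 hpt, one_div,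
      ENNReal.rpow_inv_le_iff hpr, ENNReal.mul_rpow_of_nonneg _ _ hpr.le, ← ENNReal.rpow_mul,
      inv_mul_cancel₀ hpr.ne', ENNReal.rpow_one]
    calc ∫⁻ x in ⋃ T ∈ S, T.closedInterior, ‖g x‖ₑ ^ p.toReal
        ≤ ∑ T ∈ S, ∫⁻ x in T.closedInterior, ‖g x‖ₑ ^ p.toReal := by
          have hu : ⋃ T ∈ S, T.closedInterior = ⋃ T : S, T.1.closedInterior := by ext x; simp
          rw [← Finset.sum_coe_sort S, ← tsum_fintype (L := .unconditional _), hu]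
          exact lintegral_iUnion_le _ _
      _ ≤ ∑ T ∈ S, η ^ p.toReal := by
          refine Finset.sum_le_sum fun T hT => ?_
          rw [← ENNReal.rpow_inv_le_iff hpr, ← one_div,
            ← eLpNorm_eq_lintegral_rpow_enorm_toReal hp0 hpt]
          exact hη T hT
      _ = (S.card : ℝ≥0∞) * η ^ p.toReal := by rw [Finset.sum_const, nsmul_eq_mul]

/-- The part of `R` outside `Ω` lies in the boundary of `Ω`, a null set; this is where the domain
being polygonal is used. -/
theorem volume_inter_eq (hΩ : IsPolygonalDomain Ω) {R : Triangle}
    (hR : R.closedInterior ⊆ closure Ω) :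
    volume (interior R.closedInterior ∩ Ω) = ENNReal.ofReal (area R) := by
  rw [← volume_triangle]
  refine le_antisymm (measure_mono (Set.inter_subset_left.trans interior_subset)) ?_
  have hsub : R.closedInterior ⊆
      (interior R.closedInterior ∩ Ω) ∪ (frontier R.closedInterior ∪ frontier Ω) := by
    intro x hx
    by_cases h1 : x ∈ interior R.closedInterior
    · by_cases h2 : x ∈ Ω
      · exact Or.inl ⟨h1, h2⟩
      · exact Or.inr (Or.inr ⟨hR hx, fun h3 => h2 (interior_subset h3)⟩)
    · exact Or.inr (Or.inl ⟨subset_closure hx, h1⟩)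
  refine (measure_mono hsub).trans ((measure_union_le _ _).trans (le_of_eq ?_))
  rw [measure_union_null ((convex_triangle R).addHaar_frontier volume) (volume_frontier_eq_zero hΩ),
    add_zero]

/-- The left side is a Riemann sum with each value within one percent of a lower bound for the
integrand; the factor 2 absorbs `(99/100)^(-t)` for `t ≤ 1`. -/
theorem sum_area_le_lintegral (hΩ : IsPolygonalDomain Ω) {S : Finset Triangle}
    (hS : DisjointInteriors S) (hSΩ : ∀ R ∈ S, R.closedInterior ⊆ closure Ω)
    {H : Triangle → Matrix (Fin 2) (Fin 2) ℝ}
    (hH : ∀ R ∈ S, ∀ x ∈ interior R.closedInterior ∩ Ω,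
      99 / 100 * Real.sqrt (H R).det ≤ Real.sqrt (hessian f x).det) {t : ℝ} (ht0 : 0 ≤ t)
    (ht1 : t ≤ 1) :
    ENNReal.ofReal (∑ R ∈ S, area R * Real.sqrt (H R).det ^ t) ≤
      2 * ∫⁻ x in Ω, ‖Real.sqrt (hessian f x).det‖ₑ ^ t := by
  have hmeas : ∀ R ∈ S, MeasurableSet (interior R.closedInterior ∩ Ω) := fun R _ =>
    isOpen_interior.measurableSet.inter hΩ.isOpen.measurableSet
  calc ENNReal.ofReal (∑ R ∈ S, area R * Real.sqrt (H R).det ^ t)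
      = ∑ R ∈ S, ENNReal.ofReal (area R * Real.sqrt (H R).det ^ t) :=
        ENNReal.ofReal_sum_of_nonneg fun R _ =>
          mul_nonneg (area_pos R).le (Real.rpow_nonneg (Real.sqrt_nonneg _) _)
    _ ≤ ∑ R ∈ S, 2 * ∫⁻ x in interior R.closedInterior ∩ Ω,
          ‖Real.sqrt (hessian f x).det‖ₑ ^ t := by
        refine Finset.sum_le_sum fun R hR => ?_
        have h1 : ∫⁻ x in interior R.closedInterior ∩ Ω,
            ENNReal.ofReal ((99 / 100 * Real.sqrt (H R).det) ^ t) ≤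
            ∫⁻ x in interior R.closedInterior ∩ Ω, ‖Real.sqrt (hessian f x).det‖ₑ ^ t := by
          refine setLIntegral_mono' (hmeas R hR) fun x hx => ?_
          rw [Real.enorm_of_nonneg (Real.sqrt_nonneg _),
            ENNReal.ofReal_rpow_of_nonneg (Real.sqrt_nonneg _) ht0]
          exact ENNReal.ofReal_le_ofReal (Real.rpow_le_rpow (by positivity) (hH R hR x hx) ht0)
        refine le_trans ?_ (mul_le_mul_right h1 2)
        rw [setLIntegral_const, volume_inter_eq hΩ (hSΩ R hR),
          ← ENNReal.ofReal_mul (by positivity), show (2 : ℝ≥0∞) = ENNReal.ofReal 2 by simp,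
          ← ENNReal.ofReal_mul (by norm_num)]
        refine ENNReal.ofReal_le_ofReal ?_
        rw [Real.mul_rpow (by norm_num) (Real.sqrt_nonneg _)]
        have h2 : (99 / 100 : ℝ) ≤ (99 / 100) ^ t := by
          simpa using Real.rpow_le_rpow_of_exponent_ge (show (0 : ℝ) < 99 / 100 by norm_num)
            (by norm_num) ht1
        have h3 : 0 ≤ Real.sqrt (H R).det ^ t * area R :=
          mul_nonneg (Real.rpow_nonneg (Real.sqrt_nonneg _) _) (area_pos R).le
        nlinarith [mul_le_mul_of_nonneg_right h2 h3]
    _ = 2 * ∫⁻ x in ⋃ R ∈ S, interior R.closedInterior ∩ Ω,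
          ‖Real.sqrt (hessian f x).det‖ₑ ^ t := by
        rw [← Finset.mul_sum, lintegral_biUnion_finset (fun R hR R' hR' hne =>
          (hS hR hR' hne).mono Set.inter_subset_left Set.inter_subset_left) hmeas]
    _ ≤ 2 * ∫⁻ x in Ω, ‖Real.sqrt (hessian f x).det‖ₑ ^ t :=
        mul_le_mul_right (lintegral_mono_set
          (Set.iUnion₂_subset fun R _ => Set.inter_subset_right)) 2

end

section

/-! ### The convergence theorem -/

variable {A : Triangle → (Plane → ℝ) → (Plane →ᵃ[ℝ] ℝ)} {p : ℝ≥0∞} {f : Plane → ℝ} {m : ℝ}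
  {Ω : Set Plane} {S₀ : Finset Triangle}
  {N₀ N : ℕ} {𝒯 : ℕ → Finset Triangle} {τ : ℕ → Triangle} {ι : ℕ → Fin 3}

theorem GreedySeq.tendsto_localError (h : GreedySeq A p f N₀ 𝒯 τ ι) (hA : IsApproxOperator A)
    (hp : 1 ≤ p) (hf : StronglyConvexC2 Ω f m) (hS : IsTriangulation (𝒯 N₀) Ω) :
    (∀ᶠ N in atTop, localError A p f (τ N) ≠ ⊤) ∧
      Tendsto (fun N => (localError A p f (τ N)).toReal) atTop (nhdsWithin 0 (Set.Ioi 0)) := by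
  have hsmall : ∀ ε > 0, ∀ᶠ N in atTop, localError A p f (τ N) ≤ ENNReal.ofReal ε := by
    intro ε hε
    obtain ⟨L, hL, hup⟩ := exists_localError_le hA hp hf hS hε
    obtain ⟨N₁, hN₁, hlt⟩ := h.exists_maxEdge_lt hA hp hf hS hL
    filter_upwards [eventually_ge_atTop N₁] with N hN
    have hτ := h.seq.mem N (hN₁.trans hN)
    exact hup _ (h.seq.triangle_subset hS (hN₁.trans hN) hτ) (hlt N hN _ hτ)
  have htop : ∀ᶠ N in atTop, localError A p f (τ N) ≠ ⊤ :=
    (hsmall 1 one_pos).mono fun N hN => ne_top_of_le_ne_top ENNReal.ofReal_ne_top hN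
  refine ⟨htop, tendsto_nhdsWithin_iff.2 ⟨?_, ?_⟩⟩
  · rw [Metric.tendsto_nhds]
    intro ε hε
    filter_upwards [hsmall (ε / 2) (half_pos hε)] with N hN
    have := ENNReal.toReal_mono ENNReal.ofReal_ne_top hN
    rw [ENNReal.toReal_ofReal (by linarith)] at this
    rw [Real.dist_0_eq_abs, abs_of_nonneg ENNReal.toReal_nonneg]
    linarith
  · filter_upwards [htop, eventually_ge_atTop N₀] with N hN hN₀
    refine ENNReal.toReal_pos ?_ hN
    obtain ⟨ε, hε, hlow⟩ := exists_le_localError (A := A) hp hf (area_pos (τ N))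
    have := hlow (τ N) (h.seq.triangle_subset hS hN₀ (h.seq.mem N hN₀)) le_rfl
    exact ((ENNReal.ofReal_pos.2 hε).trans_le this).ne'

theorem GreedySeq.eLpNorm_sub_approximant_le (h : GreedySeq A p f N₀ 𝒯 τ ι) (hp : 1 ≤ p)
    (hS : IsTriangulation (𝒯 N₀) Ω) (hcard : (𝒯 N₀).card = N₀) (hN : N₀ ≤ N) :
    eLpNorm (fun x => f x - approximant A f (𝒯 N) x) p (volume.restrict Ω) ≤
      (N : ℝ≥0∞) ^ p.toReal⁻¹ * localError A p f (τ N) := by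
  have hsub : Ω ⊆ ⋃ T ∈ 𝒯 N, T.closedInterior := by
    rw [h.seq.union_eq hN, hS.union]; exact subset_closure
  have hd := h.seq.disjoint hS.disjoint hN
  have hc : (𝒯 N).card ≤ N := by
    have := h.seq.card_le hN
    rw [hcard, add_sub_cancel] at this
    exact_mod_cast this
  refine (eLpNorm_mono_measure _ (Measure.restrict_mono_set volume hsub)).trans ?_
  refine (eLpNorm_restrict_biUnion_le (η := localError A p f (τ N)) hp fun T hT => ?_).trans ?_
  · rw [eLpNorm_approximant_triangle hd hT]
    exact h.localError_le N hN T hT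
  · gcongr

/-- The count is restarted at a stage `N₁` all of whose triangles are nearly quadratic. Each later
step bisects below one of them, so `N - N₁` is a sum of the counts. -/
theorem GreedySeq.eventually_card_le (h : GreedySeq A p f N₀ 𝒯 τ ι) (hA : IsApproxOperator A)
    {K : ℝ} (hK0 : 0 ≤ K) (hK : UniformBound A K) {ω : ℝ} (hω : 0 < ω)
    (hωa : ∀ T : Triangle, area T = ω * |cross (edge T 0) (edge T 1)|) {G : ℝ}
    (hG : ∀ w₀ : ℝ, 0 ≤ w₀ → ∃ Λ₀ : ℝ, ∀ Λ : ℝ, Λ₀ ≤ Λ → ∀ P : ℝ, 0 ≤ P →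
      ∀ c w : ℕ → ℝ, (∀ k, 0 ≤ c k) → (∀ k, 0 ≤ w k) → (∀ k, c k ≤ 2 ^ k) → w 0 ≤ w₀ →
        (∀ k, c k ≤ 600 * (1 + K) ^ 2 * Λ * (Λ / 2 ^ k) ^ P * w k) →
        (∀ k, w (k + 1) ≤ 19 / 20 * w k + 20 / ω * (c k / 2 ^ k)) →
        ∀ n, ∑ k ∈ Finset.range n, c k ≤ G * Λ)
    (hp : 1 ≤ p) (hf : StronglyConvexC2 Ω f m) (hS : IsTriangulation (𝒯 N₀) Ω) :
    ∃ N₁, N₀ ≤ N₁ ∧ ∃ H : Triangle → Matrix (Fin 2) (Fin 2) ℝ,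
      (∀ R ∈ 𝒯 N₁, ∀ x ∈ interior R.closedInterior ∩ Ω,
        99 / 100 * Real.sqrt (H R).det ≤ Real.sqrt (hessian f x).det) ∧
      ∀ᶠ N : ℕ in atTop, (N : ℝ) * (localError A p f (τ N)).toReal ^ (1 / (1 + p.toReal⁻¹)) ≤
        2 * G * ∑ R ∈ 𝒯 N₁, area R * Real.sqrt (H R).det ^ (1 / (1 + p.toReal⁻¹)) := by
  obtain ⟨δ, hδ, hδR⟩ : ∃ δ > 0, ∀ R₀ ∈ 𝒯 N₀, ∀ R : Triangle,
      R.closedInterior ⊆ R₀.closedInterior → maxEdge 1 R < δ →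
      ∃ H, NearQuadratic f H R.closedInterior ∧ ∀ x ∈ interior R.closedInterior ∩ Ω,
        99 / 100 * Real.sqrt H.det ≤ Real.sqrt (hessian f x).det := by
    have hex : ∀ R₀ ∈ 𝒯 N₀, _ := fun R₀ hR₀ =>
      hf.exists_nearQuadratic (h.seq.triangle_subset hS le_rfl hR₀)
    choose! δ hδ hδR using hex
    obtain ⟨R₁, hR₁, hmin⟩ := Finset.exists_min_image (𝒯 N₀) δ ⟨_, h.seq.mem N₀ le_rfl⟩
    exact ⟨δ R₁, hδ R₁ hR₁, fun R₀ hR₀ R hR hlt => hδR R₀ hR₀ R hR (hlt.trans_le (hmin R₀ hR₀))⟩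
  obtain ⟨N₁, hN₁, hlt⟩ := h.exists_maxEdge_lt hA hp hf hS hδ
  have hex : ∀ R ∈ 𝒯 N₁, ∃ H, NearQuadratic f H R.closedInterior ∧
      ∀ x ∈ interior R.closedInterior ∩ Ω,
        99 / 100 * Real.sqrt H.det ≤ Real.sqrt (hessian f x).det := by
    intro R hR
    obtain ⟨R₀, hR₀, k, hk⟩ := h.seq.exists_desc hN₁ R hR
    exact hδR R₀ hR₀ R hk.subset (hlt N₁ le_rfl R hR)
  choose! H hH hdet using hex
  refine ⟨N₁, hN₁, H, hdet, ?_⟩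
  obtain ⟨htop, hη⟩ := h.tendsto_localError hA hp hf hS
  set t := 1 / (1 + p.toReal⁻¹) with ht
  have hP0 := (inv_toReal_mem hp).1
  have h₁ := h.mono hN₁
  have hd₁ := h.seq.disjoint hS.disjoint hN₁
  have hev : ∀ᶠ N in atTop, ∀ R ∈ 𝒯 N₁, ∀ n,
      ∑ k ∈ Finset.range n, ((splits τ N₁ N R k).card : ℝ) ≤
        G * (area R * (Real.sqrt (H R).det / (localError A p f (τ N)).toReal) ^ t) :=
    (Filter.eventually_all_finset _).2 fun R hR =>
      h₁.eventually_sum_splits_le hA hK0 hK hω hωa hG hp hd₁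
        (fun R hR => hf.continuousOn (h.seq.triangle_subset hS hN₁ hR)) hH hη hR
  -- For `N ≥ 2 N₁` the steps before `N₁` cost at most a factor 2.
  filter_upwards [hev, eventually_ge_atTop (2 * N₁), (tendsto_nhdsWithin_iff.1 hη).2]
    with N hN hN2 hη0
  have hη0 : 0 < (localError A p f (τ N)).toReal := hη0
  set η := (localError A p f (τ N)).toReal
  obtain ⟨n, hn⟩ := h₁.seq.exists_sub_le (show N₁ ≤ N by omega)
  have h1 : (N : ℝ) - N₁ ≤ ∑ R ∈ 𝒯 N₁, G * (area R * (Real.sqrt (H R).det / η) ^ t) :=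
    hn.trans (Finset.sum_le_sum fun R hR => hN R hR n)
  have h2 : (N : ℝ) ≤ 2 * ((N : ℝ) - N₁) := by
    have : (2 * N₁ : ℝ) ≤ N := by exact_mod_cast hN2
    linarith
  have hηt : 0 < η ^ t := Real.rpow_pos_of_pos hη0 _
  have h3 : ∑ R ∈ 𝒯 N₁, G * (area R * (Real.sqrt (H R).det / η) ^ t) =
      G * (∑ R ∈ 𝒯 N₁, area R * Real.sqrt (H R).det ^ t) / η ^ t := by
    rw [Finset.mul_sum, Finset.sum_div]
    refine Finset.sum_congr rfl fun R _ => ?_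
    rw [Real.div_rpow (Real.sqrt_nonneg _) hη0.le]
    ring
  rw [h3] at h1
  calc (N : ℝ) * η ^ t ≤
        2 * (G * (∑ R ∈ 𝒯 N₁, area R * Real.sqrt (H R).det ^ t) / η ^ t) * η ^ t :=
        mul_le_mul_of_nonneg_right (by linarith) hηt.le
    _ = 2 * G * ∑ R ∈ 𝒯 N₁, area R * Real.sqrt (H R).det ^ t := by field_simp

theorem mul_rpow_mul_le {N : ℕ} {P η M : ℝ} (hP : 0 ≤ P) (hη : 0 ≤ η)
    (h : (N : ℝ) * η ^ (1 / (1 + P)) ≤ M) : (N : ℝ) * ((N : ℝ) ^ P * η) ≤ M ^ (1 + P) := by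
  have hN : (0 : ℝ) ≤ N := Nat.cast_nonneg N
  have hP1 : 1 + P ≠ 0 := by positivity
  calc (N : ℝ) * ((N : ℝ) ^ P * η) = ((N : ℝ) * η ^ (1 / (1 + P))) ^ (1 + P) := by
        rw [Real.mul_rpow hN (by positivity), ← Real.rpow_mul hη, one_div_mul_cancel hP1,
          Real.rpow_one, Real.rpow_add_of_nonneg hN zero_le_one hP, Real.rpow_one, mul_assoc]
    _ ≤ M ^ (1 + P) := Real.rpow_le_rpow (by positivity) h (by positivity)

theorem eLpNorm_inv_add_one (hp : 1 ≤ p) (g : Plane → ℝ) (μ : Measure Plane) :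
    eLpNorm g (p⁻¹ + 1)⁻¹ μ = (∫⁻ x, ‖g x‖ₑ ^ (1 / (1 + p.toReal⁻¹)) ∂μ) ^ (1 + p.toReal⁻¹) := by
  have hp0 : p ≠ 0 := (zero_lt_one.trans_le hp).ne'
  have hinv : p⁻¹ ≠ ⊤ := ENNReal.inv_ne_top.2 hp0
  have hr : ((p⁻¹ + 1)⁻¹).toReal = 1 / (1 + p.toReal⁻¹) := by
    rw [ENNReal.toReal_inv, ENNReal.toReal_add hinv ENNReal.one_ne_top, ENNReal.toReal_inv,
      ENNReal.toReal_one, add_comm, one_div]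
  have h0 : (p⁻¹ + 1)⁻¹ ≠ 0 := ENNReal.inv_ne_zero.2 (ENNReal.add_ne_top.2 ⟨hinv, ENNReal.one_ne_top⟩)
  have ht : (p⁻¹ + 1)⁻¹ ≠ ⊤ := ENNReal.inv_ne_top.2 (by simp)
  rw [eLpNorm_eq_lintegral_rpow_enorm_toReal h0 ht, hr, one_div_one_div]

end

end GreedyBisection

end

open GreedyBisection

theorem mainTheorem1
    (A : GreedyBisection.Triangle → (GreedyBisection.Plane → ℝ) →
      (GreedyBisection.Plane →ᵃ[ℝ] ℝ))
    (hA : GreedyBisection.IsApproxOperator A) :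
    ∃ C : ℝ≥0, ∀ (p : ℝ≥0∞), 1 ≤ p →
      ∀ (Ω : Set GreedyBisection.Plane), GreedyBisection.IsPolygonalDomain Ω →
      ∀ (S₀ : Finset GreedyBisection.Triangle), GreedyBisection.IsTriangulation S₀ Ω →
      ∀ (f : GreedyBisection.Plane → ℝ), ContDiffOn ℝ 2 f (closure Ω) →
      ∀ (m : ℝ), 0 < m →
        (∀ x ∈ Ω,
          (GreedyBisection.hessian f x - m • (1 : Matrix (Fin 2) (Fin 2) ℝ)).PosSemidef) →
      ∀ (𝒯 : ℕ → Finset GreedyBisection.Triangle), GreedyBisection.IsGreedyRun A p f S₀ 𝒯 →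
        limsup (fun N : ℕ => (N : ℝ≥0∞) *
            eLpNorm (fun x => f x - GreedyBisection.approximant A f (𝒯 N) x) p
              (volume.restrict Ω)) atTop
          ≤ (C : ℝ≥0∞) * eLpNorm (fun x => Real.sqrt (GreedyBisection.hessian f x).det)
              (p⁻¹ + 1)⁻¹ (volume.restrict Ω) := by
  obtain ⟨K, hK0, hK⟩ := hA.exists_uniform_bound
  obtain ⟨ω, hω, hωa⟩ := exists_area_eq
  obtain ⟨G, hG0, hG⟩ := exists_sum_count_le (B := 600 * (1 + K) ^ 2) (C := 20 / ω)
    (by positivity) (by positivity)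
  -- One factor 2 comes from `N ≥ 2 N₁` and one from the Riemann sum. The power `(4 G)^(1 + 1/p)` is
  -- made independent of `p` by `1 + 1/p ≤ 2`, with 1 added so that the base is at least 1.
  refine ⟨((1 + 4 * G) ^ 2).toNNReal, ?_⟩
  intro p hp Ω hΩ S₀ hS₀ f hf m hm hess 𝒯 hrun
  obtain ⟨τ, ι, h⟩ := hrun.exists_greedySeq
  have hfc : StronglyConvexC2 Ω f m := ⟨hΩ.isOpen, hf, hm, hess⟩
  have hS : IsTriangulation (𝒯 S₀.card) Ω := by rw [hrun.start]; exact hS₀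
  have hcard : (𝒯 S₀.card).card = S₀.card := by rw [hrun.start]
  obtain ⟨N₁, hN₁, H, hdet, hev⟩ := h.eventually_card_le hA hK0 hK hω hωa hG hp hfc hS
  obtain ⟨htop, -⟩ := h.tendsto_localError hA hp hfc hS
  obtain ⟨hP0, hP1⟩ := inv_toReal_mem hp
  rw [eLpNorm_inv_add_one hp]
  set P := p.toReal⁻¹ with hP
  set t := 1 / (1 + P) with ht
  have ht0 : 0 ≤ t := by positivity
  have ht1 : t ≤ 1 := (div_le_one (by positivity)).2 (by linarith)
  have hJ := sum_area_le_lintegral hΩ (h.seq.disjoint hS.disjoint hN₁)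
    (fun R hR => h.seq.triangle_subset hS hN₁ hR) hdet ht0 ht1
  set J := ∫⁻ x in Ω, ‖Real.sqrt (hessian f x).det‖ₑ ^ t
  set M := ∑ R ∈ 𝒯 N₁, area R * Real.sqrt (H R).det ^ t
  have hM0 : 0 ≤ M := Finset.sum_nonneg fun R _ =>
    mul_nonneg (area_pos R).le (Real.rpow_nonneg (Real.sqrt_nonneg _) _)
  refine limsup_le_of_le (h := ?_)
  filter_upwards [hev, htop, eventually_ge_atTop S₀.card] with N hN hNtop hN₀
  set η := (localError A p f (τ N)).toReal with hη
  have hη0 : 0 ≤ η := ENNReal.toReal_nonneg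
  have hcast : (N : ℝ≥0∞) = ENNReal.ofReal N := (ENNReal.ofReal_natCast N).symm
  calc (N : ℝ≥0∞) * eLpNorm (fun x => f x - approximant A f (𝒯 N) x) p (volume.restrict Ω)
      ≤ (N : ℝ≥0∞) * ((N : ℝ≥0∞) ^ P * localError A p f (τ N)) := by
        gcongr
        exact h.eLpNorm_sub_approximant_le hp hS hcard hN₀
    _ = ENNReal.ofReal (N * ((N : ℝ) ^ P * η)) := by
        rw [hcast, ENNReal.ofReal_rpow_of_nonneg (Nat.cast_nonneg N) hP0,
          ← ENNReal.ofReal_toReal hNtop, ← ENNReal.ofReal_mul (by positivity),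
          ← ENNReal.ofReal_mul (Nat.cast_nonneg N)]
    _ ≤ ENNReal.ofReal ((2 * G * M) ^ (1 + P)) :=
        ENNReal.ofReal_le_ofReal (mul_rpow_mul_le hP0 hη0 hN)
    _ = (ENNReal.ofReal (2 * G) * ENNReal.ofReal M) ^ (1 + P) := by
        rw [← ENNReal.ofReal_mul (by positivity),
          ENNReal.ofReal_rpow_of_nonneg (by positivity) (by positivity)]
    _ ≤ (ENNReal.ofReal (2 * G) * (2 * J)) ^ (1 + P) := by gcongr
    _ = ENNReal.ofReal ((4 * G) ^ (1 + P)) * J ^ (1 + P) := by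
        rw [← mul_assoc, ENNReal.mul_rpow_of_nonneg _ _ (by positivity),
          show (2 : ℝ≥0∞) = ENNReal.ofReal 2 by simp, ← ENNReal.ofReal_mul (by positivity),
          ENNReal.ofReal_rpow_of_nonneg (by positivity) (by positivity)]
        ring_nf
    _ ≤ ENNReal.ofReal ((1 + 4 * G) ^ 2) * J ^ (1 + P) := by
        refine mul_le_mul_left (ENNReal.ofReal_le_ofReal ?_) _
        calc (4 * G) ^ (1 + P) ≤ (1 + 4 * G) ^ (1 + P) :=
              Real.rpow_le_rpow (by positivity) (by linarith) (by positivity)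
          _ ≤ (1 + 4 * G) ^ (2 : ℝ) :=
              Real.rpow_le_rpow_of_exponent_le (by linarith) (by linarith)
          _ = (1 + 4 * G) ^ 2 := by norm_cast
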